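/- Write $e(x)=e^{2\pi i x}$ and let $\mathfrak H$ be the upper half plane. Let $r\in\{1,3,5,7\}$ and let $k\ge 0$ be an integer such that $\kappa:=k+\frac{r+1}{2}$ is even. **Jacobi forms.** Let $D_r=\{x\in\mathbb Z^r: x_1+\dots+x_r\in 2\mathbb Z\}$ with $\beta(x,y)=\sum_i x_iy_i$, $\beta(x)=\frac12\beta(x,x)$ (extended to $\mathbb C^r$), and dual lattice $D_r^\sharp=\{y\in\mathbb Q^r:\beta(x,y)\in\mathbb Z\ \forall x\in D_r\}$; one has $[D_r^\sharp:D_r]=4$. Let $J_{\kappa,D_r}$ be the space of holomorphic $\phi:\mathfrak H\times\mathbb C^r\to\mathbb C$ such that (i) $\phi\bigl(\frac{a\tau+b}{c\tau+d},\frac{z}{c\tau+d}\bigr)e\bigl(\frac{-c\beta(z)}{c\tau+d}\bigr)(c\tau+d)^{-\kappa}=\phi(\tau,z)$ for all $\begin{pmatrix}a&b\\c&d\end{pmatrix}\in SL(2,\mathbb Z)$; (ii) $\phi(\tau,z+\lambda\tau+\mu)\,e(\tau\beta(\lambda)+\beta(\lambda,z))=\phi(\tau,z)$ for all $\lambda,\mu\in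 D_r$; (iii) $\phi(\tau,z)=\sum_{n'\in\mathbb Z,\ r'\in D_r^\sharp}C(n',r')\,e(n'\tau+\beta(r',z))$ with $C(n',r')=0$ unless $n'-\beta(r')\ge 0$. The subspace $J^{cusp}_{\kappa,D_r}$ of cusp forms is defined by requiring $C(n',r')=0$ unless $n'-\beta(r')>0$. For an odd prime $p$, $\phi|T^J(p)$ is the function $\sum_{n',r'} C^*(n',r')\,e(n'\tau+\beta(r',z))$ with $$C^*(n',r')=C(p^2n',pr')+p^{\kappa-r-2}\Bigl(\bigl(\tfrac{-1}{p}\bigr)p\Bigr)^{\frac{r+1}{2}}\Bigl(\tfrac{2[D_r^\sharp:D_r]}{p}\Bigr)\Bigl(\tfrac{n'-\beta(r')}{p}\Bigr)C(n',r')+p^{2\kappa-r-2}\sum_{\lambda\in D_r/pD_r}C\Bigl(\tfrac{n'-\beta(r',\lambda)+\beta(\lambda)}{p^2},\tfrac{r'-\lambda}{p}\Bigr),$$ where $C$ is $0$ outside $\mathbb Z\times D_r^\sharp$ and $(\frac{\cdot}{p})$ is the Legendre symbol, extended to rational numbers with denominator prime to $p$. **Theta decomposition.** Let $v_0=0$,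 $v_1=\frac12(e_1+\dots+e_r)$, $v_2=e_r$, $v_3=\frac12(e_1+\dots+e_{r-1}-e_r)$, representatives of $D_r^\sharp/D_r$. For $\phi\in J_{\kappa,D_r}$ put $h_j(\tau)=\sum_{n'\in\mathbb Z}C(n',v_j)\,e((n'-\beta(v_j))\tau)$ and $$\mathcal J(\phi)(\tau)=\sum_{j=0}^3h_j(8\tau).$$ **Half-integral weight.** Let $\theta(\tau)=\sum_{m\in\mathbb Z}e(m^2\tau)$ and $j(A,\tau)=\theta(A\tau)/\theta(\tau)$ for $A\in\Gamma_0(4)$. Let $M_{k+1/2}(8)$ be the space of holomorphic $f:\mathfrak H\to\mathbb C$ with $j(A,\tau)^{-2k-1}f(A\tau)=f(\tau)$ for all $A\in\Gamma_0(8)$ and such that $f^2$ is a modular form of weight $2k+1$ for $\Gamma_0(8)$ with character $\bigl(\frac{-4}{d}\bigr)$; $S_{k+1/2}(8)$ is the subspace of those $f$ for which $f^2$ is a cusp form. Let $M^{+,-r}_{k+1/2}(8)$ be the space of $g=\sum_{n\ge0}c(n)q^n\in M_{k+1/2}(8)$, $q=e(\tau)$, with $c(n)=0$ unless $n\equiv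 0,4,-r \bmod 8$, and $S^{+,-r}_{k+1/2}(8)=M^{+,-r}_{k+1/2}(8)\cap S_{k+1/2}(8)$. For an odd prime $p$ and $f=\sum_{n\ge 0}c(n)q^n$ put $$f|T(p^2)=\sum_{n\ge0}\Bigl\{c(p^2n)+\Bigl(\tfrac{(-1)^kn}{p}\Bigr)p^{k-1}c(n)+p^{2k-1}c(n/p^2)\Bigr\}q^n,$$ with $c(n/p^2)=0$ if $p^2\nmid n$. **Proposition.** Every $\phi\in J_{\kappa,D_r}$ has the theta decomposition $\phi(\tau,z)=\sum_{j=0}^3h_j(\tau)\,\theta_{r,j}(\tau,z)$, where $\theta_{r,j}(\tau,z)=\sum_{y\in v_j+D_r}e(\tau\beta(y)+\beta(y,z))$. The map $\mathcal J$ is an isomorphism of complex vector spaces $$\mathcal J:\ J_{k+\frac{r+1}{2},D_r}\ \xrightarrow{\ \cong\ }\ M^{+,-r}_{k+\frac12}(8),$$ and it is an isomorphism of Hecke modules: for every odd prime $p$ and every $\phi\in J_{\kappa,D_r}$ one has $\phi|T^J(p)\in J_{\kappa,D_r}$ and $$\mathcal J(\phi|T^J(p))=\mathcal J(\phi)|T(p^2).$$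 Moreover, the restriction of $\mathcal J$ to cusp forms is an isomorphism $$\mathcal J:\ J^{cusp}_{k+\frac{r+1}{2},D_r}\ \xrightarrow{\ \cong\ }\ S^{+,-r}_{k+\frac12}(8).$$ -/

import Mathlib

open UpperHalfPlane
open scoped MatrixGroups ModularForm Manifold

namespace JacobiD

noncomputable section

/-- `e(x) = exp(2πix)`. -/
def e (x : ℂ) : ℂ := Complex.exp (2 * Real.pi * Complex.I * x)

/-! ### Lattices

Lattices are subgroups `L` of `ℚⁿ` (of full rank), with the bilinear form
`β(x, y) = x₁y₁ + ⋯ + xₙyₙ`; then `L ⊗ ℚ = ℚⁿ` and `L ⊗ ℂ = ℂⁿ`. -/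

/-- The rational bilinear form `β(x, y)`. -/
def bil {n : ℕ} (x y : Fin n → ℚ) : ℚ := ∑ i, x i * y i

/-- The quadratic form `β(x) = β(x, x) / 2`. -/
def quad {n : ℕ} (x : Fin n → ℚ) : ℚ := bil x x / 2

/-- `β(x, z)` for a rational vector `x` and a complex vector `z`. -/
def bilC {n : ℕ} (x : Fin n → ℚ) (z : Fin n → ℂ) : ℂ := ∑ i, (x i : ℂ) * z i

/-- `β(z) = β(z, z) / 2` for a complex vector `z`. -/
def quadC {n : ℕ} (z : Fin n → ℂ) : ℂ := (∑ i, z i * z i) / 2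

/-- The dual lattice `L♯ = {y ∈ L ⊗ ℚ : β(x, y) ∈ ℤ for all x ∈ L}`. -/
def dual {n : ℕ} (L : AddSubgroup (Fin n → ℚ)) : AddSubgroup (Fin n → ℚ) where
  carrier := {y | ∀ x ∈ L, ∃ a : ℤ, bil x y = a}
  zero_mem' := fun x _ => ⟨0, by simp [bil]⟩
  add_mem' := by
    intro y y' hy hy' x hx
    obtain ⟨a, ha⟩ := hy x hx
    obtain ⟨b, hb⟩ := hy' x hx
    refine ⟨a + b, ?_⟩
    rw [Int.cast_add, ← ha, ← hb]
    simp [bil, mul_add, Finset.sum_add_distrib]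
  neg_mem' := by
    intro y hy x hx
    obtain ⟨a, ha⟩ := hy x hx
    refine ⟨-a, ?_⟩
    rw [Int.cast_neg, ← ha]
    simp [bil]

/-- The lattice `D_r = {x ∈ ℤʳ : x₁ + ⋯ + x_r even}`. -/
def latticeD (r : ℕ) : AddSubgroup (Fin r → ℚ) where
  carrier := {x | ∃ a : Fin r → ℤ, (∀ i, x i = a i) ∧ Even (∑ i, a i)}
  zero_mem' := ⟨0, by simp, by simp⟩
  add_mem' := by
    rintro x y ⟨a, ha, ha'⟩ ⟨b, hb, hb'⟩
    refine ⟨a + b, fun i => by simp [ha, hb], ?_⟩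
    simpa [Finset.sum_add_distrib] using ha'.add hb'
  neg_mem' := by
    rintro x ⟨a, ha, ha'⟩
    exact ⟨-a, fun i => by simp [ha], by simpa using ha'⟩

/-- The representatives `v₀, v₁, v₂, v₃` of `D_r♯ / D_r` (for odd `r`):
`v₀ = 0`, `v₁ = (e₁ + ⋯ + e_r) / 2`, `v₂ = e_r`, `v₃ = (e₁ + ⋯ + e_{r-1} - e_r) / 2`. -/
def rep (r : ℕ) (j : Fin 4) : Fin r → ℚ := fun i =>
  match j with
  | 0 => 0
  | 1 => 1 / 2
  | 2 => if (i : ℕ) + 1 = r then 1 else 0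
  | 3 => if (i : ℕ) + 1 = r then -1 / 2 else 1 / 2

/-! ### Jacobi forms of lattice index -/

/-- `c` is the family of Fourier coefficients of `φ`, extended by `0` outside `ℤ × L♯`:
`φ(τ, z) = ∑_{n' ∈ ℤ} ∑_{r' ∈ L♯} c(n', r') e(n'τ + β(r', z))`.
By uniqueness of Fourier expansions `φ` has at most one such family. -/
def IsFourierExpansion {n : ℕ} (L : AddSubgroup (Fin n → ℚ)) (φ : ℍ → (Fin n → ℂ) → ℂ)
    (c : ℚ → (Fin n → ℚ) → ℂ) : Prop :=
  (∀ m x, c m x ≠ 0 → (∃ a : ℤ, m = a) ∧ x ∈ dual L) ∧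
  ∀ (τ : ℍ) (z : Fin n → ℂ),
    HasSum (fun p : ℤ × dual L =>
      c (p.1 : ℚ) (p.2 : Fin n → ℚ) * e ((p.1 : ℂ) * (τ : ℂ) + bilC (p.2 : Fin n → ℚ) z)) (φ τ z)

/-- The Fourier coefficients of `φ` (an arbitrary family if `φ` has no Fourier expansion). -/
def fourierCoeff {n : ℕ} (L : AddSubgroup (Fin n → ℚ)) (φ : ℍ → (Fin n → ℂ) → ℂ) :
    ℚ → (Fin n → ℚ) → ℂ :=
  Classical.epsilon (IsFourierExpansion L φ)

/-- Holomorphy on `ℍ × ℂⁿ` and the transformation laws, of weight `κ` and index `L`, under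
`SL(2, ℤ)` and under `L × L`. -/
structure IsJacobiInvariant {n : ℕ} (κ : ℤ) (L : AddSubgroup (Fin n → ℚ))
    (φ : ℍ → (Fin n → ℂ) → ℂ) : Prop where
  holo : DifferentiableOn ℂ (fun p : ℂ × (Fin n → ℂ) => φ (ofComplex p.1) p.2)
    {p | 0 < p.1.im}
  modular : ∀ (A : SL(2, ℤ)) (τ : ℍ) (z : Fin n → ℂ),
    φ (A • τ) (fun i => z i / ((A 1 0 : ℂ) * (τ : ℂ) + (A 1 1 : ℂ)))
      * e (-(A 1 0 : ℂ) * quadC z / ((A 1 0 : ℂ) * (τ : ℂ) + (A 1 1 : ℂ)))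
      * ((A 1 0 : ℂ) * (τ : ℂ) + (A 1 1 : ℂ)) ^ (-κ) = φ τ z
  elliptic : ∀ l ∈ L, ∀ m ∈ L, ∀ (τ : ℍ) (z : Fin n → ℂ),
    φ τ (fun i => z i + (l i : ℂ) * (τ : ℂ) + (m i : ℂ))
      * e ((τ : ℂ) * (quad l : ℂ) + bilC l z) = φ τ z

theorem IsFourierExpansion.zero {n : ℕ} (L : AddSubgroup (Fin n → ℚ)) :
    IsFourierExpansion L 0 0 := by
  refine ⟨fun m x h => absurd rfl h, fun τ z => ?_⟩
  simp

theorem IsFourierExpansion.add {n : ℕ} {L : AddSubgroup (Fin n → ℚ)}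
    {φ ψ : ℍ → (Fin n → ℂ) → ℂ} {c d : ℚ → (Fin n → ℚ) → ℂ}
    (hc : IsFourierExpansion L φ c) (hd : IsFourierExpansion L ψ d) :
    IsFourierExpansion L (φ + ψ) (c + d) := by
  refine ⟨fun m x h => ?_, fun τ z => ?_⟩
  · by_cases h1 : c m x = 0
    · refine hd.1 m x fun h2 => h ?_
      simp [h1, h2]
    · exact hc.1 m x h1
  · simpa [add_mul] using (hc.2 τ z).add (hd.2 τ z)

theorem IsFourierExpansion.smul {n : ℕ} {L : AddSubgroup (Fin n → ℚ)}
    {φ : ℍ → (Fin n → ℂ) → ℂ} {c : ℚ → (Fin n → ℚ) → ℂ} (a : ℂ)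
    (hc : IsFourierExpansion L φ c) : IsFourierExpansion L (a • φ) (a • c) := by
  refine ⟨fun m x h => hc.1 m x fun h2 => h (by simp [h2]), fun τ z => ?_⟩
  simpa [mul_assoc] using (hc.2 τ z).mul_left a

theorem IsJacobiInvariant.zero {n : ℕ} (κ : ℤ) (L : AddSubgroup (Fin n → ℚ)) :
    IsJacobiInvariant κ L 0 :=
  ⟨by simp, fun A τ z => by simp,
    fun l _ m _ τ z => by simp⟩

theorem IsJacobiInvariant.add {n : ℕ} {κ : ℤ} {L : AddSubgroup (Fin n → ℚ)}
    {φ ψ : ℍ → (Fin n → ℂ) → ℂ} (h : IsJacobiInvariant κ L φ) (h' : IsJacobiInvariant κ L ψ) :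
    IsJacobiInvariant κ L (φ + ψ) :=
  ⟨h.holo.add h'.holo,
    fun A τ z => by
      rw [Pi.add_apply, Pi.add_apply, Pi.add_apply, Pi.add_apply, add_mul, add_mul,
        h.modular A τ z, h'.modular A τ z],
    fun l hl m hm τ z => by
      rw [Pi.add_apply, Pi.add_apply, Pi.add_apply, add_mul,
        h.elliptic l hl m hm τ z, h'.elliptic l hl m hm τ z]⟩

theorem IsJacobiInvariant.smul {n : ℕ} {κ : ℤ} {L : AddSubgroup (Fin n → ℚ)}
    {φ : ℍ → (Fin n → ℂ) → ℂ} (a : ℂ) (h : IsJacobiInvariant κ L φ) :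
    IsJacobiInvariant κ L (a • φ) :=
  ⟨h.holo.const_smul a,
    fun A τ z => by
      rw [Pi.smul_apply, Pi.smul_apply, Pi.smul_apply, Pi.smul_apply, smul_mul_assoc,
        smul_mul_assoc, h.modular A τ z],
    fun l hl m hm τ z => by
      rw [Pi.smul_apply, Pi.smul_apply, Pi.smul_apply, smul_mul_assoc,
        h.elliptic l hl m hm τ z]⟩

/-- The space `J_{κ,L}` of Jacobi forms of weight `κ` and index `L`: the Fourier coefficients
`c(n', r')` vanish unless `n' - β(r') ≥ 0`. -/
def jacobiForms {n : ℕ} (κ : ℤ) (L : AddSubgroup (Fin n → ℚ)) :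
    Submodule ℂ (ℍ → (Fin n → ℂ) → ℂ) where
  carrier := {φ | IsJacobiInvariant κ L φ ∧
    ∃ c, IsFourierExpansion L φ c ∧ ∀ m x, c m x ≠ 0 → 0 ≤ m - quad x}
  zero_mem' := ⟨.zero κ L, 0, IsFourierExpansion.zero L, fun m x h => absurd rfl h⟩
  add_mem' := by
    rintro φ ψ ⟨h, c, hc, hc'⟩ ⟨h', d, hd, hd'⟩
    refine ⟨h.add h', c + d, hc.add hd, fun m x hx => ?_⟩
    by_cases h1 : c m x = 0
    · exact hd' m x fun h2 => hx (by simp [h1, h2])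
    · exact hc' m x h1
  smul_mem' := by
    rintro a φ ⟨h, c, hc, hc'⟩
    exact ⟨h.smul a, a • c, hc.smul a, fun m x hx => hc' m x fun h2 => hx (by simp [h2])⟩

/-- The space of Jacobi cusp forms of weight `κ` and index `L`: the Fourier coefficients
`c(n', r')` vanish unless `n' - β(r') > 0`. -/
def jacobiCuspForms {n : ℕ} (κ : ℤ) (L : AddSubgroup (Fin n → ℚ)) :
    Submodule ℂ (ℍ → (Fin n → ℂ) → ℂ) where
  carrier := {φ | IsJacobiInvariant κ L φ ∧
    ∃ c, IsFourierExpansion L φ c ∧ ∀ m x, c m x ≠ 0 → 0 < m - quad x}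
  zero_mem' := ⟨.zero κ L, 0, IsFourierExpansion.zero L, fun m x h => absurd rfl h⟩
  add_mem' := by
    rintro φ ψ ⟨h, c, hc, hc'⟩ ⟨h', d, hd, hd'⟩
    refine ⟨h.add h', c + d, hc.add hd, fun m x hx => ?_⟩
    by_cases h1 : c m x = 0
    · exact hd' m x fun h2 => hx (by simp [h1, h2])
    · exact hc' m x h1
  smul_mem' := by
    rintro a φ ⟨h, c, hc, hc'⟩
    exact ⟨h.smul a, a • c, hc.smul a, fun m x hx => hc' m x fun h2 => hx (by simp [h2])⟩

/-! ### Theta decomposition -/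

/-- `θ_{L,x}(τ, z) = ∑_{y ∈ x + L} e(τβ(y) + β(y, z))`. -/
def latticeTheta {n : ℕ} (L : AddSubgroup (Fin n → ℚ)) (x : Fin n → ℚ) (τ : ℍ)
    (z : Fin n → ℂ) : ℂ :=
  ∑' y : {y : Fin n → ℚ // y - x ∈ L}, e ((τ : ℂ) * (quad y.1 : ℂ) + bilC y.1 z)

/-- The theta component `h_x(τ) = ∑_{n' ∈ ℤ} c(n', x) e((n' - β(x))τ)` of `φ`. -/
def thetaComponent {n : ℕ} (L : AddSubgroup (Fin n → ℚ)) (φ : ℍ → (Fin n → ℂ) → ℂ)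
    (x : Fin n → ℚ) (τ : ℂ) : ℂ :=
  ∑' m : ℤ, fourierCoeff L φ (m : ℚ) x * e (((m : ℂ) - (quad x : ℂ)) * τ)

/-- `φ ↦ ∑_{j=0}^{3} h_j(8τ)` for Jacobi forms `φ` of index `D_r`, where `h_j = h_{v_j}`. -/
def evenMap (r : ℕ) (φ : ℍ → (Fin r → ℂ) → ℂ) (τ : ℍ) : ℂ :=
  ∑ j : Fin 4, thetaComponent (latticeD r) φ (rep r j) (8 * (τ : ℂ))

/-! ### Hecke operators on Jacobi forms -/

/-- The Legendre symbol `(x / p)` of a rational number `x` whose denominator is prime to the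
odd prime `p`. -/
def legendreRat (x : ℚ) (p : ℕ) : ℤ := jacobiSym (x.num * (x.den : ℤ)) p

/-- The Fourier coefficients of `φ | T^J(p)` in terms of those of `φ`, for a lattice of odd
rank `n` and an odd prime `p` that does not divide `[L♯ : L]`. -/
def jacobiHeckeCoeff {n : ℕ} (κ : ℤ) (L : AddSubgroup (Fin n → ℚ)) (p : ℕ)
    (c : ℚ → (Fin n → ℚ) → ℂ) (m : ℚ) (x : Fin n → ℚ) : ℂ :=
  c ((p : ℚ) ^ 2 * m) ((p : ℚ) • x)
  + (p : ℂ) ^ (κ - n - 2) * ((jacobiSym (-1) p * (p : ℤ) : ℤ) : ℂ) ^ ((n + 1) / 2)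
      * (jacobiSym (2 * (L.relIndex (dual L) : ℤ)) p : ℂ) * (legendreRat (m - quad x) p : ℂ)
      * c m x
  + (p : ℂ) ^ (2 * κ - n - 2)
      * ∑ᶠ l : L ⧸ (nsmulAddMonoidHom (α := L) p).range,
          c ((m - bil x (l.out : L) + quad (l.out : L).1) / (p : ℚ) ^ 2)
            ((1 / (p : ℚ)) • (x - (l.out : L).1))

/-- The Hecke operator `T^J(p)` on Jacobi forms of weight `κ` and index `L` (of odd rank). -/
def jacobiHecke {n : ℕ} (κ : ℤ) (L : AddSubgroup (Fin n → ℚ)) (p : ℕ)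
    (φ : ℍ → (Fin n → ℂ) → ℂ) (τ : ℍ) (z : Fin n → ℂ) : ℂ :=
  ∑' q : ℤ × dual L,
    jacobiHeckeCoeff κ L p (fourierCoeff L φ) (q.1 : ℚ) (q.2 : Fin n → ℚ)
      * e ((q.1 : ℂ) * (τ : ℂ) + bilC (q.2 : Fin n → ℚ) z)

/-! ### Modular forms of half-integral weight -/

/-- `θ(τ) = ∑_{m ∈ ℤ} e(m²τ)`. -/
def theta (τ : ℍ) : ℂ := ∑' m : ℤ, e ((m : ℂ) ^ 2 * (τ : ℂ))

/-- The automorphy factor `j(A, τ) = θ(Aτ) / θ(τ)` for `A ∈ Γ₀(4)`. -/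
def thetaFactor (A : SL(2, ℤ)) (τ : ℍ) : ℂ := theta (A • τ) / theta τ

/-- `F` is a modular form of odd weight `w` for `Γ₀(N)`, `4 ∣ N`, with character `(-4 / d)`. -/
structure IsModularChi4 (N : ℕ) (w : ℤ) (F : ℍ → ℂ) : Prop where
  holo : MDiff F
  modular : ∀ A ∈ CongruenceSubgroup.Gamma0 N, ∀ τ : ℍ,
    F (A • τ) = (ZMod.χ₄ (A 1 1 : ZMod 4) : ℂ) * denom A τ ^ w * F τ
  bdd : ∀ A : SL(2, ℤ), IsBoundedAtImInfty (F ∣[w] A)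

/-- `f` is a modular form of weight `k + 1/2` and level `N` (`4 ∣ N`). -/
structure IsHalfIntegralForm (k : ℤ) (N : ℕ) (f : ℍ → ℂ) : Prop where
  holo : MDiff f
  modular : ∀ A ∈ CongruenceSubgroup.Gamma0 N, ∀ τ : ℍ,
    thetaFactor A τ ^ (-2 * k - 1) * f (A • τ) = f τ
  sq : IsModularChi4 N (2 * k + 1) (f ^ 2)

theorem IsHalfIntegralForm.zero (k : ℤ) (N : ℕ) : IsHalfIntegralForm k N 0 := by
  refine ⟨mdifferentiable_const, fun A _ τ => by simp, ?_, fun A _ τ => by simp, fun A => ?_⟩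
  · simpa using! (mdifferentiable_const (c := (0 : ℂ)))
  · simpa using! zero_form_isBoundedAtImInfty

theorem norm_sq_slash_add_le (w : ℤ) (A : SL(2, ℤ)) (f g : ℍ → ℂ) (τ : ℍ) :
    ‖(((f + g) ^ 2) ∣[w] A) τ‖ ≤ 2 * (‖((f ^ 2) ∣[w] A) τ‖ + ‖((g ^ 2) ∣[w] A) τ‖) := by
  simp only [ModularForm.SL_slash_apply, Pi.pow_apply, Pi.add_apply, norm_mul, norm_pow]
  rw [← add_mul, ← mul_assoc]
  refine mul_le_mul_of_nonneg_right ?_ (norm_nonneg _)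
  have h1 := norm_add_le (f (A • τ)) (g (A • τ))
  have h2 := norm_nonneg (f (A • τ) + g (A • τ))
  nlinarith [sq_nonneg (‖f (A • τ)‖ - ‖g (A • τ)‖)]

theorem IsHalfIntegralForm.add {k : ℤ} {N : ℕ} {f g : ℍ → ℂ} (hf : IsHalfIntegralForm k N f)
    (hg : IsHalfIntegralForm k N g) : IsHalfIntegralForm k N (f + g) := by
  refine ⟨hf.holo.add hg.holo, fun A hA τ => ?_, ?_, fun A hA τ => ?_, fun A => ?_⟩
  · rw [Pi.add_apply, Pi.add_apply, mul_add, hf.modular A hA τ, hg.modular A hA τ]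
  · simpa [pow_two] using! (hf.holo.add hg.holo).mul (hf.holo.add hg.holo)
  · have h1 := hf.modular A hA τ
    have h2 := hg.modular A hA τ
    have h3 := hf.sq.modular A hA τ
    have h4 := hg.sq.modular A hA τ
    simp only [Pi.pow_apply, Pi.add_apply] at h3 h4 ⊢
    set u := thetaFactor A τ ^ (-2 * k - 1)
    set C := (ZMod.χ₄ (A 1 1 : ZMod 4) : ℂ) * denom A τ ^ (2 * k + 1)
    have h5 : f (A • τ) * g (A • τ) = C * (f τ * g τ) := by
      by_cases h0 : f τ = 0
      · have h8 : f (A • τ) ^ 2 = 0 := by rw [h3, h0]; ring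
        rw [pow_eq_zero_iff two_ne_zero] at h8
        rw [h8, h0, zero_mul, zero_mul, mul_zero]
      · have h6 : f (A • τ) ≠ 0 := fun h => h0 (by rw [← h1, h, mul_zero])
        rw [← h1] at h3 ⊢
        rw [← h2]
        have h7 : f (A • τ) * (f (A • τ) * g (A • τ))
            = f (A • τ) * (C * (u * f (A • τ) * (u * g (A • τ)))) := by
          linear_combination g (A • τ) * h3
        exact mul_left_cancel₀ h6 h7
    linear_combination h3 + h4 + 2 * h5
  · have h1 := hf.sq.bdd A
    have h2 := hg.sq.bdd A
    rw [isBoundedAtImInfty_iff] at h1 h2 ⊢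
    obtain ⟨M, B, h1⟩ := h1
    obtain ⟨M', B', h2⟩ := h2
    refine ⟨2 * (M + M'), max B B', fun τ hτ => ?_⟩
    refine (norm_sq_slash_add_le _ A f g τ).trans ?_
    have := h1 τ ((le_max_left _ _).trans hτ)
    have := h2 τ ((le_max_right _ _).trans hτ)
    linarith

theorem IsHalfIntegralForm.smul {k : ℤ} {N : ℕ} {f : ℍ → ℂ} (a : ℂ)
    (hf : IsHalfIntegralForm k N f) : IsHalfIntegralForm k N (a • f) := by
  refine ⟨hf.holo.const_smul a, fun A hA τ => ?_, ?_, fun A hA τ => ?_, fun A => ?_⟩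
  · rw [Pi.smul_apply, Pi.smul_apply, mul_smul_comm, hf.modular A hA τ]
  · rw [smul_pow]
    exact hf.sq.holo.const_smul _
  · rw [smul_pow, Pi.smul_apply, Pi.smul_apply, hf.sq.modular A hA τ, mul_smul_comm]
  · rw [smul_pow, ModularForm.SL_smul_slash]
    exact Asymptotics.IsBigO.const_smul_left (hf.sq.bdd A) _

/-- The space `M_{k+1/2}(N)`. -/
def halfIntegralForms (k : ℤ) (N : ℕ) : Submodule ℂ (ℍ → ℂ) where
  carrier := {f | IsHalfIntegralForm k N f}
  zero_mem' := .zero k N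
  add_mem' := fun hf hg => hf.add hg
  smul_mem' := fun a _ hf => hf.smul a

/-- The space `S_{k+1/2}(N)` of those `f ∈ M_{k+1/2}(N)` for which `f²` is a cusp form. -/
def halfIntegralCuspForms (k : ℤ) (N : ℕ) : Submodule ℂ (ℍ → ℂ) where
  carrier := {f | f ∈ halfIntegralForms k N ∧
    ∀ A : SL(2, ℤ), IsZeroAtImInfty ((f ^ 2) ∣[2 * k + 1] A)}
  zero_mem' := ⟨zero_mem _, fun A => by
    simpa using! tendsto_const_nhds⟩
  add_mem' := by
    rintro f g ⟨hf, hf'⟩ ⟨hg, hg'⟩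
    refine ⟨add_mem hf hg, fun A => ?_⟩
    refine squeeze_zero_norm (norm_sq_slash_add_le _ A f g) ?_
    simpa using! ((hf' A).norm.add (hg' A).norm).const_mul 2
  smul_mem' := by
    rintro a f ⟨hf, hf'⟩
    refine ⟨Submodule.smul_mem _ a hf, fun A => ?_⟩
    rw [smul_pow, ModularForm.SL_smul_slash]
    simpa using! (hf' A).const_smul (a ^ 2)

/-- The space `M_{k+1/2}^{+,-r}(8)`: forms `g = ∑ c(n) qⁿ` in `M_{k+1/2}(8)` such that `c(n) = 0`
unless `n ≡ 0, 4, -r mod 8`. -/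
def plusForms (k : ℤ) (r : ℕ) : Submodule ℂ (ℍ → ℂ) where
  carrier := {g | g ∈ halfIntegralForms k 8 ∧
    ∃ c : ℕ → ℂ, (∀ τ : ℍ, HasSum (fun n : ℕ => c n * e ((n : ℂ) * (τ : ℂ))) (g τ)) ∧
      ∀ n : ℕ, c n ≠ 0 → (n : ℤ) ≡ 0 [ZMOD 8] ∨ (n : ℤ) ≡ 4 [ZMOD 8] ∨
        (n : ℤ) ≡ -(r : ℤ) [ZMOD 8]}
  zero_mem' := ⟨zero_mem _, 0, fun τ => by simp, fun n h => absurd rfl h⟩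
  add_mem' := by
    rintro f g ⟨hf, c, hc, hc'⟩ ⟨hg, d, hd, hd'⟩
    refine ⟨add_mem hf hg, c + d, fun τ => by simpa [add_mul] using (hc τ).add (hd τ),
      fun n hn => ?_⟩
    by_cases h1 : c n = 0
    · exact hd' n fun h2 => hn (by simp [h1, h2])
    · exact hc' n h1
  smul_mem' := by
    rintro a f ⟨hf, c, hc, hc'⟩
    refine ⟨Submodule.smul_mem _ a hf, a • c,
      fun τ => by simpa [mul_assoc] using (hc τ).mul_left a,
      fun n hn => hc' n fun h2 => hn (by simp [h2])⟩

/-- The space `S_{k+1/2}^{+,-r}(8) = M_{k+1/2}^{+,-r}(8) ∩ S_{k+1/2}(8)`. -/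
def plusCuspForms (k : ℤ) (r : ℕ) : Submodule ℂ (ℍ → ℂ) :=
  plusForms k r ⊓ halfIntegralCuspForms k 8

/-- The Hecke operator `T(p²)` in weight `k + 1/2`, for an odd prime `p`, on
`f = ∑_{n ≥ 0} c(n) qⁿ`; the `n`-th coefficient of the image is
`c(p²n) + ((-1)^k n / p) p^{k-1} c(n) + p^{2k-1} c(n/p²)`. -/
def halfIntegralHecke (k : ℤ) (p : ℕ) (f : ℍ → ℂ) (τ : ℍ) : ℂ :=
  ∑' n : ℕ,
    ((qExpansion 1 f).coeff (p ^ 2 * n)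
      + (jacobiSym ((k.negOnePow : ℤ) * (n : ℤ)) p : ℂ) * (p : ℂ) ^ (k - 1)
          * (qExpansion 1 f).coeff n
      + (p : ℂ) ^ (2 * k - 1) *
          (if p ^ 2 ∣ n then (qExpansion 1 f).coeff (n / p ^ 2) else 0))
    * e ((n : ℂ) * (τ : ℂ))

end

end JacobiD

open JacobiD

open Filter Topology

namespace JacobiD

/-! ### The exponential `e` -/

/-! A Fourier coefficient `C(m, x)` of a Jacobi form `φ` of index `D_r` depends only on the class of
`x` modulo `D_r` and on `m - β(x)` (`IsCoeffFamily.eq_rep`); this gives the theta decomposition.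
Evenness of the weight gives `C(m, -x) = C(m, x)`, and `-v₁ ≡ v₃` modulo `D_r` for odd `r`, so `h₁ =
h₃`. With `g = h₀ + h₂`, `u = h₀ - h₂` and `W = h₁ + h₃`, the form `φ` is therefore half of `g ∏ϑ₀₀
+ u ∏ϑ₀₁ + W ∏ϑ₁₀`. The three products are linearly independent functions of `z`, because the theta
constants vanish nowhere (`thetaProd_ne_zero`). Hence the modular law of `φ` says exactly that `(g,
u, W)` transforms under `S` and `T` like the theta constants `(ϑ₀₀, ϑ₀₁, ϑ₁₀)`, in weight `k + 1/2`
and up to the sign `i^κ`. This is the notion `IsThetaTriple`, the meeting point of both sides.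

On the other side the image of `φ` is `g(8τ) + W(8τ)`, while `θ(τ) = ϑ₀₀(8τ, 0) + ϑ₁₀(8τ, 0)`. The
quotient of the first by the power `2k + 1` of the second has weight zero; following its translates
along words in `S` and `T` (`slash_coset`) shows that it is invariant under `Γ₀(8)`
(`IsThetaTriple.liftForm_smul`). Growth at all cusps follows from the `SL(2, ℤ)`-invariance of
`(|g|² + |u|² + |W|²)² y^(2k+1)`. Conversely, the congruence condition on the coefficients of `f`
splits `f(τ/8)` into `g + W` with known behaviour under `T`. Two matrices `(t, s; 8, t)` then give
the law of `u` and `W` under `S`, and the relation `STS = T⁻¹ST⁻¹` gives that of `g`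
(`isThetaTriple_of_isHalfIntegralForm`). Injectivity holds because `T⁴` fixes `g` and negates `W`.
For cusp forms only the constant term of `f` has to be watched in the inverse direction.

The operator `T^J(p)` is, up to a power of `p`, a sum over the primitive integral matrices of
determinant `p²` modulo `SL(2, ℤ)` and over pairs of vectors in `D_r / p D_r` (`hasSum_heckeSum`);
Gauss sums produce the Legendre symbol in the middle term. Multiplication by `S` permutes the
summands, and the remaining properties of a Jacobi form are read off the coefficients
(`jacobiHecke_mem`). The comparison with `T(p²)` is made coefficient by coefficient
(`evenCoeff_heckeCoeff`), from `p v_j ≡ ±v_j` modulo `D_r`, from `p² ≡ 1` modulo `8`, and from the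
fact that a single class of `D_r / p D_r` contributes at `v_j`. -/

theorem e_add (x y : ℂ) : e (x + y) = e x * e y := by
  simp only [e, mul_add, Complex.exp_add]

@[simp] theorem e_zero : e 0 = 1 := by simp [e]

theorem e_ne_zero (x : ℂ) : e x ≠ 0 := Complex.exp_ne_zero _

theorem e_neg (x : ℂ) : e (-x) = (e x)⁻¹ := by
  simp only [e, mul_neg, Complex.exp_neg]

theorem e_sub (x y : ℂ) : e (x - y) = e x / e y := by
  rw [sub_eq_add_neg, e_add, e_neg, div_eq_mul_inv]

theorem e_int (n : ℤ) : e n = 1 := by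
  rw [e, mul_comm, ← Complex.exp_int_mul_two_pi_mul_I n]

theorem e_nat_mul (n : ℕ) (x : ℂ) : e (n * x) = e x ^ n := by
  rw [e, e, ← Complex.exp_nat_mul]
  ring_nf

theorem e_int_mul (n : ℤ) (x : ℂ) : e (n * x) = e x ^ n := by
  rw [e, e, ← Complex.exp_int_mul]
  ring_nf

theorem e_add_int (x : ℂ) (n : ℤ) : e (x + n) = e x := by
  rw [e_add, e_int, mul_one]

theorem norm_e (x : ℂ) : ‖e x‖ = Real.exp (-2 * Real.pi * x.im) := by
  rw [e, Complex.norm_exp]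
  congr 1
  simp

theorem norm_e_of_im_eq_zero {x : ℂ} (hx : x.im = 0) : ‖e x‖ = 1 := by
  rw [norm_e, hx]
  simp

theorem e_eq_one_iff (x : ℂ) : e x = 1 ↔ ∃ n : ℤ, x = n := by
  rw [e, Complex.exp_eq_one_iff]
  have h : (2 * (Real.pi : ℂ) * Complex.I) ≠ 0 := by
    simp [Real.pi_ne_zero]
  constructor
  · rintro ⟨n, hn⟩
    refine ⟨n, mul_left_cancel₀ h ?_⟩
    rw [hn]; ring
  · rintro ⟨n, rfl⟩
    exact ⟨n, by ring⟩

theorem e_half : e (1 / 2) = -1 := by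
  rw [e, ← Complex.exp_pi_mul_I]
  congr 1; ring

theorem e_quarter : e (1 / 4) = Complex.I := by
  rw [e, show 2 * (Real.pi : ℂ) * Complex.I * (1 / 4) = Real.pi / 2 * Complex.I by ring,
    Complex.exp_pi_div_two_mul_I]

theorem differentiable_e : Differentiable ℂ e := by
  unfold e
  fun_prop

/-! ### Uniqueness of expansions in unitary characters -/

/-- The geometric sums stay bounded by `2 / |ω - 1|`, so dividing by `N` kills them. -/
theorem tendsto_average_pow {ω : ℂ} (h1 : ‖ω‖ = 1) (h : ω ≠ 1) :
    Tendsto (fun N : ℕ => (∑ n ∈ Finset.range N, ω ^ n) / N) atTop (𝓝 0) := by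
  have h2 : (0 : ℝ) < ‖ω - 1‖ := norm_pos_iff.2 (sub_ne_zero.2 h)
  refine squeeze_zero_norm (a := fun N : ℕ => 2 / ‖ω - 1‖ / N) (fun N => ?_)
    (tendsto_const_div_atTop_nhds_zero_nat _)
  rw [geom_sum_eq h, norm_div, norm_div, Complex.norm_natCast]
  gcongr
  calc ‖ω ^ N - 1‖ ≤ ‖ω ^ N‖ + ‖(1 : ℂ)‖ := norm_sub_le _ _
    _ = 2 := by rw [norm_pow, h1]; norm_num

/-- A summable combination of distinct unitary characters of `ℕ` vanishes only if all its
coefficients do. -/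
theorem eq_zero_of_sum_pow_eq_zero {ι : Type*} {b χ : ι → ℂ} (hb : Summable b)
    (hχ : ∀ i, ‖χ i‖ = 1) (hinj : Function.Injective χ)
    (h : ∀ n : ℕ, ∑' i, b i * χ i ^ n = 0) : b = 0 := by
  classical
  funext i₀
  have hne : χ i₀ ≠ 0 := fun h0 => by simpa [h0] using hχ i₀
  have hb' : Summable fun i => ‖b i‖ := hb.norm
  have hω : ∀ i, ‖χ i / χ i₀‖ = 1 := fun i => by rw [norm_div, hχ, hχ, div_one]
  -- Averaging `b i (χ i / χ i₀)ⁿ` over `n < N` isolates the coefficient at `i₀` in the limit, while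
  -- every average is zero by hypothesis.
  have key : Tendsto (fun N : ℕ => ∑' i, b i * ((∑ n ∈ Finset.range N, (χ i / χ i₀) ^ n) / N))
      atTop (𝓝 (∑' i, b i * if i = i₀ then 1 else 0)) := by
    refine tendsto_tsum_of_dominated_convergence (bound := fun i => ‖b i‖) hb' (fun i => ?_)
      (Eventually.of_forall fun N i => ?_)
    · refine Tendsto.const_mul _ ?_
      split_ifs with hi
      · subst hi
        refine tendsto_const_nhds.congr' ?_
        filter_upwards [eventually_gt_atTop 0] with N hN
        have : (N : ℂ) ≠ 0 := by exact_mod_cast hN.ne'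
        simp [div_self hne, this]
      · refine tendsto_average_pow (hω i) fun h1 => hi (hinj ?_)
        rwa [div_eq_one_iff_eq hne] at h1
    · rw [norm_mul]
      refine mul_le_of_le_one_right (norm_nonneg _) ?_
      rw [norm_div, Complex.norm_natCast]
      refine div_le_one_of_le₀ ?_ (Nat.cast_nonneg _)
      refine (norm_sum_le _ _).trans ?_
      simp [norm_pow, hχ]
  have hz : ∀ N : ℕ, ∑' i, b i * ((∑ n ∈ Finset.range N, (χ i / χ i₀) ^ n) / N) = 0 := by
    intro N
    have h1 : ∀ i, b i * ((∑ n ∈ Finset.range N, (χ i / χ i₀) ^ n) / N)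
        = ∑ n ∈ Finset.range N, (b i * χ i ^ n) * ((χ i₀ ^ n)⁻¹ / N) := by
      intro i
      rw [Finset.sum_div, Finset.mul_sum]
      refine Finset.sum_congr rfl fun n _ => ?_
      rw [div_pow]; ring
    simp_rw [h1]
    rw [Summable.tsum_finsetSum]
    · refine Finset.sum_eq_zero fun n _ => ?_
      rw [tsum_mul_right, h n, zero_mul]
    · intro n _
      refine Summable.mul_right _ (Summable.of_norm ?_)
      simpa [norm_mul, norm_pow, hχ] using hb'
  simp_rw [hz] at key
  have := tendsto_nhds_unique tendsto_const_nhds key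
  rw [tsum_eq_single i₀ (fun i hi => by simp [hi])] at this
  simpa using this.symm

/-- Any transcendental real number would serve as the direction in which frequencies are separated.
-/
theorem transcendental_rat_liouville : Transcendental ℚ (liouvilleNumber 2) := by
  intro h
  exact transcendental_liouvilleNumber (m := 2) le_rfl
    ((IsFractionRing.isAlgebraic_iff ℤ ℚ ℝ).2 h)

/-- The frequencies of Fourier expansions are separated by a transcendental direction. -/
theorem frequency_injective {n : ℕ} {m m' : ℤ} {x x' : Fin n → ℚ} {k : ℤ}
    (h : (m : ℝ) * liouvilleNumber 2 + ∑ i, (x i : ℝ) * liouvilleNumber 2 ^ ((i : ℕ) + 2)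
      = m' * liouvilleNumber 2 + ∑ i, (x' i : ℝ) * liouvilleNumber 2 ^ ((i : ℕ) + 2) + k) :
    m = m' ∧ x = x' := by
  -- The hypothesis says that this rational polynomial vanishes at the Liouville number. The unknown
  -- integer `k` occupies degree `0`, the frequency of `τ` degree `1`, and that of the coordinate
  -- `i` degree `i + 2`, so the coefficients do not interfere.
  open Polynomial in
  let q : ℚ[X] := C (-(k : ℚ)) + C ((m : ℚ) - m') * X
    + ∑ i : Fin n, C (x i - x' i) * X ^ ((i : ℕ) + 2)
  have hq : q = 0 := by
    by_contra hne
    refine transcendental_rat_liouville ⟨q, hne, ?_⟩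
    simp only [q, map_add, map_mul, map_sum, map_pow, Polynomial.aeval_X, Polynomial.aeval_C,
      map_neg, map_sub, eq_ratCast, Rat.cast_intCast, sub_mul, Finset.sum_sub_distrib]
    linarith
  have hc : ∀ d, q.coeff d = 0 := fun d => by rw [hq, Polynomial.coeff_zero]
  constructor
  · have := hc 1
    simp only [q, Polynomial.coeff_add, Polynomial.finsetSum_coeff, Polynomial.coeff_C_mul,
      Polynomial.coeff_X_pow, Polynomial.coeff_C, Polynomial.coeff_X] at this
    have h2 : (m : ℚ) = m' := by
      simpa [sub_eq_zero] using this
    exact_mod_cast h2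
  · funext j
    have := hc (j + 2)
    simp only [q, Polynomial.coeff_add, Polynomial.finsetSum_coeff, Polynomial.coeff_C_mul,
      Polynomial.coeff_X_pow, Polynomial.coeff_C, Polynomial.coeff_X, add_left_inj] at this
    have h3 : ∀ i : Fin n, ((j : ℕ) = i) ↔ i = j := fun i => by
      rw [Fin.ext_iff, eq_comm]
    simpa [h3, sub_eq_zero] using this

/-- At `τ = i + N t` and `z_i = N t^(i+2)`, with `t` transcendental, the series becomes a sum of
`N`-th powers of unitary numbers. These are pairwise distinct by `frequency_injective`, so
`eq_zero_of_sum_pow_eq_zero` applies; the decay in `τ` is absorbed into the coefficients. -/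
theorem hasSum_fourier_eq_zero {n : ℕ} {L : AddSubgroup (Fin n → ℚ)}
    {a : ℤ × dual L → ℂ}
    (h : ∀ (τ : ℍ) (z : Fin n → ℂ), HasSum (fun p : ℤ × dual L =>
      a p * e ((p.1 : ℂ) * (τ : ℂ) + bilC (p.2 : Fin n → ℚ) z)) 0) : a = 0 := by
  set t : ℝ := liouvilleNumber 2 with ht
  set b : ℤ × dual L → ℂ := fun p => a p * e ((p.1 : ℂ) * Complex.I)
  set ν : ℤ × dual L → ℝ := fun p => p.1 * t + ∑ i, ((p.2 : Fin n → ℚ) i : ℝ) * t ^ ((i : ℕ) + 2)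
  have hsum : ∀ N : ℕ, HasSum (fun p => b p * e (ν p) ^ N) 0 := by
    intro N
    have h1 := h ((N * t : ℝ) +ᵥ UpperHalfPlane.I) (fun i => (N : ℂ) * (t : ℂ) ^ ((i : ℕ) + 2))
    refine h1.congr_fun ?_ |> fun h => h
    intro p
    simp only [b, ν]
    rw [← e_nat_mul, mul_assoc, ← e_add]
    congr 2
    simp only [UpperHalfPlane.coe_vadd, UpperHalfPlane.coe_I, bilC]
    push_cast
    rw [mul_add, mul_add, Finset.mul_sum]
    have : ∀ i : Fin n, (N : ℂ) * (((p.2 : Fin n → ℚ) i : ℂ) * (t : ℂ) ^ ((i : ℕ) + 2))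
      = ((p.2 : Fin n → ℚ) i : ℂ) * (N * (t : ℂ) ^ ((i : ℕ) + 2)) := fun i => by ring
    simp_rw [this]
    ring
  have hb : b = 0 := by
    refine eq_zero_of_sum_pow_eq_zero (χ := fun p => e (ν p)) ?_ ?_ ?_ fun N => (hsum N).tsum_eq
    · simpa using (hsum 0).summable
    · exact fun p => norm_e_of_im_eq_zero (by simp)
    · intro p q hpq
      have h1 : e ((ν p : ℂ) - ν q) = 1 := by
        rw [e_sub]
        exact (div_eq_one_iff_eq (e_ne_zero _)).2 hpq
      obtain ⟨k, hk⟩ := (e_eq_one_iff _).1 h1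
      have hk' : ν p = ν q + k := by
        have : ((ν p - ν q : ℝ) : ℂ) = ((k : ℝ) : ℂ) := by push_cast; exact hk
        have := Complex.ofReal_injective this
        linarith
      obtain ⟨h2, h3⟩ := frequency_injective hk'
      exact Prod.ext h2 (Subtype.ext h3)
  funext p
  have := congrFun hb p
  simpa [b, e_ne_zero] using this

theorem IsFourierExpansion.unique {n : ℕ} {L : AddSubgroup (Fin n → ℚ)}
    {φ : ℍ → (Fin n → ℂ) → ℂ} {c d : ℚ → (Fin n → ℚ) → ℂ}
    (hc : IsFourierExpansion L φ c) (hd : IsFourierExpansion L φ d) : c = d := by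
  have h := hasSum_fourier_eq_zero (L := L)
    (a := fun p => c p.1 (p.2 : Fin n → ℚ) - d p.1 (p.2 : Fin n → ℚ))
    (fun τ z => by simpa [sub_mul] using (hc.2 τ z).sub (hd.2 τ z))
  funext m x
  by_cases hx : (∃ a : ℤ, m = a) ∧ x ∈ dual L
  · obtain ⟨⟨a, rfl⟩, hx⟩ := hx
    have := congrFun h (a, ⟨x, hx⟩)
    simpa [sub_eq_zero] using this
  · rw [not_imp_comm.1 (hc.1 m x) hx, not_imp_comm.1 (hd.1 m x) hx]

/-- Uniqueness removes the choice made in `fourierCoeff`; every later use of that function passes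
through this equality. -/
theorem IsFourierExpansion.fourierCoeff_eq {n : ℕ} {L : AddSubgroup (Fin n → ℚ)}
    {φ : ℍ → (Fin n → ℂ) → ℂ} {c : ℚ → (Fin n → ℚ) → ℂ}
    (hc : IsFourierExpansion L φ c) : fourierCoeff L φ = c :=
  IsFourierExpansion.unique (Classical.epsilon_spec (p := IsFourierExpansion L φ) ⟨c, hc⟩) hc

/-! ### Series of exponentials with nonnegative frequencies -/

section ExpSeries

variable {ι : Type*} {a : ι → ℂ} {ν : ι → ℝ}

/-- Absolute convergence at one point therefore majorises the series on the whole half plane above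
it. -/
theorem norm_mul_e_le (a : ℂ) {ν : ℝ} (hν : a ≠ 0 → 0 ≤ ν) {τ τ' : ℂ} (h : τ.im ≤ τ'.im) :
    ‖a * e (ν * τ')‖ ≤ ‖a * e (ν * τ)‖ := by
  by_cases ha : a = 0
  · simp [ha]
  rw [norm_mul, norm_mul, norm_e, norm_e]
  have := hν ha
  refine mul_le_mul_of_nonneg_left (Real.exp_le_exp.2 ?_) (norm_nonneg _)
  simp only [Complex.mul_im, Complex.ofReal_re, Complex.ofReal_im, zero_mul, add_zero]
  have := mul_le_mul_of_nonneg_left h this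
  nlinarith [Real.pi_pos]

theorem mdifferentiable_of_hasSum {f : ℍ → ℂ} (hν : ∀ i, a i ≠ 0 → 0 ≤ ν i)
    (hf : ∀ τ : ℍ, HasSum (fun i => a i * e (ν i * τ)) (f τ)) : MDiff f := by
  rw [UpperHalfPlane.mdifferentiable_iff]
  have h1 : DifferentiableOn ℂ (fun τ : ℂ => ∑' i, a i * e (ν i * τ)) {τ | 0 < τ.im} := by
    intro τ hτ
    have hτ' : 0 < τ.im := hτ
    -- A point at half the height supplies a summable majorant on an open neighbourhood of `τ`.
    let τ₀ : ℍ := ⟨⟨0, τ.im / 2⟩, by simpa using hτ'⟩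
    have hopen : IsOpen {w : ℂ | τ.im / 2 < w.im} :=
      isOpen_lt continuous_const Complex.continuous_im
    have h2 : DifferentiableOn ℂ (fun τ : ℂ => ∑' i, a i * e (ν i * τ)) {w | τ.im / 2 < w.im} := by
      refine Complex.differentiableOn_tsum_of_summable_norm (u := fun i => ‖a i * e (ν i * τ₀)‖)
        (hf τ₀).summable.norm (fun i => ?_) hopen fun i w hw => ?_
      · exact ((differentiable_e.comp (differentiable_id.const_mul _)).const_mul _).differentiableOn
      · exact norm_mul_e_le _ (hν i) (le_of_lt hw)
    exact (h2.differentiableAt (hopen.mem_nhds (by show τ.im / 2 < τ.im; linarith))).differentiableWithinAt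
  refine h1.congr fun τ hτ => ?_
  simp only [Function.comp_apply]
  rw [← (hf _).tsum_eq, ofComplex_apply_of_im_pos hτ]

theorem isBoundedAtImInfty_of_hasSum {f : ℍ → ℂ} (hν : ∀ i, a i ≠ 0 → 0 ≤ ν i)
    (hf : ∀ τ : ℍ, HasSum (fun i => a i * e (ν i * τ)) (f τ)) : IsBoundedAtImInfty f := by
  rw [isBoundedAtImInfty_iff]
  refine ⟨∑' i, ‖a i * e (ν i * UpperHalfPlane.I)‖, 1, fun τ hτ => ?_⟩
  rw [← (hf τ).tsum_eq]
  refine (norm_tsum_le_tsum_norm (hf τ).summable.norm).trans ?_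
  refine Summable.tsum_le_tsum (fun i => norm_mul_e_le _ (hν i) ?_) (hf τ).summable.norm
    (hf _).summable.norm
  simpa using hτ

theorem isZeroAtImInfty_of_hasSum {f : ℍ → ℂ} (hν : ∀ i, a i ≠ 0 → 0 < ν i)
    (hf : ∀ τ : ℍ, HasSum (fun i => a i * e (ν i * τ)) (f τ)) : IsZeroAtImInfty f := by
  have h0 : (0 : ℂ) = ∑' i : ι, (0 : ℂ) := by simp
  have hf' : f = fun τ : ℍ => ∑' i, a i * e (ν i * τ) := funext fun τ => (hf τ).tsum_eq.symm
  rw [IsZeroAtImInfty, ZeroAtFilter, hf', h0]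
  refine tendsto_tsum_of_dominated_convergence
    (bound := fun i => ‖a i * e (ν i * UpperHalfPlane.I)‖) (hf _).summable.norm (fun i => ?_) ?_
  · by_cases ha : a i = 0
    · simp [ha]
    · rw [tendsto_zero_iff_norm_tendsto_zero]
      simp only [norm_mul, norm_e]
      rw [← mul_zero ‖a i‖]
      refine Tendsto.const_mul _ (Real.tendsto_exp_atBot.comp ?_)
      simp only [Complex.mul_im, Complex.ofReal_re, Complex.ofReal_im, zero_mul, add_zero]
      have h1 : Tendsto UpperHalfPlane.im atImInfty atTop := tendsto_comap
      have h2 : -2 * Real.pi * ν i < 0 := by nlinarith [Real.pi_pos, hν i ha, mul_pos Real.pi_pos (hν i ha)]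
      simpa [mul_assoc, Function.comp_def] using h1.const_mul_atTop_of_neg h2
  · have : ∀ᶠ τ : ℍ in atImInfty, (1 : ℝ) ≤ τ.im := by
      have h1 : Tendsto UpperHalfPlane.im atImInfty atTop := tendsto_comap
      exact h1.eventually_ge_atTop 1
    filter_upwards [this] with τ hτ i
    exact norm_mul_e_le _ (fun h => (hν i h).le) (by simpa using hτ)

end ExpSeries

noncomputable section

theorem e_congr_int {x y : ℂ} (n : ℤ) (h : x = y + n) : e x = e y := by
  rw [h, e_add_int]

/-! ### The classical theta functions -/

/-- The branch of `√(-iτ)` that is positive on the imaginary axis. -/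
def rootS (τ : ℂ) : ℂ := (-Complex.I * τ) ^ (1 / 2 : ℂ)

/-- `ϑ₀₀(τ, z) = ∑ e(n²τ/2 + nz)`. -/
def th00 (τ z : ℂ) : ℂ := jacobiTheta₂ z τ

/-- `ϑ₀₁(τ, z) = ∑ (-1)ⁿ e(n²τ/2 + nz)`. -/
def th01 (τ z : ℂ) : ℂ := jacobiTheta₂ (z + 1 / 2) τ

/-- `ϑ₁₀(τ, z) = ∑ e((n + 1/2)²τ/2 + (n + 1/2)z)`. -/
def th10 (τ z : ℂ) : ℂ := e (τ / 8 + z / 2) * jacobiTheta₂ (z + τ / 2) τ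

theorem neg_I_mul_re (τ : ℂ) : (-Complex.I * τ).re = τ.im := by simp

theorem rootS_sq {τ : ℂ} : rootS τ ^ 2 = -Complex.I * τ := by
  rw [rootS, one_div]
  exact Complex.cpow_nat_inv_pow _ two_ne_zero

theorem rootS_ne_zero {τ : ℂ} (h : τ ≠ 0) : rootS τ ≠ 0 := fun h0 => by
  have := rootS_sq (τ := τ)
  rw [h0] at this
  simp [h] at this

theorem norm_rootS_sq (τ : ℂ) : ‖rootS τ‖ ^ 2 = ‖τ‖ := by
  rw [← norm_pow, rootS_sq]
  simp

/-- The number `-iτ` lies in the right half plane and the principal root halves its argument. This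
bound decides signs in products of such roots. -/
theorem rootS_arg {τ : ℂ} (h : 0 < τ.im) : |(rootS τ).arg| < Real.pi / 4 := by
  have h1 : |(-Complex.I * τ).arg| < Real.pi / 2 :=
    Complex.abs_arg_lt_pi_div_two_iff.2 (Or.inl (by rwa [neg_I_mul_re]))
  have hne : -Complex.I * τ ≠ 0 := fun h0 => by
    have := neg_I_mul_re τ
    rw [h0] at this
    simp at this
    linarith
  rw [rootS, Complex.cpow_def_of_ne_zero hne, Complex.arg_exp]
  have h2 : (Complex.log (-Complex.I * τ) * (1 / 2)).im = (-Complex.I * τ).arg / 2 := by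
    rw [show Complex.log (-Complex.I * τ) * (1 / 2) = Complex.log (-Complex.I * τ) / (2 : ℝ) by
      push_cast; ring, Complex.div_ofReal_im, Complex.log_im]
  rw [h2, (toIocMod_eq_self _).2]
  · rw [abs_div, abs_two]
    linarith
  · rw [abs_lt] at h1
    constructor <;> linarith [Real.pi_pos]

/-- The metaplectic form of the relation `STS = T⁻¹ST⁻¹`. -/
theorem rootS_mul_rootS {τ : ℂ} (h : 0 < τ.im) (h' : 0 < (-τ / (τ - 1)).im) :
    rootS (-τ / (τ - 1)) * rootS (τ - 1) = e (1 / 8) * rootS τ := by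
  have hτ1 : 0 < (τ - 1).im := by simpa using h
  have hne : τ - 1 ≠ 0 := fun h0 => by rw [h0] at hτ1; simp at hτ1
  have hne0 : τ ≠ 0 := fun h0 => by rw [h0] at h; simp at h
  have hsq : (rootS (-τ / (τ - 1)) * rootS (τ - 1)) ^ 2 = (e (1 / 8) * rootS τ) ^ 2 := by
    rw [mul_pow, mul_pow, rootS_sq, rootS_sq, rootS_sq, ← e_nat_mul,
      show ((2 : ℕ) : ℂ) * (1 / 8) = 1 / 4 by push_cast; norm_num, e_quarter]
    field_simp
  rcases sq_eq_sq_iff_eq_or_eq_neg.1 hsq with h1 | h1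
  · exact h1
  -- The opposite sign is impossible because both sides have positive real part. On the left two
  -- arguments below `π/4` in absolute value are added; on the right `π/4` is added to such an
  -- argument.
  exfalso
  have a1 := abs_lt.1 (rootS_arg h)
  have a2 := abs_lt.1 (rootS_arg h')
  have a3 := abs_lt.1 (rootS_arg hτ1)
  have hre : 0 < (rootS (-τ / (τ - 1)) * rootS (τ - 1)).re := by
    refine (Complex.abs_arg_lt_pi_div_two_iff.1 ?_).resolve_right
      (mul_ne_zero (rootS_ne_zero ?_) (rootS_ne_zero hne))
    · rw [Complex.arg_mul (rootS_ne_zero (div_ne_zero (neg_ne_zero.2 hne0) hne))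
        (rootS_ne_zero hne) ⟨by linarith, by linarith⟩, abs_lt]
      constructor <;> linarith
    · exact div_ne_zero (neg_ne_zero.2 hne0) hne
  have harg8 : (e (1 / 8)).arg = Real.pi / 4 := by
    rw [e, show 2 * (Real.pi : ℂ) * Complex.I * (1 / 8) = ((Real.pi / 4 : ℝ) : ℂ) * Complex.I by
      push_cast; ring, Complex.arg_exp_mul_I, (toIocMod_eq_self _).2]
    constructor <;> linarith [Real.pi_pos]
  have hre' : 0 < (e (1 / 8) * rootS τ).re := by
    refine (Complex.abs_arg_lt_pi_div_two_iff.1 ?_).resolve_right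
      (mul_ne_zero (e_ne_zero _) (rootS_ne_zero hne0))
    rw [Complex.arg_mul (e_ne_zero _) (rootS_ne_zero hne0) ⟨by rw [harg8]; linarith,
      by rw [harg8]; linarith⟩, abs_lt, harg8]
    constructor <;> linarith
  rw [h1, Complex.neg_re] at hre
  linarith

theorem hasSum_th00 {τ : ℂ} (hτ : 0 < τ.im) (z : ℂ) :
    HasSum (fun n : ℤ => e ((n : ℂ) ^ 2 * τ / 2 + n * z)) (th00 τ z) := by
  refine (hasSum_jacobiTheta₂_term z hτ).congr_fun fun n => ?_
  rw [jacobiTheta₂_term, e]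
  congr 1; ring

theorem e_int_half (n : ℤ) : e ((n : ℂ) / 2) = (-1) ^ n := by
  rw [div_eq_mul_one_div, e_int_mul, e_half]

theorem hasSum_th01 {τ : ℂ} (hτ : 0 < τ.im) (z : ℂ) :
    HasSum (fun n : ℤ => (-1) ^ n * e ((n : ℂ) ^ 2 * τ / 2 + n * z)) (th01 τ z) := by
  refine (hasSum_th00 hτ (z + 1 / 2)).congr_fun fun n => ?_
  rw [← e_int_half, ← e_add]
  congr 1; ring

theorem hasSum_th10 {τ : ℂ} (hτ : 0 < τ.im) (z : ℂ) :
    HasSum (fun n : ℤ => e (((n : ℂ) + 1 / 2) ^ 2 * τ / 2 + (n + 1 / 2) * z)) (th10 τ z) := by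
  refine ((hasSum_th00 hτ (z + τ / 2)).mul_left (e (τ / 8 + z / 2))).congr_fun fun n => ?_
  rw [← e_add]
  congr 1; ring

theorem th00_S {τ : ℂ} (hτ : 0 < τ.im) (z : ℂ) :
    th00 (-1 / τ) (z / τ) = rootS τ * e (z ^ 2 / (2 * τ)) * th00 τ z := by
  have hne : τ ≠ 0 := fun h => by rw [h] at hτ; simp at hτ
  have h1 := rootS_ne_zero hne
  have h2 : Complex.exp (-Real.pi * Complex.I * z ^ 2 / τ) = (e (z ^ 2 / (2 * τ)))⁻¹ := by
    rw [← e_neg, e]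
    congr 1
    field_simp
  rw [th00, th00, jacobiTheta₂_functional_equation z τ, h2]
  have h3 := e_ne_zero (z ^ 2 / (2 * τ))
  change _ = rootS τ * e (z ^ 2 / (2 * τ)) * (1 / rootS τ * _ * _)
  rw [one_div]
  calc _ = (rootS τ * (rootS τ)⁻¹) * (e (z ^ 2 / (2 * τ)) * (e (z ^ 2 / (2 * τ)))⁻¹)
        * jacobiTheta₂ (z / τ) (-1 / τ) := by rw [mul_inv_cancel₀ h1, mul_inv_cancel₀ h3]; ring
    _ = _ := by ring

/-- A shift of `z` by `τ/2` becomes a shift of `z/τ` by `1/2`. So `S` exchanges `ϑ₀₁` and `ϑ₁₀`, and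
the law of `ϑ₀₀` implies the other two. -/
theorem th01_S {τ : ℂ} (hτ : 0 < τ.im) (z : ℂ) :
    th01 (-1 / τ) (z / τ) = rootS τ * e (z ^ 2 / (2 * τ)) * th10 τ z := by
  have hne : τ ≠ 0 := fun h => by rw [h] at hτ; simp at hτ
  have h1 := th00_S hτ (z + τ / 2)
  rw [th00, th00, show (z + τ / 2) / τ = z / τ + 1 / 2 by field_simp] at h1
  rw [th01, h1, th10, ← mul_assoc, mul_assoc (rootS τ) (e _) (e _), ← e_add]
  congr 3
  field_simp; ring

theorem jacobiTheta₂_sub_half (z τ : ℂ) :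
    jacobiTheta₂ (z - 1 / 2) τ = jacobiTheta₂ (z + 1 / 2) τ := by
  rw [← jacobiTheta₂_add_left (z - 1 / 2)]
  congr 1; ring

theorem th10_S {τ : ℂ} (hτ : 0 < τ.im) (z : ℂ) :
    th10 (-1 / τ) (z / τ) = rootS τ * e (z ^ 2 / (2 * τ)) * th01 τ z := by
  have hne : τ ≠ 0 := fun h => by rw [h] at hτ; simp at hτ
  have h1 := th00_S hτ (z - 1 / 2)
  rw [th00, th00, jacobiTheta₂_sub_half] at h1
  rw [th10, show z / τ + -1 / τ / 2 = (z - 1 / 2) / τ by field_simp; ring, h1, th01, ← mul_assoc,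
    mul_left_comm, ← mul_assoc, mul_assoc (rootS τ), ← e_add]
  congr 3
  field_simp; ring

theorem neg_one_zpow_sq (n : ℤ) : e ((n : ℂ) ^ 2 / 2) = (-1) ^ n := by
  rw [← e_int_half]
  obtain ⟨m, hm⟩ := Int.even_mul_succ_self (n - 1)
  have h : ((n : ℂ)) ^ 2 / 2 = n / 2 + (m : ℤ) := by
    have : ((n : ℂ) - 1) * (n - 1 + 1) = m + m := by exact_mod_cast hm
    linear_combination this / 2
  rw [h, e_add_int]

theorem th00_T {τ : ℂ} (hτ : 0 < τ.im) (z : ℂ) : th00 (τ + 1) z = th01 τ z := by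
  refine (hasSum_th00 (by simpa using hτ) z).unique ((hasSum_th01 hτ z).congr_fun fun n => ?_)
  rw [← neg_one_zpow_sq, ← e_add]
  congr 1; ring

theorem th01_T {τ : ℂ} (hτ : 0 < τ.im) (z : ℂ) : th01 (τ + 1) z = th00 τ z := by
  refine (hasSum_th01 (by simpa using hτ) z).unique ((hasSum_th00 hτ z).congr_fun fun n => ?_)
  rw [← neg_one_zpow_sq, ← e_add]
  refine e_congr_int (n ^ 2) ?_
  push_cast; ring

theorem th10_T {τ : ℂ} (hτ : 0 < τ.im) (z : ℂ) : th10 (τ + 1) z = e (1 / 8) * th10 τ z := by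
  refine (hasSum_th10 (by simpa using hτ) z).unique
    (((hasSum_th10 hτ z).mul_left (e (1 / 8))).congr_fun fun n => ?_)
  obtain ⟨m, hm⟩ := Int.even_mul_succ_self n
  have h : (n : ℂ) * (n + 1) = m + m := by exact_mod_cast hm
  rw [← e_add]
  refine e_congr_int m ?_
  linear_combination h / 2

theorem th00_add_one (τ z : ℂ) : th00 τ (z + 1) = th00 τ z := jacobiTheta₂_add_left _ _

theorem th01_add_one (τ z : ℂ) : th01 τ (z + 1) = th01 τ z := by
  rw [th01, add_right_comm, jacobiTheta₂_add_left, th01]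

theorem th10_add_one (τ z : ℂ) : th10 τ (z + 1) = -th10 τ z := by
  rw [th10, add_right_comm, jacobiTheta₂_add_left, th10, add_div, ← add_assoc, e_add, e_half]
  ring

theorem jacobiTheta₂_add_self (z τ : ℂ) :
    jacobiTheta₂ (z + τ) τ = e (-τ / 2 - z) * jacobiTheta₂ z τ := by
  rw [jacobiTheta₂_add_left', e]
  congr 2; ring

theorem th00_add_self (τ z : ℂ) : th00 τ (z + τ) = e (-τ / 2 - z) * th00 τ z :=
  jacobiTheta₂_add_self _ _

theorem th01_add_self (τ z : ℂ) : th01 τ (z + τ) = -(e (-τ / 2 - z) * th01 τ z) := by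
  rw [th01, add_right_comm, jacobiTheta₂_add_self, th01, ← sub_sub, e_sub, e_half]
  ring

/-! ### Holomorphy of the theta functions in both variables -/

theorem differentiableAt_theta₂ {τ : ℂ} (hτ : 0 < τ.im) (z : ℂ) :
    DifferentiableAt ℂ (fun p : ℂ × ℂ => jacobiTheta₂ p.2 p.1) (τ, z) := by
  have h := (hasFDerivAt_jacobiTheta₂ z hτ).differentiableAt
  exact DifferentiableAt.comp (τ, z) (f := fun p : ℂ × ℂ => (p.2, p.1))
    (g := fun p : ℂ × ℂ => jacobiTheta₂ p.1 p.2) h (by fun_prop)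

section Differentiable

variable {E : Type*} [NormedAddCommGroup E] [NormedSpace ℂ E] {t ζ : E → ℂ} {x : E}

theorem _root_.DifferentiableAt.th00 (ht : DifferentiableAt ℂ t x) (hζ : DifferentiableAt ℂ ζ x)
    (h : 0 < (t x).im) : DifferentiableAt ℂ (fun y => th00 (t y) (ζ y)) x :=
  DifferentiableAt.comp (f := fun y => (t y, ζ y)) (g := fun p : ℂ × ℂ => jacobiTheta₂ p.2 p.1) x
    (differentiableAt_theta₂ h (ζ x)) (ht.prodMk hζ)

theorem _root_.DifferentiableAt.th01 (ht : DifferentiableAt ℂ t x) (hζ : DifferentiableAt ℂ ζ x)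
    (h : 0 < (t x).im) : DifferentiableAt ℂ (fun y => th01 (t y) (ζ y)) x :=
  DifferentiableAt.th00 ht (hζ.add_const _) h

theorem _root_.DifferentiableAt.e_comp (ht : DifferentiableAt ℂ t x) :
    DifferentiableAt ℂ (fun y => e (t y)) x :=
  DifferentiableAt.comp (g := e) x (differentiable_e _) ht

theorem _root_.DifferentiableAt.th10 (ht : DifferentiableAt ℂ t x) (hζ : DifferentiableAt ℂ ζ x)
    (h : 0 < (t x).im) : DifferentiableAt ℂ (fun y => th10 (t y) (ζ y)) x :=
  have h1 : DifferentiableAt ℂ (fun y => t y / 8 + ζ y / 2) x := by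
    simp only [div_eq_mul_inv]; fun_prop
  have h2 : DifferentiableAt ℂ (fun y => ζ y + t y / 2) x := by
    simp only [div_eq_mul_inv]; fun_prop
  h1.e_comp.mul (DifferentiableAt.th00 ht h2 h)

end Differentiable

/-! ### The theta constants do not vanish -/

theorem coe_S_smul (τ : ℍ) : ((ModularGroup.S • τ : ℍ) : ℂ) = -1 / (τ : ℂ) := by
  rw [modular_S_smul]
  change (-(τ : ℂ))⁻¹ = _
  rw [inv_neg, neg_div, one_div]

theorem coe_T_smul (τ : ℍ) : ((ModularGroup.T • τ : ℍ) : ℂ) = (τ : ℂ) + 1 := by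
  rw [modular_T_smul, UpperHalfPlane.coe_vadd]
  push_cast; ring

theorem th00_zero_S (τ : ℍ) : th00 (ModularGroup.S • τ : ℍ) 0 = rootS τ * th00 τ 0 := by
  have := th00_S τ.im_pos 0
  rw [coe_S_smul]
  simpa using this

theorem th01_zero_S (τ : ℍ) : th01 (ModularGroup.S • τ : ℍ) 0 = rootS τ * th10 τ 0 := by
  have := th01_S τ.im_pos 0
  rw [coe_S_smul]
  simpa using this

theorem th10_zero_S (τ : ℍ) : th10 (ModularGroup.S • τ : ℍ) 0 = rootS τ * th01 τ 0 := by
  have := th10_S τ.im_pos 0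
  rw [coe_S_smul]
  simpa using this

theorem mdifferentiable_of_differentiableAt {F : ℂ → ℂ}
    (h : ∀ τ : ℂ, 0 < τ.im → DifferentiableAt ℂ F τ) : MDiff (fun τ : ℍ => F τ) := by
  rw [UpperHalfPlane.mdifferentiable_iff]
  intro τ hτ
  refine (h τ hτ).differentiableWithinAt.congr (fun w hw => ?_) ?_
  · simp [ofComplex_apply_of_im_pos (show 0 < w.im from hw)]
  · simp [ofComplex_apply_of_im_pos (show 0 < τ.im from hτ)]

/-- The function `(ϑ₀₀ϑ₀₁ϑ₁₀)⁸`, proportional to the modular discriminant. -/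
def thetaProd (τ : ℍ) : ℂ := (th00 τ 0 * th01 τ 0 * th10 τ 0) ^ 8

theorem thetaProd_S : thetaProd ∣[(12 : ℤ)] ModularGroup.S = thetaProd := by
  ext τ
  have hd : UpperHalfPlane.denom ModularGroup.S τ = (τ : ℂ) := by
    rw [ModularGroup.denom_apply]; simp [ModularGroup.S]
  have h1 : rootS τ ^ 24 = (τ : ℂ) ^ 12 := by
    rw [show 24 = 2 * 12 by rfl, pow_mul, rootS_sq, mul_pow, neg_pow, Complex.I_pow_eq_pow_mod]
    norm_num
  rw [ModularForm.SL_slash_apply, hd, thetaProd, th00_zero_S, th01_zero_S, th10_zero_S, thetaProd,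
    zpow_neg, ← div_eq_mul_inv, div_eq_iff (zpow_ne_zero _ τ.ne_zero)]
  norm_cast
  rw [← h1]
  ring

theorem e_eighth_pow_eight : e (1 / 8) ^ 8 = 1 := by
  rw [← e_nat_mul, show ((8 : ℕ) : ℂ) * (1 / 8) = (1 : ℤ) by norm_num, e_int]

theorem thetaProd_T : thetaProd ∣[(12 : ℤ)] ModularGroup.T = thetaProd := by
  ext τ
  have hd : UpperHalfPlane.denom ModularGroup.T τ = 1 := by
    rw [ModularGroup.denom_apply]; simp [ModularGroup.T]
  rw [ModularForm.SL_slash_apply, hd, thetaProd, coe_T_smul, th00_T τ.im_pos, th01_T τ.im_pos,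
    th10_T τ.im_pos, thetaProd]
  have := e_eighth_pow_eight
  simp only [mul_pow, this, one_zpow]
  ring

theorem thetaProd_isZeroAtImInfty : IsZeroAtImInfty thetaProd := by
  have h0 : IsBoundedAtImInfty (fun τ : ℍ => th00 τ 0) :=
    isBoundedAtImInfty_of_hasSum (a := fun _ : ℤ => 1) (ν := fun n : ℤ => (n : ℝ) ^ 2 / 2)
      (fun n _ => by positivity) fun τ => by
        refine (hasSum_th00 τ.im_pos 0).congr_fun fun n => ?_
        push_cast; rw [one_mul]; congr 1; ring
  have h1 : IsBoundedAtImInfty (fun τ : ℍ => th01 τ 0) :=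
    isBoundedAtImInfty_of_hasSum (a := fun n : ℤ => (-1) ^ n) (ν := fun n : ℤ => (n : ℝ) ^ 2 / 2)
      (fun n _ => by positivity) fun τ => by
        refine (hasSum_th01 τ.im_pos 0).congr_fun fun n => ?_
        push_cast; congr 2; ring
  have h2 : IsZeroAtImInfty (fun τ : ℍ => th10 τ 0) :=
    isZeroAtImInfty_of_hasSum (a := fun n : ℤ => 1) (ν := fun n : ℤ => ((n : ℝ) + 1 / 2) ^ 2 / 2)
      (fun n _ => by
        have : (n : ℝ) + 1 / 2 ≠ 0 := fun h => by
          have : ((2 * n + 1 : ℤ) : ℝ) = 0 := by push_cast; linarith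
          have : 2 * n + 1 = 0 := by exact_mod_cast this
          omega
        positivity) fun τ => by
        refine (hasSum_th10 τ.im_pos 0).congr_fun fun n => ?_
        push_cast; rw [one_mul]; congr 1; ring
  have h3 : Tendsto (fun τ : ℍ => th00 τ 0 * th01 τ 0 * th10 τ 0) atImInfty (𝓝 0) := by
    refine (Asymptotics.isLittleO_one_iff ℝ).1 ?_
    simpa using (h0.mul h1).mul_isLittleO ((Asymptotics.isLittleO_one_iff ℝ).2 h2)
  simpa [IsZeroAtImInfty, ZeroAtFilter, thetaProd] using! h3.pow 8

/-- `(ϑ₀₀ϑ₀₁ϑ₁₀)⁸` as a cusp form of weight `12`. -/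
def thetaProdForm : CuspForm 𝒮ℒ 12 where
  toFun := thetaProd
  slash_action_eq' A hA := by
    obtain ⟨A, rfl⟩ := hA
    exact SlashInvariantForm.slash_action_generators_SL2Z thetaProd_S thetaProd_T A
  holo' := mdifferentiable_of_differentiableAt
    (F := fun τ => (th00 τ 0 * th01 τ 0 * th10 τ 0) ^ 8) fun τ hτ => by
      have h := differentiableAt_id (𝕜 := ℂ) (x := τ)
      have h' := differentiableAt_const (𝕜 := ℂ) (0 : ℂ) (x := τ)
      exact (((h.th00 h' hτ).mul (h.th01 h' hτ)).mul (h.th10 h' hτ)).pow 8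
  zero_at_cusps' hc := by
    rw [Subgroup.IsArithmetic.isCusp_iff_isCusp_SL2Z] at hc
    rw [OnePoint.isZeroAt_iff_forall_SL2Z hc]
    intro γ _
    rw [SlashInvariantForm.slash_action_generators_SL2Z thetaProd_S thetaProd_T]
    exact thetaProd_isZeroAtImInfty

/-- On the imaginary axis all terms are positive real numbers. -/
theorem tsum_e_ne_zero {a : ℤ → ℝ} {s : ℂ}
    (h : HasSum (fun n : ℤ => e (a n * Complex.I)) s) : s ≠ 0 := by
  have h1 : ∀ n, e (a n * Complex.I) = ((Real.exp (-2 * Real.pi * a n) : ℝ) : ℂ) := fun n => by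
    rw [e, Complex.ofReal_exp]
    congr 1
    push_cast
    linear_combination 2 * Real.pi * a n * Complex.I_mul_I
  simp_rw [h1] at h
  have h2 : Summable fun n : ℤ => Real.exp (-2 * Real.pi * a n) := by
    have := h.summable
    exact_mod_cast this
  have h3 : s = ((∑' n : ℤ, Real.exp (-2 * Real.pi * a n) : ℝ) : ℂ) := by
    rw [Complex.ofReal_tsum]
    exact h.tsum_eq.symm
  rw [h3]
  have := h2.tsum_pos (fun n => (Real.exp_pos _).le) 0 (Real.exp_pos _)
  exact_mod_cast this.ne'

theorem thetaProd_I_ne_zero : thetaProd UpperHalfPlane.I ≠ 0 := by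
  have h0 : th00 UpperHalfPlane.I 0 ≠ 0 :=
    tsum_e_ne_zero (a := fun n => (n : ℝ) ^ 2 / 2)
      ((hasSum_th00 UpperHalfPlane.I.im_pos 0).congr_fun fun n => by
        push_cast; congr 1; ring)
  have h2 : th10 UpperHalfPlane.I 0 ≠ 0 :=
    tsum_e_ne_zero (a := fun n => ((n : ℝ) + 1 / 2) ^ 2 / 2)
      ((hasSum_th10 UpperHalfPlane.I.im_pos 0).congr_fun fun n => by
        push_cast; congr 1; ring)
  -- The terms of `ϑ₀₁` alternate in sign, so positivity does not apply; but `S` fixes `i` and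
  -- relates `ϑ₀₁` there to `ϑ₁₀`.
  have h1 : th01 UpperHalfPlane.I 0 ≠ 0 := by
    have h := th10_zero_S UpperHalfPlane.I
    rw [coe_S_smul, UpperHalfPlane.coe_I, show (-1 / Complex.I : ℂ) = Complex.I by
      rw [div_eq_iff Complex.I_ne_zero, Complex.I_mul_I]] at h
    rw [UpperHalfPlane.coe_I] at h2 ⊢
    intro h3
    rw [h3, mul_zero] at h
    exact h2 h
  exact pow_ne_zero _ (mul_ne_zero (mul_ne_zero h0 h1) h2)

/-- Cusp forms of weight `12` and level one are multiples of the discriminant, which has no zeros;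
the value at `i` shows that the multiple is not zero. -/
theorem thetaProd_ne_zero (τ : ℍ) : thetaProd τ ≠ 0 := by
  obtain ⟨c, hc⟩ := CuspForm.exists_smul_discriminant_of_weight_eq_twelve thetaProdForm
  have h : ∀ τ, thetaProd τ = c * ModularForm.discriminant τ := fun τ =>
    (congrFun (congrArg DFunLike.coe hc) τ).symm
  rw [h]
  refine mul_ne_zero (fun h0 => thetaProd_I_ne_zero ?_) (ModularForm.discriminant_ne_zero τ)
  rw [h, h0, zero_mul]

theorem th00_ne_zero (τ : ℍ) : th00 τ 0 ≠ 0 := fun h => by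
  simpa [thetaProd, h] using thetaProd_ne_zero τ

theorem th01_ne_zero (τ : ℍ) : th01 τ 0 ≠ 0 := fun h => by
  simpa [thetaProd, h] using thetaProd_ne_zero τ

theorem th10_ne_zero (τ : ℍ) : th10 τ 0 ≠ 0 := fun h => by
  simpa [thetaProd, h] using thetaProd_ne_zero τ

end

noncomputable section

/-! ### Words in `S` and `T` -/

/-- The inverses of `S` and `T` are positive words in `S` and `T`, so no induction step for inverses
is needed. -/
theorem SL2Z_induction {P : SL(2, ℤ) → Prop} (one : P 1)
    (hS : ∀ γ, P γ → P (γ * ModularGroup.S)) (hT : ∀ γ, P γ → P (γ * ModularGroup.T))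
    (γ : SL(2, ℤ)) : P γ := by
  have hmem : γ ∈ Subgroup.closure {ModularGroup.S, ModularGroup.T} := by
    rw [SpecialLinearGroup.SL2Z_generators]; trivial
  have hSi : ∀ γ, P γ → P (γ * ModularGroup.S⁻¹) := fun γ h => by
    have h1 : ModularGroup.S⁻¹ = ModularGroup.S * ModularGroup.S * ModularGroup.S := by decide
    rw [h1, ← mul_assoc, ← mul_assoc]
    exact hS _ (hS _ (hS _ h))
  have hTi : ∀ γ, P γ → P (γ * ModularGroup.T⁻¹) := fun γ h => by
    have h1 : ModularGroup.T⁻¹ = ModularGroup.S * ModularGroup.S * ModularGroup.S * ModularGroup.T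
        * ModularGroup.S * ModularGroup.T * ModularGroup.S := by decide
    rw [h1]
    simp only [← mul_assoc]
    exact hS _ (hT _ (hS _ (hT _ (hS _ (hS _ (hS _ h))))))
  induction hmem using Subgroup.closure_induction_right with
  | one => exact one
  | mul_right x hx y hy h =>
    rcases hy with rfl | rfl
    · exact hS _ h
    · exact hT _ h
  | mul_inv_cancel x hx y hy h =>
    rcases hy with rfl | rfl
    · exact hSi _ h
    · exact hTi _ h

theorem mul_S_apply (γ : SL(2, ℤ)) :
    (γ * ModularGroup.S) 0 0 = γ 0 1 ∧ (γ * ModularGroup.S) 0 1 = -γ 0 0 ∧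
    (γ * ModularGroup.S) 1 0 = γ 1 1 ∧ (γ * ModularGroup.S) 1 1 = -γ 1 0 := by
  simp only [Matrix.SpecialLinearGroup.coe_mul, ModularGroup.coe_S, Matrix.mul_apply,
    Fin.sum_univ_two]
  simp

theorem mul_T_apply (γ : SL(2, ℤ)) :
    (γ * ModularGroup.T) 0 0 = γ 0 0 ∧ (γ * ModularGroup.T) 0 1 = γ 0 0 + γ 0 1 ∧
    (γ * ModularGroup.T) 1 0 = γ 1 0 ∧ (γ * ModularGroup.T) 1 1 = γ 1 0 + γ 1 1 := by
  simp only [Matrix.SpecialLinearGroup.coe_mul, ModularGroup.coe_T, Matrix.mul_apply,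
    Fin.sum_univ_two]
  simp

theorem det_eq (γ : SL(2, ℤ)) : γ 0 0 * γ 1 1 - γ 0 1 * γ 1 0 = 1 := by
  rw [← Matrix.det_fin_two, γ.det_coe]

theorem slash_S_slash_S (w : ℤ) (f : ℍ → ℂ) :
    (f ∣[w] ModularGroup.S) ∣[w] ModularGroup.S = ((-1 : ℂ) ^ w) • f := by
  rw [← SlashAction.slash_mul, show ModularGroup.S * ModularGroup.S = -1 by decide]
  ext τ
  have hd : UpperHalfPlane.denom (-1 : SL(2, ℤ)) τ = -1 := by
    rw [ModularGroup.denom_apply]; simp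
  rw [ModularForm.SL_slash_apply, hd, ModularGroup.SL_neg_smul, one_smul, zpow_neg, ← inv_zpow,
    inv_neg, inv_one, Pi.smul_apply, smul_eq_mul, mul_comm]

/-- Think of `R t` as the translate of `R 0` by `Tᵗ`. Up to the character, `R 0 ∣ γ` depends only on
the top row `(a, b)` of `γ`. For odd `a` the matrix acts like `T^s` with `s ≡ ab` modulo `8`,
because `a² ≡ 1`. For even `a` it acts like `T^s S` with `s ≡ -ab`, the top row of `T^s S` being
`(s, -1)`. The proof follows the top row along a word in `S` and `T`; when `8` divides `b` it yields
the transformation law of `R 0`. -/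
theorem slash_coset {w : ℤ} {R : ℤ → ℍ → ℂ} {χ : ℤ → ℂ}
    (hmul : ∀ a b, χ (a * b) = χ a * χ b) (hone : χ 1 = 1) (hw : χ (-1) = (-1) ^ w)
    (hper4 : ∀ a, χ (a + 4) = χ a) (hper : ∀ s t : ℤ, s ≡ t [ZMOD 8] → R s = R t)
    (hT : ∀ t, R t ∣[w] ModularGroup.T = R (t + 1))
    (hS : ∀ t, Odd t → R t ∣[w] ModularGroup.S = χ t • R (-t))
    (h0 : ∀ t, 4 ∣ t → (R t ∣[w] ModularGroup.S) ∣[w] ModularGroup.T = R t ∣[w] ModularGroup.S)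
    (h2 : ∀ t, 4 ∣ t + 2 → (R t ∣[w] ModularGroup.S) ∣[w] ModularGroup.T
      = χ (-1) • (R (t + 4) ∣[w] ModularGroup.S)) (γ : SL(2, ℤ)) :
    (Odd (γ 0 0) → R 0 ∣[w] γ = χ (γ 0 0) • R (γ 0 0 * γ 0 1)) ∧
    (Even (γ 0 0) → R 0 ∣[w] γ
      = χ (-γ 0 1) • (R (-(γ 0 0 * γ 0 1)) ∣[w] ModularGroup.S)) := by
  have hneg : ∀ a, χ (-a) = χ (-1) * χ a := fun a => by rw [← hmul]; ring_nf
  have hnn : χ (-1) * χ (-1) = 1 := by rw [← hmul, ← hone]; norm_num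
  have hw2 : χ (-1) * (-1) ^ w = 1 := by rw [← hw, hnn]
  have hper4' : ∀ a k, χ (a + 4 * k) = χ a := by
    intro a k
    induction k using Int.induction_on with
    | zero => simp
    | succ n ih => rw [mul_add, mul_one, ← add_assoc, hper4, ih]
    | pred n ih => rw [← ih, mul_sub, mul_one, ← hper4]; ring_nf
  have hper2 : ∀ b, Odd b → χ (b + 2) = χ (-b) := fun b ⟨k, hk⟩ => by
    rw [← hper4' (-b) (k + 1), hk]; congr 1; ring
  induction γ using SL2Z_induction with
  | one =>
    have h1 : (1 : SL(2, ℤ)) 0 0 = 1 := rfl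
    have h2 : (1 : SL(2, ℤ)) 0 1 = 0 := rfl
    rw [h1, h2]
    refine ⟨fun _ => by rw [SlashAction.slash_one, hone, one_smul, mul_zero], fun h => ?_⟩
    exact absurd h (by decide)
  | hS γ ih =>
    obtain ⟨e0, e1, -, -⟩ := mul_S_apply γ
    have hdet := det_eq γ
    rw [e0, e1, SlashAction.slash_mul]
    set a := γ 0 0
    set b := γ 0 1
    refine ⟨fun hb => ?_, fun hb => ?_⟩
    · rcases Int.even_or_odd a with ha | ha
      · rw [ih.2 ha, ModularForm.SL_smul_slash, slash_S_slash_S, smul_smul, hneg, mul_right_comm,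
          hw2, one_mul]
        congr 2; ring
      · rw [ih.1 ha, ModularForm.SL_smul_slash, hS _ (ha.mul hb), smul_smul, hmul, ← mul_assoc]
        have haa : χ a * χ a = 1 := by
          obtain ⟨k, hk⟩ := ha
          rw [← hmul, ← hone, hk]
          rw [← hper4' 1 (k ^ 2 + k)]; congr 1; ring
        rw [haa, one_mul]
        congr 2; ring
    · have ha : Odd a := by
        by_contra h
        rw [Int.not_odd_iff_even] at h
        have : Even (1 : ℤ) := by rw [← hdet]; exact (h.mul_right _).sub (hb.mul_right _)
        exact absurd this (by decide)
      rw [ih.1 ha, ModularForm.SL_smul_slash]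
      congr 3
      · ring
      · ring
  | hT γ ih =>
    obtain ⟨e0, e1, -, -⟩ := mul_T_apply γ
    have hdet := det_eq γ
    rw [e0, e1, SlashAction.slash_mul]
    set a := γ 0 0
    set b := γ 0 1
    refine ⟨fun ha => ?_, fun ha => ?_⟩
    · rw [ih.1 ha, ModularForm.SL_smul_slash, hT]
      congr 1
      refine hper _ _ ?_
      have h8 : a * a ≡ 1 [ZMOD 8] := by
        obtain ⟨k, hk⟩ := ha
        obtain ⟨l, hl⟩ := Int.even_mul_succ_self k
        refine Int.modEq_iff_dvd.2 ⟨-l, ?_⟩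
        rw [hk]
        linear_combination (-4) * hl
      have := (h8.add_right (a * b)).symm
      rw [mul_add, add_comm (a * b) 1]
      exact this
    · have hb : Odd b := by
        by_contra h
        rw [Int.not_odd_iff_even] at h
        have : Even (1 : ℤ) := by rw [← hdet]; exact (ha.mul_right _).sub (h.mul_right _)
        exact absurd this (by decide)
      rw [ih.2 ha, ModularForm.SL_smul_slash]
      obtain ⟨m, hm⟩ := ha
      -- Here `a = 2m`. For even `m` the index is divisible by `4` and `T` fixes `R t ∣ S`; for odd
      -- `m` the index is `2` modulo `4`, and `T` moves it by `4` at the cost of the sign `χ(-1)`.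
      rcases Int.even_or_odd m with ⟨l, hl⟩ | ⟨l, hl⟩
      · rw [h0 _ ⟨-(l * b), by rw [hm, hl]; ring⟩]
        rw [show -(a + b) = -b + 4 * -l by rw [hm, hl]; ring, hper4',
          hper (-(a * (a + b))) (-(a * b)) (Int.modEq_iff_dvd.2 ⟨2 * l ^ 2, by rw [hm, hl]; ring⟩)]
      · obtain ⟨n, hn⟩ := hb
        rw [h2 _ ⟨-(l * b) - n, by rw [hm, hl, hn]; ring⟩, smul_smul]
        have : -(a + b) = (-b - 2) + 4 * (-l) := by rw [hm, hl]; ring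
        rw [this, hper4', mul_comm, ← hneg, ← hper4' (-b - 2) 1, neg_neg,
          show -b - 2 + 4 * 1 = -b + 2 by ring, hper2 (-b) ⟨-n - 1, by rw [hn]; ring⟩, neg_neg,
          hper (-(a * (a + b))) (-(a * b) + 4)
            (Int.modEq_iff_dvd.2 ⟨2 * l ^ 2 + 2 * l + 1, by rw [hm, hl]; ring⟩)]

/-! ### Triples transforming like the theta constants -/

/-- `(g, u, W)` transforms in weight `K/2` like `(ϑ₀₀, ϑ₀₁, ϑ₁₀)`, up to the sign `ε` and a Galois
twist. -/
structure IsThetaTriple (K : ℕ) (ε : ℂ) (g u W : ℍ → ℂ) : Prop where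
  g_T : ∀ τ : ℍ, g (ModularGroup.T • τ) = u τ
  u_T : ∀ τ : ℍ, u (ModularGroup.T • τ) = g τ
  W_T : ∀ τ : ℍ, W (ModularGroup.T • τ) = ε * e (1 / 8) ^ K * W τ
  g_S : ∀ τ : ℍ, g (ModularGroup.S • τ) = ε * rootS τ ^ K * g τ
  u_S : ∀ τ : ℍ, u (ModularGroup.S • τ) = ε * rootS τ ^ K * W τ
  W_S : ∀ τ : ℍ, W (ModularGroup.S • τ) = ε * rootS τ ^ K * u τ

theorem isThetaTriple_thetaConstants :
    IsThetaTriple 1 1 (fun τ => th00 τ 0) (fun τ => th01 τ 0) (fun τ => th10 τ 0) where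
  g_T τ := by simp only [coe_T_smul, th00_T τ.im_pos]
  u_T τ := by simp only [coe_T_smul, th01_T τ.im_pos]
  W_T τ := by simp only [coe_T_smul, th10_T τ.im_pos, one_mul, pow_one]
  g_S τ := by simp only [th00_zero_S, one_mul, pow_one]
  u_S τ := by simp only [th01_zero_S, one_mul, pow_one]
  W_S τ := by simp only [th10_zero_S, one_mul, pow_one]

/-- The translate by `t` of `g + W`. -/
def translate (ξ : ℂ) (g u W : ℍ → ℂ) (t : ℤ) (τ : ℍ) : ℂ :=
  (if Even t then g τ else u τ) + ξ ^ t * W τ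

theorem e_eighth_pow_two : e (1 / 8) ^ 2 = Complex.I := by
  rw [← e_nat_mul, ← e_quarter]; congr 1; norm_num

theorem e_eighth_pow_four : e (1 / 8) ^ 4 = -1 := by
  rw [show 4 = 2 * 2 by rfl, pow_mul, e_eighth_pow_two, Complex.I_sq]

section Triple

variable {K : ℕ} {ε : ℂ} {g u W : ℍ → ℂ}

theorem twist_pow_eight (hε : ε ^ 2 = 1) : (ε * e (1 / 8) ^ K) ^ 8 = 1 := by
  rw [mul_pow, show 8 = 2 * 4 by rfl, pow_mul ε, hε, one_pow, one_mul, ← pow_mul, mul_comm K,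
    pow_mul, show 2 * 4 = 8 by rfl, e_eighth_pow_eight, one_pow]

theorem twist_ne_zero (hε : ε ^ 2 = 1) : ε * e (1 / 8) ^ K ≠ 0 := fun h => by
  have := twist_pow_eight (K := K) hε
  rw [h] at this
  norm_num at this

theorem twist_zpow_odd (hε : ε ^ 2 = 1) {t : ℤ} (ht : Odd t) :
    (ε * e (1 / 8) ^ K) ^ t = ε * (e (1 / 8) ^ t) ^ K := by
  obtain ⟨m, rfl⟩ := ht
  have h0 : ε ≠ 0 := fun h => by rw [h] at hε; norm_num at hε
  rw [mul_zpow, zpow_add₀ h0, zpow_mul, zpow_one]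
  norm_cast
  rw [hε]
  simp only [one_zpow, one_mul]
  rw [← zpow_natCast, ← zpow_natCast, ← zpow_mul, ← zpow_mul, mul_comm (K : ℤ), mul_comm]

theorem twist_zpow_even (hε : ε ^ 2 = 1) {t : ℤ} (ht : Even t) :
    (ε * e (1 / 8) ^ K) ^ t = (e (1 / 8) ^ t) ^ K := by
  obtain ⟨m, rfl⟩ := ht
  have h0 : ε ≠ 0 := fun h => by rw [h] at hε; norm_num at hε
  rw [mul_zpow, ← two_mul, zpow_mul]
  norm_cast
  rw [hε]
  simp only [one_zpow, one_mul]
  rw [← zpow_natCast, ← zpow_natCast, ← zpow_mul, ← zpow_mul, mul_comm]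

theorem translate_congr {ξ : ℂ} (hξ : ξ ^ 8 = 1) {s t : ℤ} (h : s ≡ t [ZMOD 8]) :
    translate ξ g u W s = translate ξ g u W t := by
  obtain ⟨k, hk⟩ := Int.modEq_iff_dvd.1 h
  have h0 : ξ ≠ 0 := fun h => by rw [h] at hξ; norm_num at hξ
  obtain rfl : t = s + 8 * k := by linarith
  have h8 : ξ ^ (8 : ℤ) = 1 := by exact_mod_cast hξ
  funext τ
  have hev : Even (s + 8 * k) ↔ Even s := by
    rw [Int.even_add]
    have : Even (8 * k) := ⟨4 * k, by ring⟩
    tauto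
  simp only [translate, hev, zpow_add₀ h0, zpow_mul, h8, one_zpow, mul_one]

theorem IsThetaTriple.translate_T (h : IsThetaTriple K ε g u W) (hε : ε ^ 2 = 1) (t : ℤ) (τ : ℍ) :
    translate (ε * e (1 / 8) ^ K) g u W t (ModularGroup.T • τ)
      = translate (ε * e (1 / 8) ^ K) g u W (t + 1) τ := by
  simp only [translate, h.g_T, h.u_T, h.W_T, zpow_add_one₀ (twist_ne_zero hε), Int.even_add_one]
  split_ifs <;> ring

/-- For odd `t` the sign `ε` from the law under `S` cancels against the twist in the powers of `ξ`.
What remains is exactly the `K`-th power of the factor of `thetaTranslate`, so the quotient of the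
two has no factor at all. -/
theorem IsThetaTriple.translate_S_odd (h : IsThetaTriple K ε g u W) (hε : ε ^ 2 = 1) {t : ℤ}
    (ht : Odd t) (τ : ℍ) :
    translate (ε * e (1 / 8) ^ K) g u W t (ModularGroup.S • τ)
      = (rootS τ * e (1 / 8) ^ t) ^ K * translate (ε * e (1 / 8) ^ K) g u W (-t) τ := by
  have h1 : ¬ Even t := Int.not_even_iff_odd.2 ht
  have h0 := twist_ne_zero (K := K) hε
  simp only [translate, h.u_S, h.W_S, h1, even_neg, if_false]
  have h2 := twist_zpow_odd (K := K) hε ht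
  have h3 : (e (1 / 8) ^ t) ^ K = ε * (ε * e (1 / 8) ^ K) ^ t := by
    rw [h2, ← mul_assoc, ← pow_two, hε, one_mul]
  rw [mul_pow, h3, zpow_neg]
  have h4 := zpow_ne_zero t h0
  field_simp
  ring

theorem IsThetaTriple.translate_S_even (h : IsThetaTriple K ε g u W) (hε : ε ^ 2 = 1) {t : ℤ}
    (ht : Even t) (τ : ℍ) :
    translate (ε * e (1 / 8) ^ K) g u W t (ModularGroup.S • τ)
      = ε * rootS τ ^ K * (g τ + (e (1 / 8) ^ t) ^ K * u τ) := by
  simp only [translate, h.g_S, h.W_S, ht, if_true, twist_zpow_even hε ht]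
  ring

/-- The translates of the theta constant `ϑ₀₀ + ϑ₁₀`. -/
def thetaTranslate (t : ℤ) (τ : ℍ) : ℂ :=
  translate (e (1 / 8)) (fun τ => th00 τ 0) (fun τ => th01 τ 0) (fun τ => th10 τ 0) t τ

theorem thetaTranslate_T (t : ℤ) (τ : ℍ) :
    thetaTranslate t (ModularGroup.T • τ) = thetaTranslate (t + 1) τ := by
  have := isThetaTriple_thetaConstants.translate_T (by norm_num) t τ
  simp only [one_mul, pow_one] at this
  exact this

theorem thetaTranslate_S_odd {t : ℤ} (ht : Odd t) (τ : ℍ) :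
    thetaTranslate t (ModularGroup.S • τ) = rootS τ * e (1 / 8) ^ t * thetaTranslate (-t) τ := by
  have := isThetaTriple_thetaConstants.translate_S_odd (by norm_num) ht τ
  simp only [one_mul, pow_one] at this
  exact this

theorem thetaTranslate_S_even {t : ℤ} (ht : Even t) (τ : ℍ) :
    thetaTranslate t (ModularGroup.S • τ)
      = rootS τ * (th00 τ 0 + e (1 / 8) ^ t * th01 τ 0) := by
  have := isThetaTriple_thetaConstants.translate_S_even (by norm_num) ht τ
  simp only [one_mul, pow_one] at this
  exact this

theorem thetaTranslate_congr {s t : ℤ} (h : s ≡ t [ZMOD 8]) :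
    thetaTranslate s = thetaTranslate t := by
  have := translate_congr (g := fun τ : ℍ => th00 τ 0) (u := fun τ => th01 τ 0)
    (W := fun τ => th10 τ 0) e_eighth_pow_eight h
  exact this

theorem e_eighth_zpow_four_mul (k : ℤ) :
    (e (1 / 8) ^ (4 * k)) ^ 2 = 1 := by
  have : e (1 / 8) ^ (4 : ℤ) = -1 := by exact_mod_cast e_eighth_pow_four
  rw [zpow_mul, this, ← zpow_natCast, ← zpow_mul, mul_comm, zpow_mul]
  norm_num

theorem e_eighth_zpow_four_mul_sub (k : ℤ) :
    (e (1 / 8) ^ (4 * k - 2)) ^ 2 = -1 := by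
  have h : e (1 / 8) ^ (2 : ℤ) = Complex.I := by exact_mod_cast e_eighth_pow_two
  rw [zpow_sub₀ (e_ne_zero _), h, div_pow, e_eighth_zpow_four_mul, Complex.I_sq]
  norm_num

theorem slash_zero_apply (f : ℍ → ℂ) (γ : SL(2, ℤ)) (τ : ℍ) :
    (f ∣[(0 : ℤ)] γ) τ = f (γ • τ) := by
  rw [ModularForm.SL_slash_apply]; simp

/-- Division by the `K`-th power of the theta constant turns the problem into weight zero with
trivial character. No branch of a square root has to be followed through `SL(2, ℤ)`; only the
hypotheses of `slash_coset` have to be checked on `S` and `T`. -/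
theorem IsThetaTriple.quotient_smul (h : IsThetaTriple K ε g u W) (hε : ε ^ 2 = 1) (hK : Odd K)
    {γ : SL(2, ℤ)} (hγ : 8 ∣ γ 0 1) (τ : ℍ) :
    translate (ε * e (1 / 8) ^ K) g u W 0 (γ • τ) / thetaTranslate 0 (γ • τ) ^ K
      = translate (ε * e (1 / 8) ^ K) g u W 0 τ / thetaTranslate 0 τ ^ K := by
  set ξ := ε * e (1 / 8) ^ K with hξ
  have hξ8 : ξ ^ 8 = 1 := twist_pow_eight hε
  have hne : ∀ τ : ℍ, rootS τ ≠ 0 := fun τ => rootS_ne_zero τ.ne_zero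
  set R : ℤ → ℍ → ℂ := fun t τ => translate ξ g u W t τ / thetaTranslate t τ ^ K with hR
  have hRS : ∀ t, Even t → ∀ τ : ℍ, R t (ModularGroup.S • τ) = ε * (g τ + (e (1 / 8) ^ t) ^ K * u τ)
      / (th00 τ 0 + e (1 / 8) ^ t * th01 τ 0) ^ K := fun t ht τ => by
    simp only [hR]
    rw [h.translate_S_even hε ht, thetaTranslate_S_even ht, mul_pow, mul_right_comm, mul_comm _ (rootS τ ^ K),
      mul_div_mul_left _ _ (pow_ne_zero _ (hne τ))]
  have key := slash_coset (w := 0) (R := R) (χ := fun _ => 1) (by simp) rfl (by simp) (by simp)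
    (fun s t hst => by simp only [hR, translate_congr hξ8 hst, thetaTranslate_congr hst])
    (fun t => by
      ext τ
      rw [slash_zero_apply]
      simp only [hR, thetaTranslate_T, hξ, h.translate_T hε])
    (fun t ht => by
      ext τ
      rw [slash_zero_apply, one_smul]
      simp only [hR]
      rw [h.translate_S_odd hε ht, thetaTranslate_S_odd ht, mul_pow (_ * _) (thetaTranslate _ _),
        mul_div_mul_left]
      exact pow_ne_zero _ (mul_ne_zero (hne τ) (zpow_ne_zero _ (e_ne_zero _))))
    -- Here `δ = ±1`, so `δ^K = δ` for odd `K`, and exchanging `g` and `u` multiplies `g + δu` by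
    -- `δ`. The denominator acquires the same factor.
    (fun t ⟨k, hk⟩ => by
      ext τ
      rw [slash_zero_apply, slash_zero_apply, slash_zero_apply]
      have ht : Even t := ⟨2 * k, by rw [hk]; ring⟩
      rw [hRS t ht, hRS t ht, h.g_T, h.u_T, coe_T_smul, th00_T τ.im_pos, th01_T τ.im_pos]
      have h1 : (e (1 / 8) ^ t) ^ 2 = 1 := by rw [hk, e_eighth_zpow_four_mul]
      set δ := e (1 / 8) ^ t
      have h2 : δ ^ K = δ := by
        obtain ⟨m, rfl⟩ := hK
        rw [pow_succ, pow_mul, h1, one_pow, one_mul]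
      have h3 : δ ≠ 0 := zpow_ne_zero _ (e_ne_zero _)
      rw [h2, show u τ + δ * g τ = δ * (g τ + δ * u τ) by linear_combination (-u τ) * h1,
        show th01 τ 0 + δ * th00 τ 0 = δ * (th00 τ 0 + δ * th01 τ 0) by
          linear_combination (-th01 τ 0) * h1, mul_pow, h2, mul_left_comm, mul_div_mul_left _ _ h3])
    -- Here `δ = ±i`, so `(δ^K)² = -1` for odd `K`. Exchanging `g` and `u` multiplies by `δ^K` and
    -- changes the sign in front of `u`, which is what the shift of `t` by `4` does.
    (fun t ⟨k, hk⟩ => by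
      ext τ
      rw [one_smul, slash_zero_apply, slash_zero_apply, slash_zero_apply]
      have ht : Even t := ⟨2 * k - 1, by linarith⟩
      have ht' : Even (t + 4) := ⟨2 * k + 1, by linarith⟩
      rw [hRS t ht, hRS (t + 4) ht', h.g_T, h.u_T, coe_T_smul, th00_T τ.im_pos, th01_T τ.im_pos]
      have h1 : (e (1 / 8) ^ t) ^ 2 = -1 := by
        rw [show t = 4 * k - 2 by linarith, e_eighth_zpow_four_mul_sub]
      have h4 : e (1 / 8) ^ (t + 4) = -e (1 / 8) ^ t := by
        have : e (1 / 8) ^ (4 : ℤ) = -1 := by exact_mod_cast e_eighth_pow_four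
        rw [zpow_add₀ (e_ne_zero _), this]; ring
      rw [h4]
      set δ := e (1 / 8) ^ t
      have h3 : δ ≠ 0 := zpow_ne_zero _ (e_ne_zero _)
      have h5 : (δ ^ K) ^ 2 = -1 := by
        rw [← pow_mul, mul_comm, pow_mul, h1, hK.neg_one_pow]
      rw [hK.neg_pow, show u τ + δ ^ K * g τ = δ ^ K * (g τ + -δ ^ K * u τ) by
          linear_combination (u τ) * h5,
        show th01 τ 0 + δ * th00 τ 0 = δ * (th00 τ 0 + -δ * th01 τ 0) by
          linear_combination (th01 τ 0) * h1, mul_pow, mul_left_comm,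
        mul_div_mul_left _ _ (pow_ne_zero _ h3)]) γ
  have hodd : Odd (γ 0 0) := by
    by_contra h
    rw [Int.not_odd_iff_even] at h
    have h2 : Even (γ 0 1) := by obtain ⟨k, hk⟩ := hγ; exact ⟨4 * k, by rw [hk]; ring⟩
    have : Even (1 : ℤ) := by rw [← det_eq γ]; exact (h.mul_right _).sub (h2.mul_right _)
    exact absurd this (by decide)
  have h1 := congrFun (key.1 hodd) τ
  rw [slash_zero_apply, one_smul] at h1
  simp only [hR] at h1
  have h2 : γ 0 0 * γ 0 1 ≡ 0 [ZMOD 8] := Int.modEq_zero_iff_dvd.2 (hγ.mul_left _)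
  rwa [translate_congr hξ8 h2, thetaTranslate_congr h2] at h1

/-- The character `(-4 / ·)` with complex values. -/
def chi4 (a : ℤ) : ℂ := ((ZMod.χ₄ (a : ZMod 4) : ℤ) : ℂ)

theorem chi4_odd {t : ℤ} (ht : Odd t) : e (1 / 8) ^ (2 * t) = Complex.I * chi4 t := by
  have h : e (1 / 8) ^ (2 : ℤ) = Complex.I := by exact_mod_cast e_eighth_pow_two
  have h4 : (Complex.I) ^ (4 : ℤ) = 1 := by exact_mod_cast Complex.I_pow_four
  have h42 : (Complex.I) ^ (2 : ℤ) = -1 := by exact_mod_cast Complex.I_sq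
  rw [zpow_mul, h, chi4]
  obtain ⟨m, rfl⟩ := ht
  rw [zpow_add₀ Complex.I_ne_zero, zpow_one, mul_comm]
  congr 1
  rcases Int.even_or_odd m with ⟨l, rfl⟩ | ⟨l, rfl⟩
  · rw [show 2 * (l + l) = 4 * l by ring, zpow_mul, h4, one_zpow]
    have : ((4 * l + 1 : ℤ) : ZMod 4) = 1 := by
      push_cast
      rw [show (4 : ZMod 4) = 0 by rfl]; ring
    rw [this]; simp
  · rw [show 2 * (2 * l + 1) + 1 = 4 * l + 3 by ring, show 2 * (2 * l + 1) = 4 * l + 2 by ring,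
      zpow_add₀ Complex.I_ne_zero, zpow_mul, h4, one_zpow, h42]
    have : ((4 * l + 3 : ℤ) : ZMod 4) = 3 := by
      push_cast
      rw [show (4 : ZMod 4) = 0 by rfl]; ring
    rw [this, show ZMod.χ₄ 3 = -1 by decide]; simp

theorem slash_S_apply' (w : ℤ) (f : ℍ → ℂ) (τ : ℍ) :
    (f ∣[w] ModularGroup.S) τ = f (ModularGroup.S • τ) * (τ : ℂ) ^ (-w) := by
  have hd : UpperHalfPlane.denom ModularGroup.S τ = (τ : ℂ) := by
    rw [ModularGroup.denom_apply]; simp [ModularGroup.S]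
  rw [ModularForm.SL_slash_apply, hd]

theorem slash_T_apply' (w : ℤ) (f : ℍ → ℂ) (τ : ℍ) :
    (f ∣[w] ModularGroup.T) τ = f (ModularGroup.T • τ) := by
  have hd : UpperHalfPlane.denom ModularGroup.T τ = 1 := by
    rw [ModularGroup.denom_apply]; simp [ModularGroup.T]
  rw [ModularForm.SL_slash_apply, hd, one_zpow, mul_one]

/-- The square of the theta constant has weight one and carries the character `(-4 / ·)`. This
determines the square of the automorphy factor and hence the character of `f²`. -/
theorem thetaTranslate_sq_smul {γ : SL(2, ℤ)} (hγ : 8 ∣ γ 0 1) (τ : ℍ) :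
    thetaTranslate 0 (γ • τ) ^ 2
      = chi4 (γ 0 0) * UpperHalfPlane.denom γ τ * thetaTranslate 0 τ ^ 2 := by
  set R : ℤ → ℍ → ℂ := fun t τ => thetaTranslate t τ ^ 2 with hR
  have hRS : ∀ t, Even t → ∀ τ : ℍ, (R t ∣[(1 : ℤ)] ModularGroup.S) τ
      = -Complex.I * (th00 τ 0 + e (1 / 8) ^ t * th01 τ 0) ^ 2 := fun t ht τ => by
    rw [slash_S_apply']
    simp only [hR]
    rw [thetaTranslate_S_even ht, mul_pow, rootS_sq]
    have := τ.ne_zero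
    field_simp
  have key := slash_coset (w := 1) (R := R) (χ := chi4)
    (fun a b => by simp only [chi4]; push_cast; rw [map_mul]; push_cast; rfl) (by simp [chi4])
    (by simp only [chi4]; rw [show ((-1 : ℤ) : ZMod 4) = 3 by rfl,
      show ZMod.χ₄ 3 = -1 by decide]; simp)
    (fun a => by simp only [chi4]; push_cast; rw [show (4 : ZMod 4) = 0 by rfl, add_zero])
    (fun s t hst => by simp only [hR, thetaTranslate_congr hst])
    (fun t => by
      ext τ
      rw [slash_T_apply']
      simp only [hR, thetaTranslate_T])
    (fun t ht => by
      ext τ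
      rw [slash_S_apply']
      simp only [hR, Pi.smul_apply, smul_eq_mul]
      rw [thetaTranslate_S_odd ht, mul_pow, mul_pow, rootS_sq, ← zpow_natCast, ← zpow_mul,
        mul_comm t, Nat.cast_two, chi4_odd ht]
      have := τ.ne_zero
      field_simp
      linear_combination (-chi4 t * thetaTranslate (-t) τ ^ 2) * Complex.I_sq)
    (fun t ⟨k, hk⟩ => by
      ext τ
      have ht : Even t := ⟨2 * k, by rw [hk]; ring⟩
      rw [slash_T_apply', hRS t ht, hRS t ht, coe_T_smul, th00_T τ.im_pos, th01_T τ.im_pos]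
      have h1 : (e (1 / 8) ^ t) ^ 2 = 1 := by rw [hk, e_eighth_zpow_four_mul]
      linear_combination (-Complex.I * (th00 τ 0 ^ 2 - th01 τ 0 ^ 2)) * h1)
    (fun t ⟨k, hk⟩ => by
      ext τ
      have ht : Even t := ⟨2 * k - 1, by linarith⟩
      have ht' : Even (t + 4) := ⟨2 * k + 1, by linarith⟩
      rw [slash_T_apply', Pi.smul_apply, hRS t ht, hRS (t + 4) ht', coe_T_smul, th00_T τ.im_pos,
        th01_T τ.im_pos]
      have h1 : (e (1 / 8) ^ t) ^ 2 = -1 := by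
        rw [show t = 4 * k - 2 by linarith, e_eighth_zpow_four_mul_sub]
      have h4 : e (1 / 8) ^ (t + 4) = -e (1 / 8) ^ t := by
        have : e (1 / 8) ^ (4 : ℤ) = -1 := by exact_mod_cast e_eighth_pow_four
        rw [zpow_add₀ (e_ne_zero _), this]; ring
      have h5 : chi4 (-1) = -1 := by
        simp only [chi4]; rw [show ((-1 : ℤ) : ZMod 4) = 3 by rfl,
          show ZMod.χ₄ 3 = -1 by decide]; simp
      rw [h4, h5, smul_eq_mul]
      linear_combination (-Complex.I * (th00 τ 0 ^ 2 + th01 τ 0 ^ 2)) * h1) γ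
  have hodd : Odd (γ 0 0) := by
    by_contra h
    rw [Int.not_odd_iff_even] at h
    have h2 : Even (γ 0 1) := by obtain ⟨k, hk⟩ := hγ; exact ⟨4 * k, by rw [hk]; ring⟩
    have : Even (1 : ℤ) := by rw [← det_eq γ]; exact (h.mul_right _).sub (h2.mul_right _)
    exact absurd this (by decide)
  have h1 := congrFun (key.1 hodd) τ
  have h2 : γ 0 0 * γ 0 1 ≡ 0 [ZMOD 8] := Int.modEq_zero_iff_dvd.2 (hγ.mul_left _)
  rw [ModularForm.SL_slash_apply, Pi.smul_apply, smul_eq_mul, zpow_neg, zpow_one] at h1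
  simp only [hR] at h1
  rw [thetaTranslate_congr h2, ← div_eq_mul_inv, div_eq_iff (UpperHalfPlane.denom_ne_zero _ _)] at h1
  rw [h1]; ring

end Triple

end

noncomputable section

/-! ### Modular forms of half-integral weight from theta triples -/

/-- `τ ↦ (aτ + b) / d`. -/
def upper (a b d : ℤ) (ha : 0 < a) (hd : 0 < d) (τ : ℍ) : ℍ :=
  ⟨((a : ℂ) * τ + b) / d, by
    have h : ((a : ℂ) * τ + b) / d = (((a : ℝ) / d : ℝ) : ℂ) * τ + (((b : ℝ) / d : ℝ) : ℂ) := by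
      push_cast; ring
    have ha' : (0 : ℝ) < a := by exact_mod_cast ha
    have hd' : (0 : ℝ) < d := by exact_mod_cast hd
    rw [h, Complex.add_im, Complex.im_ofReal_mul, Complex.ofReal_im, add_zero]
    exact mul_pos (div_pos ha' hd') τ.im_pos⟩

theorem coe_upper (a b d : ℤ) (ha : 0 < a) (hd : 0 < d) (τ : ℍ) :
    (upper a b d ha hd τ : ℂ) = ((a : ℂ) * τ + b) / d := rfl

theorem im_upper (a b d : ℤ) (ha : 0 < a) (hd : 0 < d) (τ : ℍ) :
    (upper a b d ha hd τ).im = a / d * τ.im := by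
  rw [← UpperHalfPlane.coe_im, coe_upper]
  have h : ((a : ℂ) * τ + b) / d = (((a : ℝ) / d : ℝ) : ℂ) * τ + (((b : ℝ) / d : ℝ) : ℂ) := by
    push_cast; ring
  rw [h, Complex.add_im, Complex.im_ofReal_mul, Complex.ofReal_im, add_zero, UpperHalfPlane.coe_im]

theorem coe_SL_smul (γ : SL(2, ℤ)) (τ : ℍ) :
    ((γ • τ : ℍ) : ℂ) = ((γ 0 0 : ℂ) * τ + γ 0 1) / ((γ 1 0 : ℂ) * τ + γ 1 1) := by
  rw [UpperHalfPlane.coe_specialLinearGroup_apply]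
  simp

theorem SL_denom_ne_zero (γ : SL(2, ℤ)) (τ : ℍ) : (γ 1 0 : ℂ) * τ + γ 1 1 ≠ 0 := by
  have := UpperHalfPlane.denom_ne_zero (γ : GL (Fin 2) ℝ) τ
  rwa [ModularGroup.denom_apply] at this

/-- This is the Hermite normal form. It serves both for the expansions at the cusps (determinant
`8`) and for the Hecke operator (determinant `p²`). -/
theorem exists_eq_mul_upper {m : ℤ} (hm : 0 < m) (M : Matrix (Fin 2) (Fin 2) ℤ) (hM : M.det = m) :
    ∃ (γ : SL(2, ℤ)) (a b d : ℤ), 0 < a ∧ 0 ≤ b ∧ b < d ∧ a * d = m ∧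
      M = γ.1 * !![a, b; 0, d] := by
  suffices H : ∀ A : FixedDetMatrix (Fin 2) ℤ m, ∃ (γ : SL(2, ℤ)) (a b d : ℤ), 0 < a ∧ 0 ≤ b ∧
      b < d ∧ a * d = m ∧ A.1 = γ.1 * !![a, b; 0, d] from H ⟨M, hM⟩
  intro A
  induction A using FixedDetMatrices.induction_on hm.ne' with
  | h0 A h10 h00 h01 habs =>
    have hdet : A.1 0 0 * A.1 1 1 = m := by
      have := A.2
      rw [Matrix.det_fin_two, h10, mul_zero, sub_zero] at this
      exact this
    have hd : 0 < A.1 1 1 := pos_of_mul_pos_right (by rw [hdet]; exact hm) h00.le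
    refine ⟨1, A.1 0 0, A.1 0 1, A.1 1 1, h00, h01, ?_, hdet, ?_⟩
    · rwa [abs_of_nonneg h01, abs_of_pos hd] at habs
    · rw [Matrix.SpecialLinearGroup.coe_one, one_mul]
      ext i j
      fin_cases i <;> fin_cases j <;> simp [h10]
  | hS B ih =>
    obtain ⟨γ, a, b, d, ha, hb, hbd, had, h⟩ := ih
    refine ⟨ModularGroup.S * γ, a, b, d, ha, hb, hbd, had, ?_⟩
    rw [FixedDetMatrices.smul_coe, h, Matrix.SpecialLinearGroup.coe_mul, mul_assoc]
  | hT B ih =>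
    obtain ⟨γ, a, b, d, ha, hb, hbd, had, h⟩ := ih
    refine ⟨ModularGroup.T * γ, a, b, d, ha, hb, hbd, had, ?_⟩
    rw [FixedDetMatrices.smul_coe, h, Matrix.SpecialLinearGroup.coe_mul, mul_assoc]

theorem denom_smul_upper {γ : SL(2, ℤ)} {a b d : ℤ} (ha : 0 < a) (hd : 0 < d) (τ : ℍ) :
    (γ 1 0 : ℂ) * upper a b d ha hd τ + γ 1 1
      = (((γ 1 0 * a : ℤ) : ℂ) * τ + ((γ 1 0 * b + γ 1 1 * d : ℤ) : ℂ)) / d := by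
  have : (d : ℂ) ≠ 0 := by exact_mod_cast hd.ne'
  rw [coe_upper]
  push_cast
  field_simp
  ring

theorem coe_smul_upper {γ : SL(2, ℤ)} {a b d : ℤ} (ha : 0 < a) (hd : 0 < d) (τ : ℍ) :
    ((γ • upper a b d ha hd τ : ℍ) : ℂ)
      = (((γ 0 0 * a : ℤ) : ℂ) * τ + ((γ 0 0 * b + γ 0 1 * d : ℤ) : ℂ))
        / (((γ 1 0 * a : ℤ) : ℂ) * τ + ((γ 1 0 * b + γ 1 1 * d : ℤ) : ℂ)) := by
  have h0 : (d : ℂ) ≠ 0 := by exact_mod_cast hd.ne'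
  have h1 := SL_denom_ne_zero γ (upper a b d ha hd τ)
  rw [coe_SL_smul]
  rw [denom_smul_upper, div_ne_zero_iff] at h1
  rw [denom_smul_upper, coe_upper]
  have h2 := h1.1
  field_simp
  push_cast
  ring

theorem mul_upper_apply (γ : SL(2, ℤ)) (a b d : ℤ) :
    (γ.1 * !![a, b; 0, d]) = !![γ 0 0 * a, γ 0 0 * b + γ 0 1 * d;
      γ 1 0 * a, γ 1 0 * b + γ 1 1 * d] := by
  ext i j
  fin_cases i <;> fin_cases j <;> simp [Matrix.mul_apply, Fin.sum_univ_two]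

/-- `τ ↦ 8τ`. -/
def scale8 (τ : ℍ) : ℍ := ⟨8 * τ, by simpa using τ.im_pos⟩

theorem coe_scale8 (τ : ℍ) : (scale8 τ : ℂ) = 8 * τ := rfl

theorem im_scale8 (τ : ℍ) : (scale8 τ).im = 8 * τ.im := by
  rw [← UpperHalfPlane.coe_im, coe_scale8]
  simp

/-- `τ ↦ g(8τ) + W(8τ)`. -/
def liftForm (g W : ℍ → ℂ) (τ : ℍ) : ℂ := g (scale8 τ) + W (scale8 τ)

theorem translate_zero (ξ : ℂ) (g u W : ℍ → ℂ) (τ : ℍ) : translate ξ g u W 0 τ = g τ + W τ := by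
  simp [translate]

theorem hasSum_theta (τ : ℍ) : HasSum (fun m : ℤ => e ((m : ℂ) ^ 2 * τ)) (theta τ) := by
  have h := hasSum_th00 (τ := 2 * τ) (by simpa using τ.im_pos) 0
  have h2 : HasSum (fun m : ℤ => e ((m : ℂ) ^ 2 * τ)) (th00 (2 * τ) 0) :=
    h.congr_fun fun n => by congr 1; ring
  rw [theta, h2.tsum_eq]
  exact h2

theorem theta_ne_zero (τ : ℍ) : theta τ ≠ 0 := by
  have h := hasSum_th00 (τ := 2 * τ) (by simpa using τ.im_pos) 0
  have h2 : HasSum (fun m : ℤ => e ((m : ℂ) ^ 2 * τ)) (th00 (2 * τ) 0) :=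
    h.congr_fun fun n => by congr 1; ring
  rw [theta, h2.tsum_eq]
  exact th00_ne_zero ⟨2 * τ, by simpa using τ.im_pos⟩

theorem hasSum_int_even_add_odd {f : ℤ → ℂ} {a b : ℂ} (h0 : HasSum (fun n => f (2 * n)) a)
    (h1 : HasSum (fun n => f (2 * n + 1)) b) : HasSum f (a + b) := by
  have i0 : Function.Injective fun n : ℤ => 2 * n := fun x y h => by simpa using h
  have i1 : Function.Injective fun n : ℤ => 2 * n + 1 := fun x y h => by simpa using h
  refine HasSum.add_isCompl (s := Set.range fun n : ℤ => 2 * n)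
    (t := Set.range fun n : ℤ => 2 * n + 1) ?_ (i0.hasSum_range_iff.2 h0) (i1.hasSum_range_iff.2 h1)
  rw [range_two_mul, range_two_mul_add_one]
  exact Int.isCompl_even_odd

/-- Even and odd summation indices give `(2n)² = 8 · n²/2` and `(2n+1)² = 8 · (n + 1/2)²/2`. -/
theorem theta_eq (τ : ℍ) : theta τ = thetaTranslate 0 (scale8 τ) := by
  rw [thetaTranslate, translate_zero]
  have h1 : HasSum (fun m : ℤ => e (((2 * m : ℤ) : ℂ) ^ 2 * τ)) (th00 (scale8 τ) 0) :=
    (hasSum_th00 (scale8 τ).im_pos 0).congr_fun fun n => by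
      rw [coe_scale8]; congr 1; push_cast; ring
  have h2 : HasSum (fun m : ℤ => e (((2 * m + 1 : ℤ) : ℂ) ^ 2 * τ)) (th10 (scale8 τ) 0) :=
    (hasSum_th10 (scale8 τ).im_pos 0).congr_fun fun n => by
      rw [coe_scale8]; congr 1; push_cast; ring
  exact (hasSum_theta τ).unique (hasSum_int_even_add_odd (f := fun m : ℤ => e ((m : ℂ) ^ 2 * τ))
    h1 h2)

/-- Conjugation by `diag(8, 1)` moves the divisibility by `8` from the lower left to the upper right
entry, where `slash_coset` needs it. -/
theorem exists_conj {A : SL(2, ℤ)} (hA : A ∈ CongruenceSubgroup.Gamma0 8) :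
    ∃ γ : SL(2, ℤ), γ 0 0 = A 0 0 ∧ 8 ∣ γ 0 1 ∧ 
      (∀ τ : ℍ, scale8 (A • τ) = γ • scale8 τ) ∧
      (∀ τ : ℍ, UpperHalfPlane.denom γ (scale8 τ) = UpperHalfPlane.denom A τ) := by
  rw [CongruenceSubgroup.Gamma0_mem] at hA
  obtain ⟨c, hc⟩ := (ZMod.intCast_zmod_eq_zero_iff_dvd (A 1 0) 8).1 hA
  push_cast at hc
  have hdet := det_eq A
  let γ : SL(2, ℤ) := ⟨!![A 0 0, 8 * A 0 1; c, A 1 1], by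
    rw [Matrix.det_fin_two_of]; rw [hc] at hdet; linarith⟩
  have hden : ∀ τ : ℍ, ((γ 1 0 : ℂ) * (scale8 τ : ℂ) + γ 1 1) = (A 1 0 : ℂ) * τ + A 1 1 := fun τ => by
    rw [hc, coe_scale8]
    change ((c : ℤ) : ℂ) * _ + ((A 1 1 : ℤ) : ℂ) = _
    push_cast; ring
  refine ⟨γ, rfl, ⟨A 0 1, rfl⟩, fun τ => ?_, fun τ => ?_⟩
  · ext
    rw [coe_SL_smul, hden, coe_scale8, coe_scale8, coe_SL_smul]
    change _ = (((A 0 0 : ℤ) : ℂ) * _ + ((8 * A 0 1 : ℤ) : ℂ)) / _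
    push_cast
    ring
  · rw [ModularGroup.denom_apply, ModularGroup.denom_apply, hden]

theorem theta_sq_smul {A : SL(2, ℤ)} (hA : A ∈ CongruenceSubgroup.Gamma0 8) (τ : ℍ) :
    thetaFactor A τ ^ 2 = chi4 (A 1 1) * UpperHalfPlane.denom A τ := by
  obtain ⟨γ, h00, h01, hsc, hden⟩ := exists_conj hA
  have h := thetaTranslate_sq_smul h01 (scale8 τ)
  rw [← hsc, ← theta_eq, ← theta_eq, hden, h00] at h
  -- Since `4` divides the lower left entry, the diagonal entries are inverse to each other modulo
  -- `4`.
  have hchi : chi4 (A 0 0) = chi4 (A 1 1) := by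
    have h1 : ((A 0 0 * A 1 1 : ℤ) : ZMod 4) = 1 := by
      have hdet := det_eq A
      rw [CongruenceSubgroup.Gamma0_mem] at hA
      obtain ⟨c, hc⟩ := (ZMod.intCast_zmod_eq_zero_iff_dvd (A 1 0) 8).1 hA
      have : A 0 0 * A 1 1 = 1 + 4 * (2 * c * A 0 1) := by
        push_cast at hc
        rw [hc] at hdet; linarith
      rw [this]
      push_cast
      rw [show (4 : ZMod 4) = 0 by rfl]; ring
    have : ∀ x y : ZMod 4, x * y = 1 → ZMod.χ₄ x = ZMod.χ₄ y := by decide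
    push_cast at h1
    rw [chi4, chi4, this _ _ h1]
  have := theta_ne_zero τ
  rw [thetaFactor, div_pow, h, hchi, mul_div_assoc, div_self (pow_ne_zero _ this), mul_one]

theorem IsThetaTriple.liftForm_smul {K : ℕ} {ε : ℂ} {g u W : ℍ → ℂ}
    (h : IsThetaTriple K ε g u W) (hε : ε ^ 2 = 1) (hK : Odd K) {A : SL(2, ℤ)}
    (hA : A ∈ CongruenceSubgroup.Gamma0 8) (τ : ℍ) :
    liftForm g W (A • τ) = thetaFactor A τ ^ K * liftForm g W τ := by
  obtain ⟨γ, h00, h01, hsc, hden⟩ := exists_conj hA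
  have key := h.quotient_smul hε hK h01 (scale8 τ)
  rw [← hsc, ← theta_eq, ← theta_eq, translate_zero, translate_zero] at key
  have h1 := theta_ne_zero τ
  have h2 := theta_ne_zero (A • τ)
  rw [liftForm, liftForm, thetaFactor, div_pow]
  field_simp at key ⊢
  linear_combination key

/-! ### Behaviour at the cusps -/

section Bound

variable {K : ℕ} {ε : ℂ} {g u W : ℍ → ℂ}

/-- `|g|² + |u|² + |W|²`. -/
def sqNorm (g u W : ℍ → ℂ) (τ : ℍ) : ℝ := ‖g τ‖ ^ 2 + ‖u τ‖ ^ 2 + ‖W τ‖ ^ 2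

theorem sqNorm_nonneg (g u W : ℍ → ℂ) (τ : ℍ) : 0 ≤ sqNorm g u W τ := by
  unfold sqNorm; positivity

/-- `S` and `T` permute the three absolute values up to the common factor `|τ|^(K/2)` for `S`. The
sum of squares is squared once more so that the exponent of the imaginary part is an integer for odd
`K`. -/
theorem IsThetaTriple.sqNorm_invariant (h : IsThetaTriple K ε g u W) (hε : ε ^ 2 = 1)
    (γ : SL(2, ℤ)) (τ : ℍ) :
    sqNorm g u W (γ • τ) ^ 2 * (γ • τ).im ^ K = sqNorm g u W τ ^ 2 * τ.im ^ K := by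
  have hε1 : ‖ε‖ = 1 := by
    have : ‖ε‖ ^ 2 = 1 := by rw [← norm_pow, hε, norm_one]
    exact (pow_eq_one_iff_of_nonneg (norm_nonneg _) two_ne_zero).1 this
  have hζ1 : ‖e (1 / 8)‖ = 1 := norm_e_of_im_eq_zero (by
    rw [show (1 / 8 : ℂ) = ((1 / 8 : ℝ) : ℂ) by push_cast; rfl, Complex.ofReal_im])
  induction γ using SL2Z_induction generalizing τ with
  | one => simp
  | hS γ ih =>
    rw [mul_smul, ih]
    have h1 : (ModularGroup.S • τ : ℍ).im = τ.im / ‖(τ : ℂ)‖ ^ 2 := by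
      have hd : UpperHalfPlane.denom ModularGroup.S τ = (τ : ℂ) := by
        rw [ModularGroup.denom_apply]; simp [ModularGroup.S]
      rw [ModularGroup.im_smul_eq_div_normSq, hd, Complex.normSq_eq_norm_sq]
    have h2 : sqNorm g u W (ModularGroup.S • τ) = ‖(τ : ℂ)‖ ^ K * sqNorm g u W τ := by
      rw [sqNorm, h.g_S, h.u_S, h.W_S, sqNorm, ← norm_rootS_sq (τ : ℂ)]
      simp only [norm_mul, norm_pow, hε1]
      ring
    have h3 : ‖(τ : ℂ)‖ ≠ 0 := norm_ne_zero_iff.2 τ.ne_zero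
    rw [h1, h2, div_pow]
    field_simp
    ring
  | hT γ ih =>
    rw [mul_smul, ih]
    have h1 : (ModularGroup.T • τ : ℍ).im = τ.im := by
      rw [← UpperHalfPlane.coe_im, coe_T_smul]; simp
    rw [h1, sqNorm, h.g_T, h.u_T, h.W_T, sqNorm]
    simp only [norm_mul, norm_pow, hε1, hζ1]
    ring

/-- Writing `diag(8, 1) A` as `γ` times an upper triangular matrix moves the estimate at the cusp of
`A` to the point `(aτ + b)/d`, by invariance of `sqNorm` under `γ`. The factor `denom^K` that
appears is cancelled by the slash action. -/
theorem IsThetaTriple.norm_slash_le (h : IsThetaTriple K ε g u W) (hε : ε ^ 2 = 1)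
    (A : SL(2, ℤ)) : ∃ (a b d : ℤ) (ha : 0 < a) (hd : 0 < d), ∀ τ : ℍ,
      ‖(((liftForm g W) ^ 2) ∣[(K : ℤ)] A) τ‖ ≤ 2 * sqNorm g u W (upper a b d ha hd τ) := by
  have hdet := det_eq A
  obtain ⟨γ, a, b, d, ha, hb, hbd, had, hM⟩ := exists_eq_mul_upper (m := 8) (by norm_num)
    !![8 * A 0 0, 8 * A 0 1; A 1 0, A 1 1] (by rw [Matrix.det_fin_two_of]; linarith)
  have hd : 0 < d := hb.trans_lt hbd
  refine ⟨a, b, d, ha, hd, fun τ => ?_⟩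
  set w := upper a b d ha hd τ
  have hw : scale8 (A • τ) = γ • w := by
    rw [mul_upper_apply] at hM
    have e00 := congrFun (congrFun hM 0) 0
    have e01 := congrFun (congrFun hM 0) 1
    have e10 := congrFun (congrFun hM 1) 0
    have e11 := congrFun (congrFun hM 1) 1
    simp only [Matrix.of_apply, Matrix.cons_val', Matrix.cons_val_zero, Matrix.cons_val_one,
      Matrix.cons_val_fin_one] at e00 e01 e10 e11
    ext
    rw [coe_smul_upper, ← e00, ← e01, ← e10, ← e11, coe_scale8, coe_SL_smul]
    push_cast; ring
  have hinv := h.sqNorm_invariant hε γ w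
  rw [← hw, im_scale8, im_upper, ModularGroup.im_smul_eq_div_normSq, Complex.normSq_eq_norm_sq]
    at hinv
  set D := ‖UpperHalfPlane.denom (A : GL (Fin 2) ℝ) τ‖
  have hD : 0 < D := norm_pos_iff.2 (UpperHalfPlane.denom_ne_zero _ _)
  have him := τ.im_pos
  have hN := sqNorm_nonneg g u W (scale8 (A • τ))
  have hNw := sqNorm_nonneg g u W w
  have hf : ‖liftForm g W (A • τ)‖ ^ 2 ≤ 2 * sqNorm g u W (scale8 (A • τ)) := by
    have h1 := norm_add_le (g (scale8 (A • τ))) (W (scale8 (A • τ)))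
    have h2 := norm_nonneg (g (scale8 (A • τ)) + W (scale8 (A • τ)))
    rw [liftForm, sqNorm]
    nlinarith [sq_nonneg (‖g (scale8 (A • τ))‖ - ‖W (scale8 (A • τ))‖),
      sq_nonneg ‖u (scale8 (A • τ))‖]
  -- From `ad = 8` and `d ≥ 1` one gets `a/d ≤ 8`.
  have hle : (a : ℝ) / d * τ.im ≤ 8 * τ.im := by
    have hd1 : (1 : ℝ) ≤ d := by exact_mod_cast hd
    have ha8 : (a : ℝ) ≤ 8 := by
      have : a ≤ 8 := by nlinarith
      exact_mod_cast this
    have : (a : ℝ) / d ≤ 8 := by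
      rw [div_le_iff₀ (by linarith)]; linarith
    exact mul_le_mul_of_nonneg_right this him.le
  have hN2 : sqNorm g u W (scale8 (A • τ)) ≤ sqNorm g u W w * D ^ K := by
    refine (pow_le_pow_iff_left₀ hN (by positivity) two_ne_zero).1 ?_
    have h1 : sqNorm g u W (scale8 (A • τ)) ^ 2 * (8 * τ.im) ^ K
        = sqNorm g u W w ^ 2 * (a / d * τ.im) ^ K * (D ^ K) ^ 2 := by
      rw [← hinv]
      rw [show 8 * (τ.im / D ^ 2) = (8 * τ.im) / D ^ 2 by ring, div_pow]
      field_simp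
      ring
    have h2 : (a / d * τ.im) ^ K ≤ (8 * τ.im) ^ K := by
      have ha' : (0 : ℝ) < a := by exact_mod_cast ha
      have hd' : (0 : ℝ) < d := by exact_mod_cast hd
      gcongr
    have h3 : (0 : ℝ) < (8 * τ.im) ^ K := by positivity
    refine le_of_mul_le_mul_right ?_ h3
    rw [h1, mul_pow]
    calc _ = (sqNorm g u W w ^ 2 * (D ^ K) ^ 2) * (a / d * τ.im) ^ K := by ring
      _ ≤ (sqNorm g u W w ^ 2 * (D ^ K) ^ 2) * (8 * τ.im) ^ K := by gcongr
      _ = _ := by ring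
  rw [ModularForm.SL_slash_apply, norm_mul, norm_zpow, Pi.pow_apply, norm_pow, zpow_neg,
    zpow_natCast, ← div_eq_mul_inv, div_le_iff₀ (by positivity)]
  calc _ ≤ _ := hf
    _ ≤ 2 * (sqNorm g u W w * D ^ K) := by linarith
    _ = _ := by ring

theorem tendsto_upper {a b d : ℤ} (ha : 0 < a) (hd : 0 < d) :
    Tendsto (upper a b d ha hd) atImInfty atImInfty := by
  refine tendsto_comap_iff.2 ?_
  have h1 : Tendsto UpperHalfPlane.im atImInfty atTop := tendsto_comap
  have ha' : (0 : ℝ) < a := by exact_mod_cast ha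
  have hd' : (0 : ℝ) < d := by exact_mod_cast hd
  refine (h1.const_mul_atTop (div_pos ha' hd')).congr fun τ => ?_
  rw [Function.comp_apply, im_upper]

theorem IsThetaTriple.slash_isZeroAtImInfty (h : IsThetaTriple K ε g u W) (hε : ε ^ 2 = 1)
    (hg : IsZeroAtImInfty g) (hu : IsZeroAtImInfty u) (hW : IsZeroAtImInfty W) (A : SL(2, ℤ)) :
    IsZeroAtImInfty (((liftForm g W) ^ 2) ∣[(K : ℤ)] A) := by
  obtain ⟨a, b, d, ha, hd, hle⟩ := h.norm_slash_le hε A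
  have h1 : Tendsto (fun τ => 2 * sqNorm g u W τ) atImInfty (𝓝 0) := by
    have := (((hg.norm.pow 2).add (hu.norm.pow 2)).add (hW.norm.pow 2)).const_mul 2
    simpa [sqNorm] using this
  exact squeeze_zero_norm hle (h1.comp (tendsto_upper ha hd))

theorem IsThetaTriple.slash_isBoundedAtImInfty (h : IsThetaTriple K ε g u W) (hε : ε ^ 2 = 1)
    (hg : IsBoundedAtImInfty g) (hu : IsBoundedAtImInfty u) (hW : IsBoundedAtImInfty W)
    (A : SL(2, ℤ)) : IsBoundedAtImInfty (((liftForm g W) ^ 2) ∣[(K : ℤ)] A) := by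
  obtain ⟨a, b, d, ha, hd, hle⟩ := h.norm_slash_le hε A
  have h1 : (fun τ => 2 * sqNorm g u W τ) =O[atImInfty] (1 : ℍ → ℝ) := by
    have h2 : ∀ {f : ℍ → ℂ}, IsBoundedAtImInfty f → (fun τ => ‖f τ‖ ^ 2) =O[atImInfty] (1 : ℍ → ℝ) :=
      fun hf => (hf.norm_left.pow 2).congr_right fun τ => one_pow 2
    exact (((h2 hg).add (h2 hu)).add (h2 hW)).const_mul_left 2
  have h2 := h1.comp_tendsto (tendsto_upper (b := b) ha hd)
  exact (Asymptotics.IsBigO.of_bound 1 (Eventually.of_forall fun τ => by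
    rw [one_mul]
    exact (hle τ).trans (le_abs_self _))).trans h2

theorem mdifferentiable_liftForm (hg : MDiff g) (hW : MDiff W) : MDiff (liftForm g W) := by
  rw [UpperHalfPlane.mdifferentiable_iff] at hg hW ⊢
  have hmap : Set.MapsTo (fun z : ℂ => 8 * z) {z | 0 < z.im} {z | 0 < z.im} := fun z hz => by
    have : 0 < z.im := hz
    simpa using this
  have h8 : DifferentiableOn ℂ (fun z : ℂ => 8 * z) {z | 0 < z.im} := by fun_prop
  refine ((hg.comp h8 hmap).add (hW.comp h8 hmap)).congr fun z hz => ?_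
  have hz' : 0 < z.im := hz
  have h1 : scale8 (ofComplex z) = ofComplex (8 * z) := by
    ext
    rw [coe_scale8, ofComplex_apply_of_im_pos hz', ofComplex_apply_of_im_pos (by simpa using hz')]
  simp only [Function.comp_apply, liftForm, h1, Pi.add_apply]

theorem IsThetaTriple.isHalfIntegralForm {k : ℕ} (h : IsThetaTriple (2 * k + 1) ε g u W)
    (hε : ε ^ 2 = 1) (dg : MDiff g) (dW : MDiff W)
    (hg : IsBoundedAtImInfty g) (hu : IsBoundedAtImInfty u) (hW : IsBoundedAtImInfty W) :
    IsHalfIntegralForm k 8 (liftForm g W) := by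
  have hK : Odd (2 * k + 1) := ⟨k, rfl⟩
  have hd := mdifferentiable_liftForm dg dW
  have hne : ∀ A τ, thetaFactor A τ ≠ 0 := fun A τ =>
    div_ne_zero (theta_ne_zero _) (theta_ne_zero _)
  refine ⟨hd, fun A hA τ => ?_, ?_, fun A hA τ => ?_, fun A => ?_⟩
  · rw [h.liftForm_smul hε hK hA, ← zpow_natCast, ← mul_assoc, ← zpow_add₀ (hne A τ)]
    push_cast
    rw [show -2 * (k : ℤ) - 1 + (2 * k + 1) = 0 by ring, zpow_zero, one_mul]
  · simpa [pow_two] using! hd.mul hd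
  · rw [Pi.pow_apply, Pi.pow_apply, h.liftForm_smul hε hK hA, mul_pow, ← pow_mul, mul_comm _ 2,
      pow_mul, theta_sq_smul hA, mul_pow, ← zpow_natCast (UpperHalfPlane.denom _ _)]
    congr 2
    have h1 : chi4 (A 1 1) ^ 2 = 1 ∨ chi4 (A 1 1) = 0 := by
      have : ∀ x : ZMod 4, (ZMod.χ₄ x) ^ 2 = 1 ∨ ZMod.χ₄ x = 0 := by decide
      rcases this (A 1 1 : ZMod 4) with h | h
      · left; rw [chi4]; exact_mod_cast h
      · right; rw [chi4, h]; simp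
    change chi4 (A 1 1) ^ (2 * k + 1) = chi4 (A 1 1)
    rcases h1 with h1 | h1
    · rw [pow_succ, pow_mul, h1, one_pow, one_mul]
    · rw [h1]; simp
  · exact_mod_cast h.slash_isBoundedAtImInfty hε hg hu hW A

end Bound

end

noncomputable section

/-! ### Theta triples from modular forms of half-integral weight -/

theorem translate_T_of {ξ : ℂ} (hξ : ξ ≠ 0) {g u W : ℍ → ℂ}
    (hg : ∀ τ : ℍ, g (ModularGroup.T • τ) = u τ) (hu : ∀ τ : ℍ, u (ModularGroup.T • τ) = g τ)
    (hW : ∀ τ : ℍ, W (ModularGroup.T • τ) = ξ * W τ) (t : ℤ) (τ : ℍ) :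
    translate ξ g u W t (ModularGroup.T • τ) = translate ξ g u W (t + 1) τ := by
  simp only [translate, hg, hu, hW, zpow_add_one₀ hξ, Int.even_add_one]
  split_ifs <;> ring

theorem translate_T_zpow_of {ξ : ℂ} (hξ : ξ ≠ 0) {g u W : ℍ → ℂ}
    (hg : ∀ τ : ℍ, g (ModularGroup.T • τ) = u τ) (hu : ∀ τ : ℍ, u (ModularGroup.T • τ) = g τ)
    (hW : ∀ τ : ℍ, W (ModularGroup.T • τ) = ξ * W τ) (n t : ℤ) (τ : ℍ) :
    translate ξ g u W t (ModularGroup.T ^ n • τ) = translate ξ g u W (t + n) τ := by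
  have h1 := translate_T_of hξ hg hu hW
  induction n using Int.induction_on generalizing τ with
  | zero => simp
  | succ n ih => rw [zpow_add_one, mul_smul, ih, h1, add_assoc]
  | pred n ih =>
    have := h1 (t + (-n - 1)) (ModularGroup.T⁻¹ • τ)
    rw [smul_inv_smul] at this
    rw [zpow_sub_one, mul_smul, ih, this]
    congr 1; ring

theorem thetaTranslate_T_zpow (n t : ℤ) (τ : ℍ) :
    thetaTranslate t (ModularGroup.T ^ n • τ) = thetaTranslate (t + n) τ :=
  translate_T_zpow_of (e_ne_zero _) (fun τ => by simp only [coe_T_smul, th00_T τ.im_pos])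
    (fun τ => by simp only [coe_T_smul, th01_T τ.im_pos])
    (fun τ => by simp only [coe_T_smul, th10_T τ.im_pos]) n t τ

theorem exists_scale8_eq (τ : ℍ) : ∃ σ, scale8 σ = τ := by
  refine ⟨⟨τ / 8, ?_⟩, ?_⟩
  · rw [show (τ : ℂ) / 8 = ((1 / 8 : ℝ) : ℂ) * τ by push_cast; ring, Complex.im_ofReal_mul]
    have : 0 < (τ : ℂ).im := τ.im_pos
    positivity
  · ext
    rw [coe_scale8]
    change 8 * ((τ : ℂ) / 8) = τ
    ring

theorem thetaTranslate_ne_zero (t : ℤ) (τ : ℍ) : thetaTranslate t τ ≠ 0 := by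
  obtain ⟨σ, hσ⟩ := exists_scale8_eq (ModularGroup.T ^ t • τ)
  have h := theta_ne_zero σ
  rwa [theta_eq, hσ, thetaTranslate_T_zpow, zero_add] at h

/-- Conjugated by `diag(8, 1)`, the matrix `(t, s; 8, t)` becomes `Tᵗ S Tᵗ`, because `8s = t² - 1`.
So its law for `f`, read at `T⁻ᵗσ`, is a law under `S` for the translate by `t`; the automorphy
factor is known from the theta constants themselves. -/
theorem translate_S_of_isHalfIntegralForm {k : ℕ} {ξ : ℂ} (hξ : ξ ≠ 0) {g u W : ℍ → ℂ}
    (hg : ∀ τ : ℍ, g (ModularGroup.T • τ) = u τ) (hu : ∀ τ : ℍ, u (ModularGroup.T • τ) = g τ)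
    (hW : ∀ τ : ℍ, W (ModularGroup.T • τ) = ξ * W τ) (hf : IsHalfIntegralForm k 8 (liftForm g W))
    {t s : ℤ} (hts : t ^ 2 - 8 * s = 1) (σ : ℍ) :
    translate ξ g u W t (ModularGroup.S • σ)
      = (rootS σ * e (1 / 8) ^ t) ^ (2 * k + 1) * translate ξ g u W (-t) σ := by
  obtain ⟨τ, hτ⟩ := exists_scale8_eq (ModularGroup.T ^ (-t) • σ)
  let A : SL(2, ℤ) := ⟨!![t, s; 8, t], by rw [Matrix.det_fin_two_of]; linarith⟩
  have hA : A ∈ CongruenceSubgroup.Gamma0 8 := by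
    rw [CongruenceSubgroup.Gamma0_mem]
    change ((8 : ℤ) : ZMod 8) = 0
    rfl
  have hτc : 8 * (τ : ℂ) = σ - t := by
    have := congrArg (fun x : ℍ => (x : ℂ)) hτ
    simp only [coe_scale8, ModularGroup.coe_T_zpow_smul_eq] at this
    rw [this]; push_cast; ring
  have hAτ : scale8 (A • τ) = ModularGroup.T ^ t • (ModularGroup.S • σ) := by
    ext
    rw [coe_scale8, coe_SL_smul, ModularGroup.coe_T_zpow_smul_eq, coe_S_smul]
    change 8 * ((((t : ℤ) : ℂ) * τ + ((s : ℤ) : ℂ)) / (((8 : ℤ) : ℂ) * τ + ((t : ℤ) : ℂ))) = _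
    have h1 : ((8 : ℤ) : ℂ) * τ + ((t : ℤ) : ℂ) = σ := by push_cast; rw [hτc]; ring
    have h2 : (t : ℂ) ^ 2 - 8 * s = 1 := by exact_mod_cast hts
    have h3 := σ.ne_zero
    rw [h1]
    field_simp
    linear_combination t * hτc - h2
  have hodd : Odd t := by
    have : Odd (t ^ 2) := by rw [show t ^ 2 = 2 * (4 * s) + 1 by linarith]; exact ⟨_, rfl⟩
    exact (Int.odd_pow' two_ne_zero).1 this
  have h := hf.modular A hA τ
  have hne : thetaFactor A τ ≠ 0 := div_ne_zero (theta_ne_zero _) (theta_ne_zero _)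
  have hF : ∀ x, liftForm g W x = translate ξ g u W 0 (scale8 x) := fun x => by
    rw [translate_zero, liftForm]
  have htr := translate_T_zpow_of hξ hg hu hW
  rw [hF, hF, hAτ, hτ, htr, htr, zero_add, zero_add] at h
  have h4 : thetaFactor A τ = rootS σ * e (1 / 8) ^ t := by
    rw [thetaFactor, theta_eq, theta_eq, hAτ, hτ, thetaTranslate_T_zpow, thetaTranslate_T_zpow,
      zero_add, zero_add, thetaTranslate_S_odd hodd, mul_div_assoc,
      div_self (thetaTranslate_ne_zero _ _), mul_one]
  rw [← h, ← h4, ← zpow_natCast, ← mul_assoc, ← zpow_add₀ hne]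
  push_cast
  rw [show (2 * (k : ℤ) + 1 + (-2 * k - 1)) = 0 by ring, zpow_zero, one_mul]

/-- For odd `K` the number `ξ` is a primitive eighth root of unity: `T⁴` negates `W`, while it fixes
`g` and `u`. This separates the two parts of `g + W`. -/
theorem twist_pow_four {ε : ℂ} (hε : ε ^ 2 = 1) (k : ℕ) :
    (ε * e (1 / 8) ^ (2 * k + 1)) ^ 4 = -1 := by
  rw [mul_pow, show 4 = 2 * 2 by rfl, pow_mul ε, hε, one_pow, one_mul, ← pow_mul,
    mul_comm (2 * k + 1), pow_mul, show 2 * 2 = 4 by rfl, e_eighth_pow_four,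
    Odd.neg_one_pow ⟨k, rfl⟩]

/-- The cases `t = 1` and `t = 5` of `translate_S_of_isHalfIntegralForm` concern `u + ξW` and `u -
ξW`, because `ξ⁵ = -ξ`; half their sum and difference give `u` and `W`. The law of `g` follows by
transporting `g` to `u` and `W` with `T`. -/
theorem isThetaTriple_of_isHalfIntegralForm {k : ℕ} {ε : ℂ} (hε : ε ^ 2 = 1) {g u W : ℍ → ℂ}
    (hg : ∀ τ : ℍ, g (ModularGroup.T • τ) = u τ) (hu : ∀ τ : ℍ, u (ModularGroup.T • τ) = g τ)
    (hW : ∀ τ : ℍ, W (ModularGroup.T • τ) = ε * e (1 / 8) ^ (2 * k + 1) * W τ)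
    (hf : IsHalfIntegralForm k 8 (liftForm g W)) : IsThetaTriple (2 * k + 1) ε g u W := by
  set ξ := ε * e (1 / 8) ^ (2 * k + 1) with hξdef
  have hξ : ξ ≠ 0 := twist_ne_zero hε
  have hξ4 : ξ ^ 4 = -1 := twist_pow_four hε k
  have h1 : ∀ σ : ℍ, u (ModularGroup.S • σ) + ξ * W (ModularGroup.S • σ)
      = rootS σ ^ (2 * k + 1) * e (1 / 8) ^ (2 * k + 1) * (u σ + ξ⁻¹ * W σ) := fun σ => by
    have := translate_S_of_isHalfIntegralForm hξ hg hu hW hf (t := 1) (s := 0) (by norm_num) σ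
    have h1 : ¬ Even (1 : ℤ) := by decide
    simpa only [translate, h1, even_neg, if_false, zpow_one, zpow_neg_one, mul_pow] using this
  have h5 : ∀ σ : ℍ, u (ModularGroup.S • σ) - ξ * W (ModularGroup.S • σ)
      = -(rootS σ ^ (2 * k + 1) * e (1 / 8) ^ (2 * k + 1)) * (u σ - ξ⁻¹ * W σ) := fun σ => by
    have := translate_S_of_isHalfIntegralForm hξ hg hu hW hf (t := 5) (s := 3) (by norm_num) σ
    have h1 : ¬ Even (5 : ℤ) := by decide
    have h2 : ξ ^ (5 : ℤ) = -ξ := by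
      rw [show (5 : ℤ) = 4 + 1 by norm_num, zpow_add₀ hξ, zpow_one]
      have : ξ ^ (4 : ℤ) = -1 := by exact_mod_cast hξ4
      rw [this]; ring
    have h3 : e (1 / 8) ^ (5 : ℤ) = -e (1 / 8) := by
      rw [show (5 : ℤ) = 4 + 1 by norm_num, zpow_add₀ (e_ne_zero _), zpow_one]
      have : e (1 / 8) ^ (4 : ℤ) = -1 := by exact_mod_cast e_eighth_pow_four
      rw [this]; ring
    simp only [translate, h1, even_neg, if_false, zpow_neg, h2, h3, mul_pow,
      Odd.neg_pow (⟨k, rfl⟩ : Odd (2 * k + 1)), inv_neg] at this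
    linear_combination this
  have hζ : e (1 / 8) ^ (2 * k + 1) = ε * ξ := by
    rw [hξdef, ← mul_assoc, ← pow_two, hε, one_mul]
  have hu_S : ∀ σ : ℍ, u (ModularGroup.S • σ) = ε * rootS σ ^ (2 * k + 1) * W σ := fun σ => by
    have e1 := h1 σ
    have e2 := h5 σ
    rw [hζ] at e1 e2
    have hc : ξ * ξ⁻¹ = 1 := mul_inv_cancel₀ hξ
    linear_combination (e1 + e2) / 2 + rootS σ ^ (2 * k + 1) * ε * W σ * hc
  have hW_S : ∀ σ : ℍ, W (ModularGroup.S • σ) = ε * rootS σ ^ (2 * k + 1) * u σ := fun σ => by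
    have e1 := h1 σ
    have e2 := h5 σ
    rw [hζ] at e1 e2
    refine mul_left_cancel₀ hξ ?_
    linear_combination (e1 - e2) / 2
  refine ⟨hg, hu, hW, fun τ => ?_, hu_S, hW_S⟩
  -- With `ρ = T⁻¹τ` and `σ = T⁻¹Sρ` the relation `STS = T⁻¹ST⁻¹` reads `Sσ = TSτ`. Thus `g(Sτ) =
  -- u(Sσ)` leads to `W(σ)`, then to `u(ρ)`, then to `g(τ)`; `rootS_mul_rootS` multiplies the two
  -- automorphy factors with the correct sign.
  set ρ : ℍ := ModularGroup.T⁻¹ • τ with hρ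
  have hTρ : ModularGroup.T • ρ = τ := smul_inv_smul _ _
  set σ : ℍ := ModularGroup.T⁻¹ • (ModularGroup.S • ρ) with hσ
  have hTσ : ModularGroup.T • σ = ModularGroup.S • ρ := smul_inv_smul _ _
  have cρ : (ρ : ℂ) = τ - 1 := by
    have := coe_T_smul ρ
    rw [hTρ] at this
    rw [this]; ring
  have hne := τ.ne_zero
  have hne1 : (τ : ℂ) - 1 ≠ 0 := by rw [← cρ]; exact ρ.ne_zero
  have cσ : (σ : ℂ) = -τ / (τ - 1) := by
    have := coe_T_smul σ
    rw [hTσ, coe_S_smul, cρ] at this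
    rw [← sub_eq_iff_eq_add] at this
    rw [← this]
    field_simp
    ring
  have hSσ : ModularGroup.S • σ = ModularGroup.T • (ModularGroup.S • τ) := by
    ext
    rw [coe_S_smul, coe_T_smul, coe_S_smul, cσ]
    field_simp
    ring
  have e1 : g (ModularGroup.S • τ) = ε * rootS σ ^ (2 * k + 1) * W σ := by
    rw [← hu, ← hSσ, hu_S]
  have e2 : ξ * W σ = ε * rootS ρ ^ (2 * k + 1) * g τ := by
    rw [← hW, hTσ, hW_S, ← hg, hTρ]
  have e3 : rootS σ * rootS ρ = e (1 / 8) * rootS τ := by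
    rw [cσ, cρ]
    exact rootS_mul_rootS τ.im_pos (by rw [← cσ]; exact σ.im_pos)
  have e4 : rootS σ ^ (2 * k + 1) * rootS ρ ^ (2 * k + 1)
      = ε * ξ * rootS τ ^ (2 * k + 1) := by
    rw [← mul_pow, e3, mul_pow, hζ]
  refine mul_left_cancel₀ hξ ?_
  rw [e1]
  linear_combination ε * rootS σ ^ (2 * k + 1) * e2 + ε ^ 2 * g τ * e4
    + ε * ξ * rootS τ ^ (2 * k + 1) * g τ * hε

end

noncomputable section

/-! ### The lattice `D_r` and its dual -/

section Lattice

variable {r : ℕ}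

theorem bil_add_left (x y w : Fin r → ℚ) : bil (x + y) w = bil x w + bil y w := by
  simp [bil, add_mul, Finset.sum_add_distrib]

theorem bil_comm (x y : Fin r → ℚ) : bil x y = bil y x := by
  simp [bil, mul_comm]

theorem bil_add_right (x y w : Fin r → ℚ) : bil w (x + y) = bil w x + bil w y := by
  simp [bil, mul_add, Finset.sum_add_distrib]

theorem bil_smul_left (a : ℚ) (x y : Fin r → ℚ) : bil (a • x) y = a * bil x y := by
  simp [bil, mul_assoc, Finset.mul_sum]

theorem bil_smul_right (a : ℚ) (x y : Fin r → ℚ) : bil x (a • y) = a * bil x y := by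
  rw [bil_comm, bil_smul_left, bil_comm]

theorem bil_neg_left (x y : Fin r → ℚ) : bil (-x) y = -bil x y := by
  simp [bil]

theorem bil_neg_right (x y : Fin r → ℚ) : bil x (-y) = -bil x y := by
  simp [bil]

theorem quad_add (x y : Fin r → ℚ) : quad (x + y) = quad x + bil x y + quad y := by
  simp only [quad, bil_add_left, bil_add_right, bil_comm y x]
  ring

theorem quad_smul (a : ℚ) (x : Fin r → ℚ) : quad (a • x) = a ^ 2 * quad x := by
  simp only [quad, bil_smul_left, bil_smul_right]
  ring

theorem quad_neg (x : Fin r → ℚ) : quad (-x) = quad x := by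
  simp [quad, bil]

theorem bilC_add (x y : Fin r → ℚ) (z : Fin r → ℂ) : bilC (x + y) z = bilC x z + bilC y z := by
  simp [bilC, add_mul, Finset.sum_add_distrib]

theorem bilC_neg (x : Fin r → ℚ) (z : Fin r → ℂ) : bilC (-x) z = -bilC x z := by
  simp [bilC]

theorem bilC_zero_right (x : Fin r → ℚ) : bilC x (fun _ => 0) = 0 := by
  simp [bilC]

theorem bilC_smul (a : ℚ) (x : Fin r → ℚ) (z : Fin r → ℂ) : bilC (a • x) z = a * bilC x z := by
  simp [bilC, mul_assoc, Finset.mul_sum]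

theorem bilC_translate (x l m : Fin r → ℚ) (z : Fin r → ℂ) (τ : ℂ) :
    bilC x (fun i => z i + (l i : ℂ) * τ + (m i : ℂ))
      = bilC x z + (bil x l : ℂ) * τ + (bil x m : ℂ) := by
  simp only [bilC, bil, mul_add, Finset.sum_add_distrib]
  push_cast
  rw [Finset.sum_mul]
  simp only [mul_assoc]

theorem two_smul_single_mem (i : Fin r) : Pi.single i (2 : ℚ) ∈ latticeD r := by
  refine ⟨Pi.single i 2, fun j => ?_, ?_⟩
  · rcases eq_or_ne j i with rfl | h
    · simp
    · simp [h]
  · simp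

theorem single_sub_single_mem (i j : Fin r) :
    Pi.single i (1 : ℚ) - Pi.single j (1 : ℚ) ∈ latticeD r := by
  refine ⟨Pi.single i 1 - Pi.single j 1, fun l => ?_, ?_⟩
  · simp only [Pi.sub_apply]
    rcases eq_or_ne l i with rfl | h <;> rcases eq_or_ne l j with rfl | h' <;> simp [*]
  · simp

theorem bil_single (i : Fin r) (a : ℚ) (x : Fin r → ℚ) : bil (Pi.single i a) x = a * x i := by
  simp [bil, Pi.single_apply]

/-- The common fractional part of the coordinates of the elements of `v_j + D_r`. -/
def repShift (j : Fin 4) : ℚ := ![0, 1 / 2, 0, 1 / 2] j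

/-- The parity of the sum of the integral parts of the elements of `v_j + D_r`. -/
def repParity (j : Fin 4) : ℤ := ![0, 0, 1, 1] j

/-- Pairing with `e_i - e_j` makes all coordinates congruent modulo `1`, and pairing with `2 e_i`
makes them half-integral. -/
theorem exists_int_shift_of_mem_dual (hr : 0 < r) {x : Fin r → ℚ} (hx : x ∈ dual (latticeD r)) :
    (∃ a : Fin r → ℤ, x = fun i => (a i : ℚ)) ∨ ∃ a : Fin r → ℤ, x = fun i => (a i : ℚ) + 1 / 2 := by
  obtain ⟨b, hb⟩ := hx _ (two_smul_single_mem ⟨0, hr⟩)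
  have h1 : ∀ i, ∃ a : ℤ, x i = x ⟨0, hr⟩ + a := by
    intro i
    obtain ⟨a, ha⟩ := hx _ (single_sub_single_mem i ⟨0, hr⟩)
    refine ⟨a, ?_⟩
    rw [← ha, sub_eq_add_neg, bil_add_left, bil_neg_left, bil_single, bil_single]
    ring
  choose a ha using h1
  rw [bil_single] at hb
  rcases Int.even_or_odd' b with ⟨c, rfl | rfl⟩
  · left
    refine ⟨fun i => a i + c, funext fun i => ?_⟩
    rw [ha i]
    push_cast at hb ⊢
    linarith
  · right
    refine ⟨fun i => a i + c, funext fun i => ?_⟩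
    rw [ha i]
    push_cast at hb ⊢
    linarith

theorem int_mem_dual (a : Fin r → ℤ) : (fun i => (a i : ℚ)) ∈ dual (latticeD r) := by
  rintro x ⟨b, hb, -⟩
  refine ⟨∑ i, b i * a i, ?_⟩
  simp [bil, hb]

theorem half_mem_dual : (fun _ => (1 / 2 : ℚ)) ∈ dual (latticeD r) := by
  rintro x ⟨b, hb, c, hc⟩
  refine ⟨c, ?_⟩
  have : ((∑ i, b i : ℤ) : ℚ) = c + c := by exact_mod_cast hc
  push_cast at this
  simp only [bil, hb, ← Finset.sum_mul, this]
  ring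

theorem int_add_shift_mem_dual (a : Fin r → ℤ) (j : Fin 4) :
    (fun i => (a i : ℚ) + repShift j) ∈ dual (latticeD r) := by
  have h0 := int_mem_dual a
  have h1 := add_mem h0 half_mem_dual
  fin_cases j
  · simpa [repShift] using h0
  · exact h1
  · simpa [repShift] using h0
  · exact h1

theorem exists_rep_eq (hr : 0 < r) (j : Fin 4) :
    ∃ w : Fin r → ℤ, (rep r j = fun i => (w i : ℚ) + repShift j) ∧ Even (∑ i, w i + repParity j) := by
  obtain ⟨n, rfl⟩ := Nat.exists_eq_succ_of_ne_zero hr.ne'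
  have h : ∀ i : Fin (n + 1), (i : ℕ) + 1 = n + 1 ↔ i = Fin.last n := fun i => by
    rw [Fin.ext_iff, Fin.val_last]; omega
  fin_cases j
  · exact ⟨0, by ext; simp [rep, repShift], by simp [repParity]⟩
  · exact ⟨0, by ext; simp [rep, repShift], by simp [repParity]⟩
  · refine ⟨Pi.single (Fin.last n) 1, ?_, by simp [repParity]⟩
    ext i
    simp only [rep, repShift, Pi.single_apply, Nat.succ_eq_add_one, h]
    split_ifs <;> norm_num
  · refine ⟨Pi.single (Fin.last n) (-1), ?_, by simp [repParity]⟩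
    ext i
    simp only [rep, repShift, Pi.single_apply, Nat.succ_eq_add_one, h]
    split_ifs <;> norm_num

theorem sub_rep_mem_iff (hr : 0 < r) (j : Fin 4) (x : Fin r → ℚ) :
    x - rep r j ∈ latticeD r ↔
      ∃ a : Fin r → ℤ, (x = fun i => (a i : ℚ) + repShift j) ∧ Even (∑ i, a i + repParity j) := by
  obtain ⟨w, hw, hw'⟩ := exists_rep_eq hr j
  constructor
  · rintro ⟨b, hb, hb'⟩
    refine ⟨b + w, funext fun i => ?_, ?_⟩
    · have := hb i
      rw [Pi.sub_apply, hw] at this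
      simp only [Pi.add_apply, Int.cast_add]
      linarith
    · simp only [Pi.add_apply, Finset.sum_add_distrib, add_assoc]
      exact hb'.add hw'
  · rintro ⟨a, rfl, ha⟩
    refine ⟨a - w, fun i => by rw [Pi.sub_apply, hw]; simp, ?_⟩
    have := ha.sub hw'
    simp only [Pi.sub_apply, Finset.sum_sub_distrib]
    rwa [add_sub_add_right_eq_sub] at this

theorem rep_mem_dual (hr : 0 < r) (j : Fin 4) : rep r j ∈ dual (latticeD r) := by
  obtain ⟨w, hw, -⟩ := exists_rep_eq hr j
  rw [hw]
  exact int_add_shift_mem_dual w j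

theorem mem_dual_of_sub_rep_mem (hr : 0 < r) {j : Fin 4} {x : Fin r → ℚ}
    (h : x - rep r j ∈ latticeD r) : x ∈ dual (latticeD r) := by
  obtain ⟨a, rfl, -⟩ := (sub_rep_mem_iff hr j x).1 h
  exact int_add_shift_mem_dual a j

theorem exists_sub_rep_mem (hr : 0 < r) {x : Fin r → ℚ} (hx : x ∈ dual (latticeD r)) :
    ∃ j, x - rep r j ∈ latticeD r := by
  simp only [sub_rep_mem_iff hr]
  rcases exists_int_shift_of_mem_dual hr hx with ⟨a, rfl⟩ | ⟨a, rfl⟩ <;>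
    rcases Int.even_or_odd (∑ i, a i) with h | h
  · exact ⟨0, a, by simp [repShift], by simpa [repParity] using h⟩
  · exact ⟨2, a, by simp [repShift], by simpa [repParity, Int.even_add_one] using h⟩
  · exact ⟨1, a, by simp [repShift], by simpa [repParity] using h⟩
  · exact ⟨3, a, by simp [repShift], by simpa [repParity, Int.even_add_one] using h⟩

theorem repShift_repParity_injective {i j : Fin 4} (h : ∃ a : ℤ, repShift i = repShift j + a)
    (h' : Even (repParity i - repParity j)) : i = j := by
  obtain ⟨a, ha⟩ := h
  have h2 : 2 * repShift i = 2 * repShift j + 2 * a := by rw [ha]; ring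
  fin_cases i <;> fin_cases j <;> first
    | rfl
    | (exfalso; revert h'; simp [repParity]; done)
    | (exfalso
       norm_num [repShift] at h2
       norm_cast at h2
       omega)

theorem sub_rep_mem_unique (hr : 0 < r) {x : Fin r → ℚ} {i j : Fin 4}
    (hi : x - rep r i ∈ latticeD r) (hj : x - rep r j ∈ latticeD r) : i = j := by
  obtain ⟨a, rfl, ha⟩ := (sub_rep_mem_iff hr i x).1 hi
  obtain ⟨b, hb, hb'⟩ := (sub_rep_mem_iff hr j _).1 hj
  have h1 : ∀ l, (a l : ℚ) + repShift i = b l + repShift j := fun l => congrFun hb l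
  have h2 : ∀ l, b l = a l + (b ⟨0, hr⟩ - a ⟨0, hr⟩) := fun l => by
    have := h1 l
    have := h1 ⟨0, hr⟩
    have h : (b l : ℚ) = a l + (b ⟨0, hr⟩ - a ⟨0, hr⟩) := by linarith
    exact_mod_cast h
  set d := b ⟨0, hr⟩ - a ⟨0, hr⟩ with hd
  have h3 : repShift i = repShift j + d := by
    have := h1 ⟨0, hr⟩
    rw [hd]; push_cast; linarith
  -- The integer `d` is a difference of two numbers from `{0, 1/2}`.
  have hd0 : d = 0 := by
    have : -(1 : ℚ) < d ∧ (d : ℚ) < 1 := by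
      have : (d : ℚ) = repShift i - repShift j := by linarith
      rw [this]
      fin_cases i <;> fin_cases j <;> norm_num [repShift]
    have h4 : -1 < d ∧ d < 1 := by exact_mod_cast this
    omega
  refine repShift_repParity_injective ⟨d, h3⟩ ?_
  have hab : b = a := funext fun l => by rw [h2 l, hd0, add_zero]
  rw [hab] at hb'
  have := ha.sub hb'
  rwa [add_sub_add_left_eq_sub] at this

theorem relIndex_latticeD (hr : 0 < r) : (latticeD r).relIndex (dual (latticeD r)) = 4 := by
  rw [AddSubgroup.relIndex, AddSubgroup.index]
  let f : Fin 4 → dual (latticeD r) ⧸ (latticeD r).addSubgroupOf (dual (latticeD r)) :=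
    fun j => QuotientAddGroup.mk ⟨rep r j, rep_mem_dual hr j⟩
  have hf : Function.Bijective f := by
    constructor
    · intro i j hij
      have := QuotientAddGroup.eq.1 hij
      rw [AddSubgroup.mem_addSubgroupOf] at this
      refine (sub_rep_mem_unique hr (x := rep r j) ?_ ?_)
      · simpa [sub_eq_add_neg, add_comm] using this
      · simp
    · intro q
      induction q using QuotientAddGroup.induction_on with
      | H x =>
        obtain ⟨j, hj⟩ := exists_sub_rep_mem hr x.2
        refine ⟨j, QuotientAddGroup.eq.2 ?_⟩
        rw [AddSubgroup.mem_addSubgroupOf]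
        simpa [sub_eq_add_neg, add_comm] using hj
  rw [← Nat.card_congr (Equiv.ofBijective f hf), Nat.card_eq_fintype_card, Fintype.card_fin]

theorem mem_dual_of_mem {x : Fin r → ℚ} (hx : x ∈ latticeD r) : x ∈ dual (latticeD r) := by
  obtain ⟨a, ha, -⟩ := hx
  rw [funext ha]
  exact int_mem_dual a

theorem exists_bil_eq_int {x y : Fin r → ℚ} (hx : x ∈ dual (latticeD r)) (hy : y ∈ latticeD r) :
    ∃ a : ℤ, bil x y = a := by
  rw [bil_comm]
  exact hx y hy

theorem exists_quad_eq_int {x : Fin r → ℚ} (hx : x ∈ latticeD r) : ∃ a : ℤ, quad x = a := by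
  obtain ⟨a, ha, h⟩ := hx
  have : Even (∑ i, a i * a i) := by
    have h1 : Even (∑ i, (a i * a i + a i)) := by
      refine Finset.even_sum _ fun i _ => ?_
      have := Int.even_mul_succ_self (a i)
      rwa [mul_add, mul_one] at this
    rw [Finset.sum_add_distrib] at h1
    exact (Int.even_add.1 h1).2 h
  obtain ⟨c, hc⟩ := this
  refine ⟨c, ?_⟩
  have h2 : ((∑ i, a i * a i : ℤ) : ℚ) = c + c := by exact_mod_cast hc
  push_cast at h2
  simp only [quad, bil, ha, h2]
  ring

theorem quad_rep_zero : quad (rep r 0) = 0 := by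
  simp [quad, bil, rep]

theorem quad_rep_one : quad (rep r 1) = r / 8 := by
  simp [quad, bil, rep]
  ring

theorem quad_rep_two (hr : 0 < r) : quad (rep r 2) = 1 / 2 := by
  obtain ⟨n, rfl⟩ := Nat.exists_eq_succ_of_ne_zero hr.ne'
  have h : ∀ i : Fin (n + 1), (i : ℕ) = n ↔ i = Fin.last n := fun i => by
    rw [Fin.ext_iff, Fin.val_last]
  simp [quad, bil, rep, h]

theorem quad_rep_three : quad (rep r 3) = r / 8 := by
  have : ∀ i : Fin r, rep r 3 i * rep r 3 i = 1 / 4 := fun i => by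
    simp only [rep]
    split_ifs <;> norm_num
  simp [quad, bil, this]
  ring

end Lattice

end

noncomputable section

/-! ### Products of theta functions -/

theorem hasSum_mul_complex {ι κ : Type*} {f : ι → ℂ} {g : κ → ℂ} {s t : ℂ} (hf : HasSum f s)
    (hg : HasSum g t) : HasSum (fun x : ι × κ => f x.1 * g x.2) (s * t) :=
  hf.mul hg (summable_mul_of_summable_norm hf.summable.norm hg.summable.norm)

theorem hasSum_pi_prod {ι : Type*} {n : ℕ} {f : Fin n → ι → ℂ} {s : Fin n → ℂ}
    (h : ∀ i, HasSum (f i) (s i)) :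
    HasSum (fun m : Fin n → ι => ∏ i, f i (m i)) (∏ i, s i) := by
  induction n with
  | zero => simp [hasSum_unique]
  | succ n ih =>
    have h1 := hasSum_mul_complex (h 0)
      (ih (f := fun i => f i.succ) (s := fun i => s i.succ) fun i => h _)
    rw [← (Fin.consEquiv fun _ => ι).hasSum_iff, Fin.prod_univ_succ]
    refine h1.congr_fun fun x => ?_
    simp [Fin.prod_univ_succ, Fin.consEquiv]

variable {r : ℕ}

/-- `∏ᵢ ϑ₀₀(τ, zᵢ)`. -/
def prod00 (τ : ℂ) (z : Fin r → ℂ) : ℂ := ∏ i, th00 τ (z i)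

/-- `∏ᵢ ϑ₀₁(τ, zᵢ)`. -/
def prod01 (τ : ℂ) (z : Fin r → ℂ) : ℂ := ∏ i, th01 τ (z i)

/-- `∏ᵢ ϑ₁₀(τ, zᵢ)`. -/
def prod10 (τ : ℂ) (z : Fin r → ℂ) : ℂ := ∏ i, th10 τ (z i)

theorem e_sum {ι : Type*} (s : Finset ι) (f : ι → ℂ) : e (∑ i ∈ s, f i) = ∏ i ∈ s, e (f i) := by
  simp only [e, Finset.mul_sum, Complex.exp_sum]

theorem e_quad_add_bilC (τ : ℂ) (y : Fin r → ℚ) (z : Fin r → ℂ) :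
    e (τ * (quad y : ℂ) + bilC y z) = ∏ i, e ((y i : ℂ) ^ 2 * τ / 2 + y i * z i) := by
  rw [← e_sum, Finset.sum_add_distrib, bilC, quad, bil]
  congr 2
  push_cast
  rw [Finset.sum_div, Finset.mul_sum]
  exact Finset.sum_congr rfl fun i _ => by ring

theorem hasSum_prod00 (τ : ℍ) (z : Fin r → ℂ) :
    HasSum (fun a : Fin r → ℤ => e ((τ : ℂ) * (quad fun i => (a i : ℚ) : ℚ)
      + bilC (fun i => (a i : ℚ)) z)) (prod00 τ z) := by
  have := hasSum_pi_prod fun i => hasSum_th00 τ.im_pos (z i)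
  refine this.congr_fun fun a => ?_
  simp only [e_quad_add_bilC, Rat.cast_intCast]

theorem hasSum_prod01 (τ : ℍ) (z : Fin r → ℂ) :
    HasSum (fun a : Fin r → ℤ => (-1) ^ (∑ i, a i) * e ((τ : ℂ) * (quad fun i => (a i : ℚ) : ℚ)
      + bilC (fun i => (a i : ℚ)) z)) (prod01 τ z) := by
  have := hasSum_pi_prod fun i => hasSum_th01 τ.im_pos (z i)
  refine this.congr_fun fun a => ?_
  have hz : ((-1 : ℂ)) ^ (∑ i, a i) = ∏ i, (-1) ^ (a i) := by
    induction (Finset.univ : Finset (Fin r)) using Finset.cons_induction with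
    | empty => simp
    | cons j s hj ih => rw [Finset.sum_cons, Finset.prod_cons, zpow_add₀ (by simp), ih]
  rw [e_quad_add_bilC, hz, ← Finset.prod_mul_distrib]
  simp

theorem hasSum_prod10 (τ : ℍ) (z : Fin r → ℂ) :
    HasSum (fun a : Fin r → ℤ => e ((τ : ℂ) * (quad fun i => (a i : ℚ) + 1 / 2 : ℚ)
      + bilC (fun i => (a i : ℚ) + 1 / 2) z)) (prod10 τ z) := by
  have := hasSum_pi_prod fun i => hasSum_th10 τ.im_pos (z i)
  refine this.congr_fun fun a => ?_
  rw [e_quad_add_bilC]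
  push_cast
  rfl

/-- The elements of `v_j + D_r` in terms of the integral parts of their coordinates. -/
def repClassEquiv (hr : 0 < r) (j : Fin 4) :
    {a : Fin r → ℤ // Even (∑ i, a i + repParity j)} ≃
      {y : Fin r → ℚ // y - rep r j ∈ latticeD r} :=
  Equiv.ofBijective (fun a => ⟨fun i => (a.1 i : ℚ) + repShift j,
      (sub_rep_mem_iff hr j _).2 ⟨a.1, rfl, a.2⟩⟩) (by
    constructor
    · rintro ⟨a, ha⟩ ⟨b, hb⟩ h
      ext i
      simpa using congrFun (congrArg Subtype.val h) i
    · rintro ⟨y, hy⟩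
      obtain ⟨a, rfl, ha⟩ := (sub_rep_mem_iff hr j y).1 hy
      exact ⟨⟨a, ha⟩, rfl⟩)

theorem hasSum_shift (j : Fin 4) (τ : ℍ) (z : Fin r → ℂ) :
    HasSum (fun a : Fin r → ℤ => e ((τ : ℂ) * (quad fun i => (a i : ℚ) + repShift j : ℚ)
      + bilC (fun i => (a i : ℚ) + repShift j) z))
      (![prod00 (τ : ℂ) z, prod10 τ z, prod00 τ z, prod10 τ z] j) := by
  have h0 := hasSum_prod00 τ z
  have h1 := hasSum_prod10 τ z
  fin_cases j
  · simpa [repShift] using h0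
  · exact h1
  · simpa [repShift] using h0
  · exact h1

theorem hasSum_latticeTheta_subtype (hr : 0 < r) (j : Fin 4) (τ : ℍ) (z : Fin r → ℂ) :
    HasSum (fun a : {a : Fin r → ℤ // Even (∑ i, a i + repParity j)} =>
      e ((τ : ℂ) * (quad fun i => (a.1 i : ℚ) + repShift j : ℚ)
      + bilC (fun i => (a.1 i : ℚ) + repShift j) z)) (latticeTheta (latticeD r) (rep r j) τ z) := by
  have h : Summable (fun a : {a : Fin r → ℤ // Even (∑ i, a i + repParity j)} =>
      e ((τ : ℂ) * (quad fun i => (a.1 i : ℚ) + repShift j : ℚ)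
      + bilC (fun i => (a.1 i : ℚ) + repShift j) z)) :=
    (hasSum_shift j τ z).summable.comp_injective
      (Subtype.val_injective (p := fun a : Fin r → ℤ => Even (∑ i, a i + repParity j)))
  rw [latticeTheta, ← (repClassEquiv hr j).tsum_eq]
  exact h.hasSum

theorem hasSum_latticeTheta (hr : 0 < r) (j : Fin 4) (τ : ℍ) (z : Fin r → ℂ) :
    HasSum (fun y : {y : Fin r → ℚ // y - rep r j ∈ latticeD r} =>
      e ((τ : ℂ) * (quad y.1 : ℂ) + bilC y.1 z)) (latticeTheta (latticeD r) (rep r j) τ z) := by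
  rw [← (repClassEquiv hr j).hasSum_iff]
  exact hasSum_latticeTheta_subtype hr j τ z

theorem hasSum_even_add_odd {f : (Fin r → ℤ) → ℂ} {A B : ℂ}
    (hA : HasSum (fun a : {a : Fin r → ℤ // Even (∑ i, a i + 0)} => f a.1) A)
    (hB : HasSum (fun a : {a : Fin r → ℤ // Even (∑ i, a i + 1)} => f a.1) B) :
    HasSum f (A + B) := by
  refine HasSum.add_isCompl (s := {a | Even (∑ i, a i + 0)}) (t := {a | Even (∑ i, a i + 1)})
    ?_ hA hB
  have : {a : Fin r → ℤ | Even (∑ i, a i + 1)} = {a | Even (∑ i, a i + 0)}ᶜ := by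
    ext a
    simp
  rw [this]
  exact isCompl_compl

/-- The classes of `v₀` and `v₂` are the vectors of `ℤʳ` with even and with odd coordinate sum. The
classes of `v₁` and `v₃` divide the shifted lattice in the same way. -/
theorem latticeTheta_zero_add_two (hr : 0 < r) (τ : ℍ) (z : Fin r → ℂ) :
    latticeTheta (latticeD r) (rep r 0) τ z + latticeTheta (latticeD r) (rep r 2) τ z
      = prod00 τ z := by
  refine HasSum.unique (hasSum_even_add_odd
    (f := fun a => e ((τ : ℂ) * (quad fun i => (a i : ℚ) + 0 : ℚ)
      + bilC (fun i => (a i : ℚ) + 0) z)) ?_ ?_) ?_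
  · exact hasSum_latticeTheta_subtype hr 0 τ z
  · exact hasSum_latticeTheta_subtype hr 2 τ z
  · exact hasSum_shift 0 τ z

theorem latticeTheta_one_add_three (hr : 0 < r) (τ : ℍ) (z : Fin r → ℂ) :
    latticeTheta (latticeD r) (rep r 1) τ z + latticeTheta (latticeD r) (rep r 3) τ z
      = prod10 τ z := by
  refine HasSum.unique (hasSum_even_add_odd
    (f := fun a => e ((τ : ℂ) * (quad fun i => (a i : ℚ) + 1 / 2 : ℚ)
      + bilC (fun i => (a i : ℚ) + 1 / 2) z)) ?_ ?_) ?_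
  · exact hasSum_latticeTheta_subtype hr 1 τ z
  · exact hasSum_latticeTheta_subtype hr 3 τ z
  · exact hasSum_shift 1 τ z

theorem latticeTheta_zero_sub_two (hr : 0 < r) (τ : ℍ) (z : Fin r → ℂ) :
    latticeTheta (latticeD r) (rep r 0) τ z - latticeTheta (latticeD r) (rep r 2) τ z
      = prod01 τ z := by
  rw [sub_eq_add_neg]
  refine HasSum.unique (hasSum_even_add_odd
    (f := fun a => (-1) ^ (∑ i, a i) * e ((τ : ℂ) * (quad fun i => (a i : ℚ) : ℚ)
      + bilC (fun i => (a i : ℚ)) z)) ?_ ?_) (hasSum_prod01 τ z)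
  · refine (hasSum_latticeTheta_subtype hr 0 τ z).congr_fun fun a => ?_
    have h := a.2
    have h1 : Even (∑ i, a.1 i) := by simpa [repParity] using h
    simp [h1.neg_one_zpow, repShift]
  · refine (hasSum_latticeTheta_subtype hr 2 τ z).neg.congr_fun fun a => ?_
    have h := a.2
    have h1 : Odd (∑ i, a.1 i) := by simpa [repParity, Int.even_add_one] using h
    simp [h1.neg_one_zpow, repShift]

/-- Four theta functions would need a fourth product, that of the odd functions `ϑ₁₁`. It belongs to
the difference of the classes `v₁` and `v₃` and drops out because `h 1 = h 3`. -/
theorem sum_mul_latticeTheta (hr : 0 < r) (h : Fin 4 → ℂ) (h13 : h 1 = h 3) (τ : ℍ)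
    (z : Fin r → ℂ) :
    ∑ j, h j * latticeTheta (latticeD r) (rep r j) τ z
      = ((h 0 + h 2) * prod00 τ z + (h 0 - h 2) * prod01 τ z + (h 1 + h 3) * prod10 τ z) / 2 := by
  rw [Fin.sum_univ_four, ← latticeTheta_zero_add_two hr, ← latticeTheta_zero_sub_two hr,
    ← latticeTheta_one_add_three hr, h13]
  ring

/-! ### Transformation laws -/

theorem quadC_div (τ : ℂ) (z : Fin r → ℂ) : quadC z / τ = ∑ i, z i ^ 2 / (2 * τ) := by
  rw [quadC, Finset.sum_div, Finset.sum_div]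
  refine Finset.sum_congr rfl fun i _ => ?_
  rw [div_div, sq]

theorem prod00_S {τ : ℂ} (hτ : 0 < τ.im) (z : Fin r → ℂ) :
    prod00 (-1 / τ) (fun i => z i / τ) = rootS τ ^ r * e (quadC z / τ) * prod00 τ z := by
  simp [prod00, th00_S hτ, Finset.prod_mul_distrib, quadC_div, e_sum]

theorem prod01_S {τ : ℂ} (hτ : 0 < τ.im) (z : Fin r → ℂ) :
    prod01 (-1 / τ) (fun i => z i / τ) = rootS τ ^ r * e (quadC z / τ) * prod10 τ z := by
  simp [prod01, prod10, th01_S hτ, Finset.prod_mul_distrib, quadC_div, e_sum]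

theorem prod10_S {τ : ℂ} (hτ : 0 < τ.im) (z : Fin r → ℂ) :
    prod10 (-1 / τ) (fun i => z i / τ) = rootS τ ^ r * e (quadC z / τ) * prod01 τ z := by
  simp [prod01, prod10, th10_S hτ, Finset.prod_mul_distrib, quadC_div, e_sum]

theorem prod00_T {τ : ℂ} (hτ : 0 < τ.im) (z : Fin r → ℂ) :
    prod00 (τ + 1) z = prod01 τ z := by
  simp [prod00, prod01, th00_T hτ]

theorem prod01_T {τ : ℂ} (hτ : 0 < τ.im) (z : Fin r → ℂ) :
    prod01 (τ + 1) z = prod00 τ z := by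
  simp [prod00, prod01, th01_T hτ]

theorem prod10_T {τ : ℂ} (hτ : 0 < τ.im) (z : Fin r → ℂ) :
    prod10 (τ + 1) z = e (1 / 8) ^ r * prod10 τ z := by
  simp [prod10, th10_T hτ, Finset.prod_mul_distrib]

/-- The three products of theta functions are linearly independent functions of `z`. -/
theorem coeff_eq_zero_of_prod_eq_zero (hr : 0 < r) (τ : ℍ) {a b c : ℂ}
    (h : ∀ z : Fin r → ℂ, a * prod00 τ z + b * prod01 τ z + c * prod10 τ z = 0) :
    a = 0 ∧ b = 0 ∧ c = 0 := by
  have h00 : prod00 τ (fun _ : Fin r => 0) ≠ 0 :=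
    Finset.prod_ne_zero_iff.2 fun _ _ => th00_ne_zero τ
  have h01 : prod01 τ (fun _ : Fin r => 0) ≠ 0 :=
    Finset.prod_ne_zero_iff.2 fun _ _ => th01_ne_zero τ
  have h10 : prod10 τ (fun _ : Fin r => 0) ≠ 0 :=
    Finset.prod_ne_zero_iff.2 fun _ _ => th10_ne_zero τ
  obtain ⟨n, rfl⟩ := Nat.exists_eq_succ_of_ne_zero hr.ne'
  -- Three evaluation points suffice. Moving one coordinate by `1` negates only `∏ϑ₁₀`, and moving
  -- it by `τ` distinguishes `∏ϑ₀₀` from `∏ϑ₀₁` by a sign; the values at `0` do not vanish.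
  have e1 := h fun _ => 0
  have e2 := h (Fin.cons (0 + 1) fun _ => 0)
  have e3 := h (Fin.cons (0 + τ) fun _ => 0)
  simp only [prod00, prod01, prod10, Fin.prod_univ_succ, Fin.cons_zero, Fin.cons_succ]
    at e1 e2 e3 h00 h01 h10
  rw [th00_add_one, th01_add_one, th10_add_one] at e2
  rw [th00_add_self, th01_add_self] at e3
  have hc : c = 0 := by
    have : c * (th10 τ 0 * ∏ _i : Fin n, th10 τ 0) = 0 := by linear_combination (e1 - e2) / 2
    exact (mul_eq_zero.1 this).resolve_right h10
  rw [hc, zero_mul, add_zero] at e1 e3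
  have hb : b = 0 := by
    have : e (-τ / 2 - 0) * (b * (th01 τ 0 * ∏ _i : Fin n, th01 τ 0)) = 0 := by
      linear_combination (e (-τ / 2 - 0) * e1 - e3) / 2
    exact (mul_eq_zero.1 ((mul_eq_zero.1 this).resolve_left (e_ne_zero _))).resolve_right h01
  rw [hb, zero_mul, add_zero] at e1
  exact ⟨(mul_eq_zero.1 e1).resolve_right h00, hb, hc⟩

end

noncomputable section

/-! ### Fourier coefficients of Jacobi forms -/

section Fourier

variable {n : ℕ} {L : AddSubgroup (Fin n → ℚ)}

/-- Sums over `ℤ × L♯` as sums over `ℚ × ℚⁿ`. -/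
theorem hasSum_int_dual_iff {g : ℚ × (Fin n → ℚ) → ℂ} {s : ℂ}
    (hg : ∀ p, g p ≠ 0 → (∃ a : ℤ, p.1 = a) ∧ p.2 ∈ dual L) :
    HasSum (fun p : ℤ × dual L => g ((p.1 : ℚ), (p.2 : Fin n → ℚ))) s ↔ HasSum g s := by
  have hinj : Function.Injective
      fun p : ℤ × dual L => (((p.1 : ℚ), (p.2 : Fin n → ℚ)) : ℚ × (Fin n → ℚ)) := by
    rintro ⟨a, x⟩ ⟨b, y⟩ h
    simp only [Prod.mk.injEq, Int.cast_inj] at h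
    exact Prod.ext h.1 (Subtype.ext h.2)
  refine hinj.hasSum_iff (f := g) fun p hp => ?_
  by_contra h
  obtain ⟨⟨a, ha⟩, hx⟩ := hg p h
  exact hp ⟨(a, ⟨p.2, hx⟩), Prod.ext ha.symm rfl⟩

theorem hasSum_int_iff {g : ℚ → ℂ} {s : ℂ} (hg : ∀ m, g m ≠ 0 → ∃ a : ℤ, m = a) :
    HasSum (fun m : ℤ => g m) s ↔ HasSum g s := by
  refine (Int.cast_injective (α := ℚ)).hasSum_iff (f := g) fun m hm => ?_
  by_contra h
  obtain ⟨a, rfl⟩ := hg m h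
  exact hm ⟨a, rfl⟩

/-- Summation over all of `ℚ × ℚⁿ` allows reindexing by bijections that need not preserve `ℤ × L♯`.
-/
theorem isFourierExpansion_iff {φ : ℍ → (Fin n → ℂ) → ℂ} {c : ℚ → (Fin n → ℚ) → ℂ}
    (hc : ∀ m x, c m x ≠ 0 → (∃ a : ℤ, m = a) ∧ x ∈ dual L) :
    IsFourierExpansion L φ c ↔ ∀ (τ : ℍ) (z : Fin n → ℂ), HasSum (fun p : ℚ × (Fin n → ℚ) =>
      c p.1 p.2 * e ((p.1 : ℂ) * (τ : ℂ) + bilC p.2 z)) (φ τ z) := by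
  have : ∀ (τ : ℍ) (z : Fin n → ℂ), HasSum (fun p : ℤ × dual L =>
      c (p.1 : ℚ) (p.2 : Fin n → ℚ) * e ((p.1 : ℂ) * (τ : ℂ) + bilC (p.2 : Fin n → ℚ) z)) (φ τ z)
      ↔ HasSum (fun p : ℚ × (Fin n → ℚ) =>
      c p.1 p.2 * e ((p.1 : ℂ) * (τ : ℂ) + bilC p.2 z)) (φ τ z) := fun τ z => by
    rw [← hasSum_int_dual_iff (L := L)]
    · simp
    · exact fun p hp => hc _ _ (left_ne_zero_of_mul hp)
  simp only [IsFourierExpansion, this, and_iff_right_iff_imp]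
  exact fun _ => hc

/-- `(m, x) ↦ (m - β(x, l) + β(l), x - l)`. -/
def heisenberg (l : Fin n → ℚ) : ℚ × (Fin n → ℚ) ≃ ℚ × (Fin n → ℚ) where
  toFun p := (p.1 - bil p.2 l + quad l, p.2 - l)
  invFun p := (p.1 + bil p.2 l + quad l, p.2 + l)
  left_inv p := by
    ext1
    · have : bil (p.2 - l) l = bil p.2 l - 2 * quad l := by
        rw [sub_eq_add_neg, bil_add_left, bil_neg_left, quad]; ring
      simp only [this]; ring
    · simp
  right_inv p := by
    ext1
    · have : bil (p.2 + l) l = bil p.2 l + 2 * quad l := by rw [bil_add_left, quad]; ring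
      simp only [this]; ring
    · simp

theorem quad_sub (x l : Fin n → ℚ) : quad (x - l) = quad x - bil x l + quad l := by
  rw [sub_eq_add_neg, quad_add, bil_neg_right, quad_neg, ← sub_eq_add_neg]

end Fourier

/-- The conditions satisfied by the Fourier coefficients of the Jacobi forms of even weight and
index `D_r`. -/
structure IsCoeffFamily {r : ℕ} (C : ℚ → (Fin r → ℚ) → ℂ) : Prop where
  supp : ∀ m x, C m x ≠ 0 → (∃ a : ℤ, m = a) ∧ x ∈ dual (latticeD r)
  trans : ∀ l ∈ latticeD r, ∀ m x, C (m - bil x l + quad l) (x - l) = C m x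
  even : ∀ m x, C m (-x) = C m x
  nonneg : ∀ m x, C m x ≠ 0 → 0 ≤ m - quad x

/-! ### Symmetries of the coefficients and the theta decomposition -/

variable {r : ℕ}

/-- The elliptic law for the pair `(l, 0)` rewrites the expansion of `φ` by the bijection
`heisenberg l`; uniqueness compares the coefficients. -/
theorem IsFourierExpansion.trans {φ : ℍ → (Fin r → ℂ) → ℂ} {c : ℚ → (Fin r → ℚ) → ℂ} {κ : ℤ}
    (hφ : IsJacobiInvariant κ (latticeD r) φ) (hc : IsFourierExpansion (latticeD r) φ c)
    {l : Fin r → ℚ} (hl : l ∈ latticeD r) (m : ℚ) (x : Fin r → ℚ) :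
    c (m - bil x l + quad l) (x - l) = c m x := by
  have hs : ∀ m x, c (m - bil x l + quad l) (x - l) ≠ 0 →
      (∃ a : ℤ, m = a) ∧ x ∈ dual (latticeD r) := by
    intro m x h
    obtain ⟨⟨a, ha⟩, hx⟩ := hc.1 _ _ h
    have hx' : x ∈ dual (latticeD r) := by
      simpa using add_mem hx (mem_dual_of_mem hl)
    obtain ⟨b, hb⟩ := exists_bil_eq_int hx' hl
    obtain ⟨d, hd⟩ := exists_quad_eq_int hl
    refine ⟨⟨a + b - d, ?_⟩, hx'⟩
    push_cast
    linarith
  have h : IsFourierExpansion (latticeD r) φ fun m x => c (m - bil x l + quad l) (x - l) := by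
    rw [isFourierExpansion_iff hs]
    intro τ z
    have h1 := (isFourierExpansion_iff hc.1).1 hc τ (fun i => z i + (l i : ℂ) * τ + (0 : ℚ))
    have h2 := h1.mul_right (e ((τ : ℂ) * (quad l : ℂ) + bilC l z))
    have h3 := hφ.elliptic l hl 0 (zero_mem _) τ z
    simp only [Pi.zero_apply] at h3
    rw [h3, ← (heisenberg l).hasSum_iff] at h2
    refine h2.congr_fun fun p => ?_
    simp only [Function.comp_apply, heisenberg, Equiv.coe_fn_mk]
    rw [mul_assoc, ← e_add]
    congr 2
    have h4 := bilC_translate (p.2 - l) l 0 z τ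
    simp only [Pi.zero_apply] at h4
    rw [h4]
    have h5 : bil (p.2 - l) l = bil p.2 l - 2 * quad l := by
      rw [sub_eq_add_neg, bil_add_left, bil_neg_left, quad]; ring
    have h6 : bil (p.2 - l) 0 = 0 := by simp [bil]
    have h7 : bilC (p.2 - l) z = bilC p.2 z - bilC l z := by
      rw [sub_eq_add_neg, bilC_add, bilC_neg, ← sub_eq_add_neg]
    rw [h5, h6, h7]
    push_cast
    ring
  exact congrFun (congrFun (h.unique hc) m) x

/-- The matrix `-1` gives `φ(τ, -z) = φ(τ, z)` in even weight. -/
theorem IsFourierExpansion.even {φ : ℍ → (Fin r → ℂ) → ℂ} {c : ℚ → (Fin r → ℚ) → ℂ} {κ : ℤ}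
    (hκ : Even κ) (hφ : IsJacobiInvariant κ (latticeD r) φ)
    (hc : IsFourierExpansion (latticeD r) φ c) (m : ℚ) (x : Fin r → ℚ) :
    c m (-x) = c m x := by
  have hs : ∀ m x, c m (-x) ≠ 0 → (∃ a : ℤ, m = a) ∧ x ∈ dual (latticeD r) := by
    intro m x h
    obtain ⟨ha, hx⟩ := hc.1 _ _ h
    exact ⟨ha, by simpa using neg_mem hx⟩
  have h : IsFourierExpansion (latticeD r) φ fun m x => c m (-x) := by
    rw [isFourierExpansion_iff hs]
    intro τ z
    have h1 := (isFourierExpansion_iff hc.1).1 hc τ (fun i => -z i)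
    have h3 := hφ.modular (-1) τ z
    have h4 : φ τ (fun i => -z i) = φ τ z := by
      have h5 : (-1 : SL(2, ℤ)) • τ = τ := by simp
      rw [h5] at h3
      simp only [Matrix.SpecialLinearGroup.coe_neg, Matrix.SpecialLinearGroup.coe_one] at h3
      simpa [hκ.neg_one_zpow, div_neg, Even.neg_zpow hκ, e_zero] using h3
    rw [h4, ← (Equiv.prodCongr (Equiv.refl ℚ) (Equiv.neg (Fin r → ℚ))).hasSum_iff] at h1
    refine h1.congr_fun fun p => ?_
    simp only [Function.comp_apply, Equiv.prodCongr_apply, Prod.map, Equiv.refl_apply,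
      Equiv.neg_apply]
    congr 3
    simp [bilC]
  exact congrFun (congrFun (h.unique hc) m) x

theorem isCoeffFamily_of_mem {φ : ℍ → (Fin r → ℂ) → ℂ} {c : ℚ → (Fin r → ℚ) → ℂ} {κ : ℤ}
    (hκ : Even κ) (hφ : φ ∈ jacobiForms κ (latticeD r))
    (hc : IsFourierExpansion (latticeD r) φ c) : IsCoeffFamily c := by
  obtain ⟨h, d, hd, hd'⟩ := hφ
  obtain rfl := hd.unique hc
  exact ⟨hc.1, fun l hl m x => hc.trans h hl m x, hc.even hκ h, hd'⟩

/-- The series `∑_m C(m, v_j) e((m - β(v_j))τ)`. -/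
def comp (C : ℚ → (Fin r → ℚ) → ℂ) (j : Fin 4) (τ : ℂ) : ℂ :=
  ∑' m : ℤ, C (m : ℚ) (rep r j) * e (((m : ℂ) - (quad (rep r j) : ℂ)) * τ)

/-- The series `∑_m C(m, v_j) e((m - β(v_j))τ)` converge. -/
def CompSummable (C : ℚ → (Fin r → ℚ) → ℂ) : Prop :=
  ∀ (j : Fin 4) (τ : ℍ),
    Summable fun m : ℤ => C (m : ℚ) (rep r j) * e (((m : ℂ) - (quad (rep r j) : ℂ)) * τ)

theorem IsFourierExpansion.compSummable (hr : 0 < r) {φ : ℍ → (Fin r → ℂ) → ℂ}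
    {c : ℚ → (Fin r → ℚ) → ℂ} (hc : IsFourierExpansion (latticeD r) φ c) : CompSummable c := by
  intro j τ
  have h := (hc.2 τ fun _ => 0).summable.comp_injective
    (i := fun m : ℤ => (m, (⟨rep r j, rep_mem_dual hr j⟩ : dual (latticeD r))))
    fun a b h => (Prod.ext_iff.1 h).1
  refine (h.mul_right (e (-(quad (rep r j) : ℂ) * τ))).congr fun m => ?_
  simp only [Function.comp_apply, bilC_zero_right, add_zero]
  rw [mul_assoc, ← e_add]
  congr 2
  ring

namespace IsCoeffFamily

variable {C : ℚ → (Fin r → ℚ) → ℂ}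

theorem eq_rep (hC : IsCoeffFamily C) {j : Fin 4} {x : Fin r → ℚ}
    (hx : x - rep r j ∈ latticeD r) (N : ℚ) :
    C (N + quad x) x = C (N + quad (rep r j)) (rep r j) := by
  have h := hC.trans _ hx (N + quad x) x
  have h2 := quad_sub x (x - rep r j)
  rw [sub_sub_cancel] at h h2
  rw [← h, h2]
  congr 1
  ring

/-- The vector is `(-1, …, -1, 0)`, whose coordinate sum `-(r - 1)` is even because `r` is odd. -/
theorem neg_rep_one_sub_mem (hr : Odd r) : -rep r 1 - rep r 3 ∈ latticeD r := by
  rw [sub_rep_mem_iff hr.pos]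
  refine ⟨fun _ => -1, ?_, ?_⟩
  · ext i
    change -(1 / 2 : ℚ) = ((-1 : ℤ) : ℚ) + 1 / 2
    norm_num
  · have : Odd (r : ℤ) := by exact_mod_cast hr
    simpa [repParity, Int.even_add_one] using this

theorem rep_one_eq_three (hC : IsCoeffFamily C) (hr : Odd r) (N : ℚ) :
    C (N + quad (rep r 1)) (rep r 1) = C (N + quad (rep r 3)) (rep r 3) := by
  rw [← hC.eq_rep (neg_rep_one_sub_mem hr) N, quad_neg, hC.even]

theorem hasSum_int_rep_iff (hC : IsCoeffFamily C) (j : Fin 4) (τ s : ℂ) :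
    HasSum (fun m : ℤ => C (m : ℚ) (rep r j) * e (((m : ℂ) - (quad (rep r j) : ℂ)) * τ)) s ↔
      HasSum (fun N : ℚ => C (N + quad (rep r j)) (rep r j) * e (N * τ)) s := by
  have h1 := hasSum_int_iff
    (g := fun m : ℚ => C m (rep r j) * e (((m : ℂ) - (quad (rep r j) : ℂ)) * τ))
    (s := s) fun m hm => (hC.supp _ _ (left_ne_zero_of_mul hm)).1
  rw [← (Equiv.addRight (quad (rep r j))).hasSum_iff] at h1
  simpa [Function.comp_def] using h1

theorem hasSum_comp (hC : IsCoeffFamily C) (hs : CompSummable C) (j : Fin 4) (τ : ℍ) :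
    HasSum (fun N : ℚ => C (N + quad (rep r j)) (rep r j) * e (N * τ)) (comp C j τ) :=
  (hC.hasSum_int_rep_iff j τ _).1 (hs j τ).hasSum

/-- The Fourier series with coefficients `C` is the combination of the theta functions
`θ_{r,j}` with the coefficients `∑_m C(m, v_j) e((m - β(v_j))τ)`. -/
theorem hasSum_decomposition (hr : 0 < r) (hC : IsCoeffFamily C) (hs : CompSummable C) (τ : ℍ)
    (z : Fin r → ℂ) :
    HasSum (fun p : ℚ × (Fin r → ℚ) => C p.1 p.2 * e ((p.1 : ℂ) * (τ : ℂ) + bilC p.2 z))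
      (∑ j, comp C j τ * latticeTheta (latticeD r) (rep r j) τ z) := by
  classical
  -- In the coordinates `(m - β(x), x)` every term is a term of some `h_j` times a term of the theta
  -- series of the class of `x`; each `x` in the dual lattice lies in exactly one class.
  let sh : ℚ × (Fin r → ℚ) ≃ ℚ × (Fin r → ℚ) :=
    { toFun := fun p => (p.1 + quad p.2, p.2)
      invFun := fun p => (p.1 - quad p.2, p.2)
      left_inv := fun p => by simp
      right_inv := fun p => by simp }
  rw [← sh.hasSum_iff]
  have h1 : ∀ j, HasSum (fun y : Fin r → ℚ => if y - rep r j ∈ latticeD r then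
      e ((τ : ℂ) * (quad y : ℂ) + bilC y z) else 0) (latticeTheta (latticeD r) (rep r j) τ z) := by
    intro j
    exact (hasSum_subtype_iff_indicator
      (s := {y : Fin r → ℚ | y - rep r j ∈ latticeD r})).1 (hasSum_latticeTheta hr j τ z)
  have h2 := hasSum_sum (s := Finset.univ) fun (j : Fin 4) _ =>
    hasSum_mul_complex (hC.hasSum_comp hs j τ) (h1 j)
  refine h2.congr_fun fun p => ?_
  simp only [Function.comp_apply, sh, Equiv.coe_fn_mk]
  by_cases hx : p.2 ∈ dual (latticeD r)
  · obtain ⟨j, hj⟩ := exists_sub_rep_mem hr hx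
    rw [Finset.sum_eq_single j, if_pos hj, hC.eq_rep hj, mul_assoc, ← e_add]
    · congr 2
      push_cast
      ring
    · intro i _ hi
      rw [if_neg fun h => hi (sub_rep_mem_unique hr h hj), mul_zero]
    · simp
  · rw [Finset.sum_eq_zero, not_imp_comm.1 (fun h => (hC.supp (p.1 + quad p.2) p.2 h).2) hx,
      zero_mul]
    intro j _
    rw [if_neg fun h => hx (mem_dual_of_sub_rep_mem hr h), mul_zero]

end IsCoeffFamily

theorem theta_decomposition (hr : 0 < r) {φ : ℍ → (Fin r → ℂ) → ℂ} {c : ℚ → (Fin r → ℚ) → ℂ}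
    {κ : ℤ} (hκ : Even κ) (hφ : φ ∈ jacobiForms κ (latticeD r))
    (hc : IsFourierExpansion (latticeD r) φ c) (τ : ℍ) (z : Fin r → ℂ) :
    φ τ z = ∑ j, comp c j τ * latticeTheta (latticeD r) (rep r j) τ z :=
  ((isFourierExpansion_iff hc.1).1 hc τ z).unique
    ((isCoeffFamily_of_mem hκ hφ hc).hasSum_decomposition hr (hc.compSummable hr) τ z)

end

noncomputable section

variable {r : ℕ} {C : ℚ → (Fin r → ℚ) → ℂ}

/-! ### From Jacobi forms to forms of half-integral weight -/

/-- `h₀ + h₂`. -/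
def compG (C : ℚ → (Fin r → ℚ) → ℂ) (τ : ℍ) : ℂ := comp C 0 τ + comp C 2 τ

/-- `h₀ - h₂`. -/
def compU (C : ℚ → (Fin r → ℚ) → ℂ) (τ : ℍ) : ℂ := comp C 0 τ - comp C 2 τ

/-- `h₁ + h₃`. -/
def compW (C : ℚ → (Fin r → ℚ) → ℂ) (τ : ℍ) : ℂ := comp C 1 τ + comp C 3 τ

theorem comp_add_one (C : ℚ → (Fin r → ℚ) → ℂ) (j : Fin 4) (τ : ℂ) :
    comp C j (τ + 1) = e (-(quad (rep r j) : ℂ)) * comp C j τ := by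
  rw [comp, comp, ← tsum_mul_left]
  refine tsum_congr fun m => ?_
  rw [mul_add, mul_one, e_add, e_sub (m : ℂ), e_int, e_neg]
  ring

/-- This matches the eigenvalue `e(-r/8)` of `W` under `T` with the one of a theta triple. It uses
`(2k + 1) + r = 2κ` and `i^κ = ±1` for even `κ`. -/
theorem e_neg_div_eight {k κ : ℕ} (hκ : 2 * κ = 2 * k + 1 + r) (hev : Even κ) :
    e (-((r / 8 : ℚ) : ℂ)) = Complex.I ^ κ * e (1 / 8) ^ (2 * k + 1) := by
  have h1 : e (1 / 8) ^ 2 = Complex.I := by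
    rw [← e_nat_mul, ← e_quarter]; congr 1; norm_num
  have h2 : e (((r / 8 : ℚ) : ℂ)) = e (1 / 8) ^ r := by
    rw [← e_nat_mul]; congr 1; push_cast; ring
  have h4 : (Complex.I ^ κ) ^ 2 = 1 := by
    rw [← pow_mul, mul_comm, pow_mul, Complex.I_sq, hev.neg_one_pow]
  have h3 : Complex.I ^ κ * e (1 / 8) ^ (2 * k + 1) * e (1 / 8) ^ r = 1 := by
    rw [mul_assoc, ← pow_add, ← hκ, pow_mul, h1, ← sq, h4]
  rw [e_neg, h2]
  exact inv_eq_of_mul_eq_one_left h3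

theorem I_pow_sq {κ : ℕ} (hev : Even κ) : (Complex.I ^ κ) ^ 2 = 1 := by
  rw [← pow_mul, mul_comm, pow_mul, Complex.I_sq, hev.neg_one_pow]

theorem compG_T (hr : 0 < r) (τ : ℍ) : compG C (ModularGroup.T • τ) = compU C τ := by
  rw [compG, compU, coe_T_smul, comp_add_one, comp_add_one, quad_rep_zero, quad_rep_two hr, e_neg,
    e_neg]
  push_cast
  rw [e_half]
  norm_num
  ring

theorem compU_T (hr : 0 < r) (τ : ℍ) : compU C (ModularGroup.T • τ) = compG C τ := by
  rw [compG, compU, coe_T_smul, comp_add_one, comp_add_one, quad_rep_zero, quad_rep_two hr, e_neg,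
    e_neg]
  push_cast
  rw [e_half]
  norm_num

theorem compW_T {k κ : ℕ} (hκ : 2 * κ = 2 * k + 1 + r) (hev : Even κ) (τ : ℍ) :
    compW C (ModularGroup.T • τ) = Complex.I ^ κ * e (1 / 8) ^ (2 * k + 1) * compW C τ := by
  rw [compW, compW, coe_T_smul, comp_add_one, comp_add_one, quad_rep_one, quad_rep_three,
    e_neg_div_eight hκ hev]
  ring

/-- `½((h₀ + h₂)∏ϑ₀₀ + (h₀ - h₂)∏ϑ₀₁ + (h₁ + h₃)∏ϑ₁₀)`. -/
def thetaCombination (g u W : ℍ → ℂ) (τ : ℍ) (z : Fin r → ℂ) : ℂ :=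
  (g τ * prod00 τ z + u τ * prod01 τ z + W τ * prod10 τ z) / 2

theorem IsCoeffFamily.comp_one_eq_three (hC : IsCoeffFamily C) (hs : CompSummable C) (hr : Odd r)
    (τ : ℍ) : comp C 1 τ = comp C 3 τ :=
  (hC.hasSum_comp hs 1 τ).unique
    ((hC.hasSum_comp hs 3 τ).congr_fun fun N => by rw [hC.rep_one_eq_three hr])

theorem IsCoeffFamily.sum_comp_mul (hC : IsCoeffFamily C) (hs : CompSummable C) (hr : Odd r)
    (τ : ℍ) (z : Fin r → ℂ) : ∑ j, comp C j τ * latticeTheta (latticeD r) (rep r j) τ z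
      = thetaCombination (compG C) (compU C) (compW C) τ z :=
  sum_mul_latticeTheta hr.pos (fun j => comp C j τ) (hC.comp_one_eq_three hs hr τ) τ z

theorem zpow_eq_rootS {k κ : ℕ} (hκ : 2 * κ = 2 * k + 1 + r) (τ : ℂ) :
    τ ^ (κ : ℤ) = Complex.I ^ κ * (rootS τ ^ (2 * k + 1) * rootS τ ^ r) := by
  rw [← pow_add, ← hκ, pow_mul, rootS_sq, zpow_natCast, ← mul_pow]
  congr 1
  rw [← mul_assoc, mul_neg, Complex.I_mul_I]
  ring

/-- The laws under `T` are read off the exponents. The law of `φ` under `S` is an identity between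
two combinations of the three theta products, and their linear independence in `z` allows the
coefficients to be compared. -/
theorem isThetaTriple_of_mem {k κ : ℕ} (hκ : 2 * κ = 2 * k + 1 + r) (hev : Even κ) (hr : Odd r)
    {φ : ℍ → (Fin r → ℂ) → ℂ} {c : ℚ → (Fin r → ℚ) → ℂ}
    (hφ : φ ∈ jacobiForms (κ : ℤ) (latticeD r)) (hc : IsFourierExpansion (latticeD r) φ c) :
    IsThetaTriple (2 * k + 1) (Complex.I ^ κ) (compG c) (compU c) (compW c) := by
  have hev' : Even (κ : ℤ) := by exact_mod_cast hev
  have hC := isCoeffFamily_of_mem hev' hφ hc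
  have hs := hc.compSummable hr.pos
  have hφeq : ∀ τ z, φ τ z = thetaCombination (compG c) (compU c) (compW c) τ z := fun τ z => by
    rw [theta_decomposition hr.pos hev' hφ hc, hC.sum_comp_mul hs hr]
  have key : ∀ τ : ℍ,
      compG c (ModularGroup.S • τ) = Complex.I ^ κ * rootS τ ^ (2 * k + 1) * compG c τ ∧
      compU c (ModularGroup.S • τ) = Complex.I ^ κ * rootS τ ^ (2 * k + 1) * compW c τ ∧
      compW c (ModularGroup.S • τ) = Complex.I ^ κ * rootS τ ^ (2 * k + 1) * compU c τ := by
    intro τ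
    have h0 : (τ : ℂ) ≠ 0 := τ.ne_zero
    have hR := rootS_ne_zero h0
    have hlin := coeff_eq_zero_of_prod_eq_zero hr.pos τ
      (a := compG c (ModularGroup.S • τ) - Complex.I ^ κ * rootS τ ^ (2 * k + 1) * compG c τ)
      (b := compW c (ModularGroup.S • τ) - Complex.I ^ κ * rootS τ ^ (2 * k + 1) * compU c τ)
      (c := compU c (ModularGroup.S • τ) - Complex.I ^ κ * rootS τ ^ (2 * k + 1) * compW c τ)
      fun z => by
        have h1 := hφ.1.modular ModularGroup.S τ z
        have e10 : ModularGroup.S 1 0 = 1 := rfl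
        have e11 : ModularGroup.S 1 1 = 0 := rfl
        rw [e10, e11] at h1
        simp only [Int.cast_one, Int.cast_zero, one_mul, add_zero] at h1
        rw [hφeq, hφeq, thetaCombination, thetaCombination, coe_S_smul, prod00_S τ.im_pos,
          prod01_S τ.im_pos, prod10_S τ.im_pos, zpow_neg, zpow_eq_rootS hκ, neg_mul, one_mul,
          neg_div, e_neg] at h1
        have hI : Complex.I ^ κ ≠ 0 := pow_ne_zero _ Complex.I_ne_zero
        have hE := e_ne_zero (quadC z / τ)
        field_simp at h1
        linear_combination h1
    exact ⟨sub_eq_zero.1 hlin.1, sub_eq_zero.1 hlin.2.2, sub_eq_zero.1 hlin.2.1⟩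
  exact ⟨compG_T hr.pos, compU_T hr.pos, compW_T hκ hev, fun τ => (key τ).1,
    fun τ => (key τ).2.1, fun τ => (key τ).2.2⟩

/-! ### Holomorphy and growth of the theta components -/

section Analytic

theorem hasSum_comp_real (hs : CompSummable C) (j : Fin 4) (τ : ℍ) :
    HasSum (fun m : ℤ => C (m : ℚ) (rep r j) * e (((m - quad (rep r j) : ℚ) : ℝ) * τ))
      (comp C j τ) := by
  refine (hs j τ).hasSum.congr_fun fun m => ?_
  push_cast
  rfl

theorem IsCoeffFamily.nonneg_real (hC : IsCoeffFamily C) (j : Fin 4) (m : ℤ)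
    (h : C (m : ℚ) (rep r j) ≠ 0) : 0 ≤ (((m - quad (rep r j) : ℚ)) : ℝ) := by
  exact_mod_cast hC.nonneg _ _ h

theorem IsCoeffFamily.mdifferentiable_comp (hC : IsCoeffFamily C) (hs : CompSummable C)
    (j : Fin 4) : MDiff (fun τ : ℍ => comp C j τ) :=
  mdifferentiable_of_hasSum (hC.nonneg_real j) (hasSum_comp_real hs j)

theorem IsCoeffFamily.isBoundedAtImInfty_comp (hC : IsCoeffFamily C) (hs : CompSummable C)
    (j : Fin 4) : IsBoundedAtImInfty (fun τ : ℍ => comp C j τ) :=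
  isBoundedAtImInfty_of_hasSum (hC.nonneg_real j) (hasSum_comp_real hs j)

theorem isZeroAtImInfty_comp (hC : ∀ m x, C m x ≠ 0 → 0 < m - quad x)
    (hs : CompSummable C) (j : Fin 4) : IsZeroAtImInfty (fun τ : ℍ => comp C j τ) :=
  isZeroAtImInfty_of_hasSum (fun m h => by exact_mod_cast hC _ _ h) (hasSum_comp_real hs j)

end Analytic

/-- The `n`-th coefficient of `∑ⱼ hⱼ(8τ)`. -/
def evenCoeff (C : ℚ → (Fin r → ℚ) → ℂ) (n : ℕ) : ℂ :=
  ∑ j, C (n / 8 + quad (rep r j)) (rep r j)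

theorem exists_eight_mul_quad_rep (hr : 0 < r) (j : Fin 4) : ∃ a : ℤ, 8 * quad (rep r j) = a := by
  fin_cases j
  · exact ⟨0, by simp [quad_rep_zero]⟩
  · exact ⟨r, by rw [Fin.mk_one, quad_rep_one]; push_cast; ring⟩
  · exact ⟨4, by change 8 * quad (rep r 2) = _; rw [quad_rep_two hr]; norm_num⟩
  · exact ⟨r, by change 8 * quad (rep r 3) = _; rw [quad_rep_three]; push_cast; ring⟩

/-- The exponents with nonzero coefficient are nonnegative and lie in `(1/8)ℤ`; values of `n` in the
wrong residue class give vanishing coefficients. -/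
theorem IsCoeffFamily.hasSum_nat_iff (hC : IsCoeffFamily C) (hr : 0 < r)
    (j : Fin 4) (τ : ℂ) (s : ℂ) :
    HasSum (fun n : ℕ => C (n / 8 + quad (rep r j)) (rep r j) * e (n / 8 * τ)) s ↔
      HasSum (fun m : ℤ => C (m : ℚ) (rep r j) * e (((m : ℂ) - (quad (rep r j) : ℂ)) * τ)) s := by
  rw [hC.hasSum_int_rep_iff]
  have hinj : Function.Injective fun n : ℕ => (n / 8 : ℚ) := fun a b hab => by
    have : (a : ℚ) = b := by simpa using hab
    exact_mod_cast this
  rw [← hinj.hasSum_iff]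
  · simp [Function.comp_def]
  · intro N hN
    by_contra h0
    have h2 := left_ne_zero_of_mul h0
    obtain ⟨⟨a, ha⟩, -⟩ := hC.supp _ _ h2
    have h3 := hC.nonneg _ _ h2
    obtain ⟨b, hb⟩ := exists_eight_mul_quad_rep hr j
    have h4 : 8 * N = ((8 * a - b : ℤ) : ℚ) := by push_cast; linarith
    have h5 : 0 ≤ 8 * a - b := by
      have : (0 : ℚ) ≤ ((8 * a - b : ℤ) : ℚ) := by rw [← h4]; linarith
      exact_mod_cast this
    refine hN ⟨(8 * a - b).toNat, ?_⟩
    have h6 : (((8 * a - b).toNat : ℕ) : ℚ) = ((8 * a - b : ℤ) : ℚ) := by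
      rw [← Int.cast_natCast, Int.toNat_of_nonneg h5]
    simp only [h6, ← h4]
    ring

theorem IsCoeffFamily.hasSum_comp_eight (hC : IsCoeffFamily C) (hs : CompSummable C) (hr : 0 < r)
    (j : Fin 4) (τ : ℍ) :
    HasSum (fun n : ℕ => C (n / 8 + quad (rep r j)) (rep r j) * e (n * τ))
      (comp C j (8 * τ)) := by
  have h := (hC.hasSum_nat_iff hr j (scale8 τ) (comp C j (scale8 τ))).2 (hs j (scale8 τ)).hasSum
  rw [coe_scale8] at h
  refine h.congr_fun fun n => ?_
  congr 2
  ring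

theorem IsCoeffFamily.hasSum_evenCoeff (hC : IsCoeffFamily C) (hs : CompSummable C) (hr : 0 < r)
    (τ : ℍ) :
    HasSum (fun n : ℕ => evenCoeff C n * e (n * τ)) (∑ j, comp C j (8 * τ)) := by
  refine (hasSum_sum fun j _ => hC.hasSum_comp_eight hs hr j τ).congr_fun fun n => ?_
  rw [evenCoeff, Finset.sum_mul]

/-- Integrality of `n/8 + β(v_j)` with `8β(v_j) = 0, r, 4, r` gives the three residue classes. -/
theorem IsCoeffFamily.evenCoeff_ne_zero (hC : IsCoeffFamily C) (hr : 0 < r) {n : ℕ}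
    (h : evenCoeff C n ≠ 0) : (n : ℤ) ≡ 0 [ZMOD 8] ∨ (n : ℤ) ≡ 4 [ZMOD 8] ∨
        (n : ℤ) ≡ -(r : ℤ) [ZMOD 8] := by
  obtain ⟨j, -, hj⟩ := Finset.exists_ne_zero_of_sum_ne_zero h
  obtain ⟨⟨a, ha⟩, -⟩ := hC.supp _ _ hj
  simp only [Int.ModEq]
  fin_cases j
  · rw [Fin.zero_eta, quad_rep_zero] at ha
    have : (n : ℤ) = 8 * a := by
      have : (n : ℚ) = 8 * a := by linarith
      exact_mod_cast this
    omega
  · rw [Fin.mk_one, quad_rep_one] at ha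
    have : (n : ℤ) = 8 * a - r := by
      have : (n : ℚ) = 8 * a - r := by linarith
      exact_mod_cast this
    omega
  · change _ + quad (rep r 2) = _ at ha
    rw [quad_rep_two hr] at ha
    have : (n : ℤ) = 8 * a - 4 := by
      have : (n : ℚ) = 8 * a - 4 := by linarith
      exact_mod_cast this
    omega
  · change _ + quad (rep r 3) = _ at ha
    rw [quad_rep_three] at ha
    have : (n : ℤ) = 8 * a - r := by
      have : (n : ℚ) = 8 * a - r := by linarith
      exact_mod_cast this
    omega

theorem evenMap_eq (φ : ℍ → (Fin r → ℂ) → ℂ) :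
    evenMap r φ = fun τ : ℍ => ∑ j, comp (fourierCoeff (latticeD r) φ) j (8 * (τ : ℂ)) := rfl

theorem sum_comp_eq_liftForm :
    (fun τ : ℍ => ∑ j, comp C j (8 * (τ : ℂ))) = liftForm (compG C) (compW C) := by
  funext τ
  rw [Fin.sum_univ_four, liftForm, compG, compW, coe_scale8]
  ring

theorem evenMap_mem {k κ : ℕ} (hκ : 2 * κ = 2 * k + 1 + r) (hev : Even κ) (hr : Odd r)
    {φ : ℍ → (Fin r → ℂ) → ℂ} (hφ : φ ∈ jacobiForms (κ : ℤ) (latticeD r)) :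
    evenMap r φ ∈ plusForms k r := by
  have hev' : Even (κ : ℤ) := by exact_mod_cast hev
  obtain ⟨h, c, hc, hc'⟩ := id hφ
  have hC := isCoeffFamily_of_mem hev' hφ hc
  have hs := hc.compSummable hr.pos
  have ht := isThetaTriple_of_mem hκ hev hr hφ hc
  rw [evenMap_eq, hc.fourierCoeff_eq]
  refine ⟨?_, evenCoeff c, fun τ => hC.hasSum_evenCoeff hs hr.pos τ,
    fun n hn => hC.evenCoeff_ne_zero hr.pos hn⟩
  rw [sum_comp_eq_liftForm]
  have hd := hC.mdifferentiable_comp hs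
  have hb := hC.isBoundedAtImInfty_comp hs
  exact ht.isHalfIntegralForm (I_pow_sq hev) ((hd 0).add (hd 2)) ((hd 1).add (hd 3))
    ((hb 0).add (hb 2)) ((hb 0).sub (hb 2)) ((hb 1).add (hb 3))

theorem evenMap_mem_cusp {k κ : ℕ} (hκ : 2 * κ = 2 * k + 1 + r) (hev : Even κ) (hr : Odd r)
    {φ : ℍ → (Fin r → ℂ) → ℂ} (hφ : φ ∈ jacobiCuspForms (κ : ℤ) (latticeD r)) :
    evenMap r φ ∈ plusCuspForms k r := by
  obtain ⟨h, c, hc, hc'⟩ := id hφ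
  have hφ' : φ ∈ jacobiForms (κ : ℤ) (latticeD r) :=
    ⟨h, c, hc, fun m x hmx => (hc' m x hmx).le⟩
  have h1 := evenMap_mem hκ hev hr hφ'
  refine ⟨h1, h1.1, ?_⟩
  have hs := hc.compSummable hr.pos
  have ht := isThetaTriple_of_mem hκ hev hr hφ' hc
  rw [evenMap_eq, hc.fourierCoeff_eq, sum_comp_eq_liftForm]
  have hb := isZeroAtImInfty_comp hc' hs
  have hU : IsZeroAtImInfty (compU c) := by
    have := Tendsto.sub (hb 0) (hb 2)
    rwa [sub_zero] at this
  have := ht.slash_isZeroAtImInfty (I_pow_sq hev)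
    ((hb 0).add (hb 2)) hU ((hb 1).add (hb 3))
  exact_mod_cast this

end

noncomputable section

/-! ### From forms of half-integral weight to Jacobi forms -/

/-- The modular transformation law follows from the laws under `S` and `T`. -/
theorem modular_of_S_T {n : ℕ} {κ : ℤ} {φ : ℍ → (Fin n → ℂ) → ℂ}
    (hS : ∀ (τ : ℍ) (z : Fin n → ℂ), φ (ModularGroup.S • τ) (fun i => z i / (τ : ℂ))
      * e (-quadC z / τ) * (τ : ℂ) ^ (-κ) = φ τ z)
    (hT : ∀ (τ : ℍ) (z : Fin n → ℂ), φ (ModularGroup.T • τ) z = φ τ z)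
    (A : SL(2, ℤ)) : ∀ (τ : ℍ) (z : Fin n → ℂ),
    φ (A • τ) (fun i => z i / ((A 1 0 : ℂ) * (τ : ℂ) + (A 1 1 : ℂ)))
      * e (-(A 1 0 : ℂ) * quadC z / ((A 1 0 : ℂ) * (τ : ℂ) + (A 1 1 : ℂ)))
      * ((A 1 0 : ℂ) * (τ : ℂ) + (A 1 1 : ℂ)) ^ (-κ) = φ τ z := by
  induction A using SL2Z_induction with
  | one => intro τ z; simp
  | hS γ ih =>
    intro τ z
    obtain ⟨-, -, h10, h11⟩ := mul_S_apply γ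
    have h0 : (τ : ℂ) ≠ 0 := τ.ne_zero
    have hj := SL_denom_ne_zero (γ * ModularGroup.S) τ
    rw [h10, h11] at hj ⊢
    push_cast at hj ⊢
    rw [← hS τ z, ← ih (ModularGroup.S • τ) (fun i => z i / τ), ← mul_smul, coe_S_smul]
    have hq : quadC (fun i => z i / (τ : ℂ)) = quadC z / (τ : ℂ) ^ 2 := by
      simp only [quadC, Finset.sum_div]
      exact Finset.sum_congr rfl fun i _ => by field_simp
    set c : ℂ := (γ 1 0 : ℂ)
    set d : ℂ := (γ 1 1 : ℂ)
    have hjS : c * (-1 / (τ : ℂ)) + d = (d * τ + -c) / τ := by field_simp; ring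
    rw [hjS, hq]
    have hz : (fun i => z i / (τ : ℂ) / ((d * τ + -c) / τ)) = fun i => z i / (d * τ + -c) :=
      funext fun i => by field_simp
    rw [hz, div_zpow, show ∀ a b x y : ℂ, a * b * x * y * (τ : ℂ) ^ (-κ)
      = a * (b * y) * (x * (τ : ℂ) ^ (-κ)) from fun a b x y => by ring, ← e_add,
      div_mul_cancel₀ _ (zpow_ne_zero _ h0)]
    congr 3
    field_simp
    ring
  | hT γ ih =>
    intro τ z
    obtain ⟨-, -, h10, h11⟩ := mul_T_apply γ
    have h1 := ih (ModularGroup.T • τ) z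
    rw [hT, ← mul_smul, coe_T_smul] at h1
    rw [h10, h11, ← h1]
    push_cast
    have h2 : (γ 1 0 : ℂ) * τ + (γ 1 0 + γ 1 1) = γ 1 0 * (τ + 1) + γ 1 1 := by ring
    rw [h2]

/-! ### The coefficient family attached to a form in the plus space -/

variable {r : ℕ}

open Classical in
/-- `1` on integral vectors and `1/2` on the other ones. -/
def classWeight (x : Fin r → ℚ) : ℂ := if ∀ i, ∃ a : ℤ, x i = a then 1 else 1 / 2

open Classical in
/-- The Fourier coefficients of the Jacobi form that corresponds to `∑ c(n) qⁿ`. -/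
def invCoeff (c : ℕ → ℂ) (m : ℚ) (x : Fin r → ℚ) : ℂ :=
  if (∃ a : ℤ, m = a) ∧ x ∈ dual (latticeD r) ∧ 0 ≤ m - quad x then
    -- Under the condition above, `8(m - β(x))` is a nonnegative integer, so the floor only changes
    -- its type.
    classWeight x * c ⌊8 * (m - quad x)⌋₊ else 0

theorem cond_of_invCoeff_ne_zero {c : ℕ → ℂ} {m : ℚ} {x : Fin r → ℚ} (h : invCoeff c m x ≠ 0) :
    (∃ a : ℤ, m = a) ∧ x ∈ dual (latticeD r) ∧ 0 ≤ m - quad x :=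
  not_imp_comm.1 (fun hn => if_neg hn) h

open Classical in
theorem classWeight_sub {x l : Fin r → ℚ} (hl : l ∈ latticeD r) :
    classWeight (x - l) = classWeight x := by
  obtain ⟨b, hb, -⟩ := hl
  have : (∀ i, ∃ a : ℤ, (x - l) i = a) ↔ ∀ i, ∃ a : ℤ, x i = a := by
    refine forall_congr' fun i => ⟨fun ⟨a, ha⟩ => ⟨a + b i, ?_⟩, fun ⟨a, ha⟩ => ⟨a - b i, ?_⟩⟩
    · rw [Pi.sub_apply, hb] at ha; push_cast; linarith
    · rw [Pi.sub_apply, hb, ha]; push_cast; ring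
  exact if_congr this rfl rfl

open Classical in
theorem classWeight_neg (x : Fin r → ℚ) : classWeight (-x) = classWeight x := by
  have : (∀ i, ∃ a : ℤ, (-x) i = a) ↔ ∀ i, ∃ a : ℤ, x i = a := by
    refine forall_congr' fun i => ⟨fun ⟨a, ha⟩ => ⟨-a, ?_⟩, fun ⟨a, ha⟩ => ⟨-a, ?_⟩⟩
    · rw [Pi.neg_apply] at ha; push_cast; linarith
    · rw [Pi.neg_apply, ha]; push_cast; ring
  exact if_congr this rfl rfl

open Classical in
theorem isCoeffFamily_invCoeff (c : ℕ → ℂ) : IsCoeffFamily (invCoeff (r := r) c) where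
  supp m x h :=
    have h1 := cond_of_invCoeff_ne_zero h
    ⟨h1.1, h1.2.1⟩
  nonneg m x h := (cond_of_invCoeff_ne_zero h).2.2
  even m x := by
    rw [invCoeff, invCoeff, quad_neg, classWeight_neg]
    exact if_congr (by rw [neg_mem_iff]) rfl rfl
  trans l hl m x := by
    have h1 : m - bil x l + quad l - quad (x - l) = m - quad x := by rw [quad_sub]; ring
    have h2 : x - l ∈ dual (latticeD r) ↔ x ∈ dual (latticeD r) :=
      ⟨fun h => by simpa using add_mem h (mem_dual_of_mem hl),
        fun h => sub_mem h (mem_dual_of_mem hl)⟩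
    have h3 : ((∃ a : ℤ, m - bil x l + quad l = a) ∧ x - l ∈ dual (latticeD r) ∧
        0 ≤ m - bil x l + quad l - quad (x - l)) ↔
        ((∃ a : ℤ, m = a) ∧ x ∈ dual (latticeD r) ∧ 0 ≤ m - quad x) := by
      rw [h1, h2]
      refine and_congr_left fun ⟨hx, _⟩ => ?_
      obtain ⟨b, hb⟩ := exists_bil_eq_int hx hl
      obtain ⟨d, hd⟩ := exists_quad_eq_int hl
      rw [hb, hd]
      constructor
      · rintro ⟨a, ha⟩
        exact ⟨a + b - d, by push_cast; linarith⟩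
      · rintro ⟨a, rfl⟩
        exact ⟨a - b + d, by push_cast; ring⟩
    rw [invCoeff, invCoeff, classWeight_sub hl]
    exact if_congr h3 (by rw [h1]) rfl

open Classical in
theorem invCoeff_rep (hr : 0 < r) (c : ℕ → ℂ) (n : ℕ) (j : Fin 4) :
    invCoeff c (n / 8 + quad (rep r j)) (rep r j) =
      if ∃ a : ℤ, (n / 8 + quad (rep r j) : ℚ) = a then classWeight (rep r j) * c n else 0 := by
  have h1 : (n / 8 + quad (rep r j) : ℚ) - quad (rep r j) = n / 8 := by ring
  have h2 : (8 * (n / 8) : ℚ) = n := by ring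
  rw [invCoeff, h1, h2, Nat.floor_natCast]
  have h3 : (0 : ℚ) ≤ n / 8 := by positivity
  simp [rep_mem_dual hr j, h3]

theorem classWeight_rep (hr : 0 < r) (j : Fin 4) :
    classWeight (rep r j) = ![1, 1 / 2, 1, 1 / 2] j := by
  obtain ⟨w, hw, -⟩ := exists_rep_eq hr j
  have h1 : (∀ i, ∃ a : ℤ, rep r j i = a) ↔ ∃ a : ℤ, repShift j = a := by
    rw [hw]
    constructor
    · intro h
      obtain ⟨a, ha⟩ := h ⟨0, hr⟩
      exact ⟨a - w ⟨0, hr⟩, by push_cast; linarith⟩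
    · rintro ⟨a, ha⟩ i
      exact ⟨w i + a, by rw [ha]; push_cast; rfl⟩
  have h2 : ¬ ∃ a : ℤ, (1 / 2 : ℚ) = a := by
    rintro ⟨a, ha⟩
    have : (1 : ℚ) = 2 * a := by linarith
    norm_cast at this
    omega
  rw [classWeight]
  fin_cases j
  · exact if_pos (h1.2 ⟨0, by simp [repShift]⟩)
  · exact if_neg fun h => h2 (h1.1 h)
  · exact if_pos (h1.2 ⟨0, by simp [repShift]⟩)
  · exact if_neg fun h => h2 (h1.1 h)

/-- The residues `0` and `4` are met only by `v₀` and `v₂` respectively, since `r` is odd. The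
residue `-r` is met by both `v₁` and `v₃`, which explains the weight `1/2` on nonintegral classes.
-/
theorem evenCoeff_invCoeff (hr : Odd r) {c : ℕ → ℂ} (hc : ∀ n : ℕ, c n ≠ 0 →
      (n : ℤ) ≡ 0 [ZMOD 8] ∨ (n : ℤ) ≡ 4 [ZMOD 8] ∨ (n : ℤ) ≡ -(r : ℤ) [ZMOD 8]) (n : ℕ) :
    evenCoeff (invCoeff (r := r) c) n = c n := by
  have hiff : ∀ (q : ℚ) (d : ℤ), 8 * q = d →
      ((∃ a : ℤ, (n / 8 + q : ℚ) = a) ↔ (n : ℤ) % 8 = -d % 8) := by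
    intro q d hd
    constructor
    · rintro ⟨a, ha⟩
      have : (n : ℤ) = 8 * a - d := by
        have : (n : ℚ) = 8 * a - d := by linarith
        exact_mod_cast this
      omega
    · intro h
      refine ⟨(n + d) / 8, ?_⟩
      have h1 : (8 : ℤ) ∣ n + d := by omega
      have h2 : ((8 * ((n + d) / 8) : ℤ) : ℚ) = ((n + d : ℤ) : ℚ) := by
        rw [Int.mul_ediv_cancel' h1]
      push_cast at h2
      linarith
  have i0 := hiff (quad (rep r 0)) 0 (by simp [quad_rep_zero])
  have i1 := hiff (quad (rep r 1)) r (by rw [quad_rep_one]; push_cast; ring)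
  have i2 := hiff (quad (rep r 2)) 4 (by rw [quad_rep_two hr.pos]; norm_num)
  have i3 := hiff (quad (rep r 3)) r (by rw [quad_rep_three]; push_cast; ring)
  rw [evenCoeff]
  simp only [invCoeff_rep hr.pos, Fin.sum_univ_four, i0, i1, i2, i3, classWeight_rep hr.pos]
  obtain ⟨s, hs⟩ := hr
  by_cases h0 : c n = 0
  · simp [h0]
  have h4 := hc n h0
  simp only [Int.ModEq] at h4
  rcases h4 with h4 | h4 | h4
  · rw [if_pos (by omega), if_neg (by omega), if_neg (by omega), if_neg (by omega)]
    simp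
  · rw [if_neg (by omega), if_neg (by omega), if_pos (by omega), if_neg (by omega)]
    simp
  · rw [if_neg (by omega), if_pos (by omega), if_neg (by omega), if_pos (by omega)]
    simp
    ring

theorem compSummable_invCoeff (hr : 0 < r) {c : ℕ → ℂ}
    (hc : ∀ τ : ℍ, Summable fun n : ℕ => c n * e ((n : ℂ) * (τ : ℂ))) :
    CompSummable (invCoeff (r := r) c) := by
  intro j τ
  obtain ⟨σ, hσ⟩ := exists_scale8_eq τ
  have h1 : Summable fun n : ℕ => invCoeff c (n / 8 + quad (rep r j)) (rep r j)
      * e (n / 8 * (τ : ℂ)) := by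
    refine Summable.of_norm_bounded (hc σ).norm fun n => ?_
    have h2 : e (n / 8 * (τ : ℂ)) = e (n * σ) := by
      rw [← hσ, coe_scale8]; congr 1; ring
    rw [h2, norm_mul, norm_mul]
    refine mul_le_mul_of_nonneg_right ?_ (norm_nonneg _)
    rw [invCoeff_rep hr]
    split_ifs
    · rw [norm_mul]
      refine mul_le_of_le_one_left (norm_nonneg _) ?_
      rw [classWeight]
      split_ifs <;> norm_num
    · simp
  exact (((isCoeffFamily_invCoeff c).hasSum_nat_iff hr j τ _).1 h1.hasSum).summable

theorem IsCoeffFamily.isFourierExpansion (hr : Odd r) {C : ℚ → (Fin r → ℚ) → ℂ}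
    (hC : IsCoeffFamily C) (hs : CompSummable C) :
    IsFourierExpansion (latticeD r) (thetaCombination (compG C) (compU C) (compW C)) C := by
  rw [isFourierExpansion_iff hC.supp]
  intro τ z
  rw [← hC.sum_comp_mul hs hr]
  exact hC.hasSum_decomposition hr.pos hs τ z

/-- A Fourier series whose coefficients are invariant under translations satisfies the elliptic
transformation law. -/
theorem IsFourierExpansion.elliptic {φ : ℍ → (Fin r → ℂ) → ℂ} {c : ℚ → (Fin r → ℚ) → ℂ}
    (hc : IsFourierExpansion (latticeD r) φ c)
    (htr : ∀ l ∈ latticeD r, ∀ m x, c (m - bil x l + quad l) (x - l) = c m x)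
    {l m : Fin r → ℚ} (hl : l ∈ latticeD r) (hm : m ∈ latticeD r) (τ : ℍ) (z : Fin r → ℂ) :
    φ τ (fun i => z i + (l i : ℂ) * (τ : ℂ) + (m i : ℂ))
      * e ((τ : ℂ) * (quad l : ℂ) + bilC l z) = φ τ z := by
  have h := (isFourierExpansion_iff hc.1).1 hc
  have h1 := (h τ (fun i => z i + (l i : ℂ) * (τ : ℂ) + (m i : ℂ))).mul_right
    (e ((τ : ℂ) * (quad l : ℂ) + bilC l z))
  rw [← (heisenberg l).hasSum_iff] at h1
  refine h1.unique ((h τ z).congr_fun fun p => ?_)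
  simp only [Function.comp_apply, heisenberg, Equiv.coe_fn_mk]
  rw [htr l hl]
  by_cases h0 : c p.1 p.2 = 0
  · simp [h0]
  have hx := (hc.1 _ _ h0).2
  obtain ⟨a, ha⟩ := exists_bil_eq_int (sub_mem hx (mem_dual_of_mem hl)) hm
  rw [mul_assoc, ← e_add, bilC_translate, ha]
  congr 1
  have h5 : bil (p.2 - l) l = bil p.2 l - 2 * quad l := by
    rw [sub_eq_add_neg, bil_add_left, bil_neg_left, quad]; ring
  have h7 : bilC (p.2 - l) z = bilC p.2 z - bilC l z := by
    rw [sub_eq_add_neg, bilC_add, bilC_neg, ← sub_eq_add_neg]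
  rw [h5, h7]
  refine e_congr_int a ?_
  push_cast
  ring

theorem differentiableOn_thetaCombination {g u W : ℍ → ℂ} (hg : MDiff g) (hu : MDiff u)
    (hW : MDiff W) :
    DifferentiableOn ℂ (fun p : ℂ × (Fin r → ℂ) => thetaCombination g u W (ofComplex p.1) p.2)
      {p | 0 < p.1.im} := by
  rw [UpperHalfPlane.mdifferentiable_iff] at hg hu hW
  have hopen : IsOpen {τ : ℂ | 0 < τ.im} := isOpen_lt continuous_const Complex.continuous_im
  intro p hp
  have hp' : 0 < p.1.im := hp
  refine DifferentiableAt.differentiableWithinAt ?_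
  have hcomp : ∀ {f : ℍ → ℂ}, DifferentiableOn ℂ (f ∘ ofComplex) {z | 0 < z.im} →
      DifferentiableAt ℂ (fun p : ℂ × (Fin r → ℂ) => f (ofComplex p.1)) p := fun hf =>
    DifferentiableAt.comp (g := fun τ : ℂ => (_ : ℍ → ℂ) (ofComplex τ)) p
      (hf.differentiableAt (hopen.mem_nhds hp')) differentiableAt_fst
  have hz : ∀ i, DifferentiableAt ℂ (fun p : ℂ × (Fin r → ℂ) => p.2 i) p := fun i => by fun_prop
  have hprod : ∀ {F : Fin r → ℂ × (Fin r → ℂ) → ℂ}, (∀ i, DifferentiableAt ℂ (F i) p) →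
      DifferentiableAt ℂ (fun p => ∏ i, F i p) p := fun hF =>
    (HasFDerivAt.finsetProd fun i _ => (hF i).hasFDerivAt).differentiableAt
  have h00 : DifferentiableAt ℂ (fun p : ℂ × (Fin r → ℂ) => prod00 p.1 p.2) p :=
    hprod fun i => DifferentiableAt.th00 differentiableAt_fst (hz i) hp'
  have h01 : DifferentiableAt ℂ (fun p : ℂ × (Fin r → ℂ) => prod01 p.1 p.2) p :=
    hprod fun i => DifferentiableAt.th01 differentiableAt_fst (hz i) hp'
  have h10 : DifferentiableAt ℂ (fun p : ℂ × (Fin r → ℂ) => prod10 p.1 p.2) p :=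
    hprod fun i => DifferentiableAt.th10 differentiableAt_fst (hz i) hp'
  have key := ((((hcomp hg).mul h00).add ((hcomp hu).mul h01)).add ((hcomp hW).mul h10)).mul_const
    ((2 : ℂ)⁻¹)
  refine key.congr_of_eventuallyEq ?_
  have : ∀ᶠ q : ℂ × (Fin r → ℂ) in 𝓝 p, 0 < q.1.im :=
    (isOpen_lt continuous_const (Complex.continuous_im.comp continuous_fst)).mem_nhds hp'
  filter_upwards [this] with q hq
  simp only [thetaCombination, Pi.add_apply, Pi.mul_apply]
  rw [ofComplex_apply_of_im_pos hq]
  rfl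

/-- This is the converse of `isThetaTriple_of_mem`. The factors of the triple and of the theta
products multiply to the factor of weight `κ` under `S` and cancel under `T`. -/
theorem thetaCombination_mem {k κ : ℕ} (hκ : 2 * κ = 2 * k + 1 + r) (hev : Even κ) (hr : Odd r)
    {C : ℚ → (Fin r → ℚ) → ℂ} (hC : IsCoeffFamily C) (hs : CompSummable C)
    (h : IsThetaTriple (2 * k + 1) (Complex.I ^ κ) (compG C) (compU C) (compW C)) :
    IsJacobiInvariant (κ : ℤ) (latticeD r)
      (thetaCombination (compG C) (compU C) (compW C)) := by
  have hd := hC.mdifferentiable_comp hs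
  refine ⟨differentiableOn_thetaCombination ((hd 0).add (hd 2)) ((hd 0).sub (hd 2))
    ((hd 1).add (hd 3)), modular_of_S_T (fun τ z => ?_) (fun τ z => ?_), fun l hl m hm τ z =>
      (hC.isFourierExpansion hr hs).elliptic hC.trans hl hm τ z⟩
  · have h0 : (τ : ℂ) ≠ 0 := τ.ne_zero
    have hR := rootS_ne_zero h0
    have hI : Complex.I ^ κ ≠ 0 := pow_ne_zero _ Complex.I_ne_zero
    have hE := e_ne_zero (quadC z / τ)
    rw [thetaCombination, thetaCombination, coe_S_smul, prod00_S τ.im_pos,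
      prod01_S τ.im_pos, prod10_S τ.im_pos, zpow_neg, zpow_eq_rootS hκ, neg_div, e_neg, h.g_S,
      h.u_S, h.W_S]
    field_simp
    ring
  · have hξ : Complex.I ^ κ * e (1 / 8) ^ (2 * k + 1) * e (1 / 8) ^ r = 1 := by
      rw [← e_neg_div_eight hκ hev, ← e_nat_mul, ← e_add]
      convert e_zero using 2
      push_cast
      ring
    rw [thetaCombination, thetaCombination, coe_T_smul, prod00_T τ.im_pos, prod01_T τ.im_pos,
      prod10_T τ.im_pos, h.g_T, h.u_T, h.W_T]
    linear_combination (compW C τ * prod10 τ z / 2) * hξ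

end

noncomputable section

variable {r : ℕ}

/-! ### The isomorphism -/

theorem comp_add {c d : ℚ → (Fin r → ℚ) → ℂ} (hc : CompSummable c) (hd : CompSummable d)
    (j : Fin 4) (τ : ℍ) : comp (c + d) j τ = comp c j τ + comp d j τ := by
  rw [comp, comp, comp, ← (hc j τ).tsum_add (hd j τ)]
  exact tsum_congr fun m => by rw [Pi.add_apply, Pi.add_apply, add_mul]

theorem comp_smul (a : ℂ) (c : ℚ → (Fin r → ℚ) → ℂ) (j : Fin 4) (τ : ℂ) :
    comp (a • c) j τ = a * comp c j τ := by
  rw [comp, comp, ← tsum_mul_left]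
  exact tsum_congr fun m => by rw [Pi.smul_apply, Pi.smul_apply, smul_eq_mul, mul_assoc]

/-- `φ ↦ ∑ⱼ hⱼ(8τ)` as a linear map. -/
def evenLinearMap (hr : 0 < r) (κ : ℤ) : jacobiForms κ (latticeD r) →ₗ[ℂ] (ℍ → ℂ) where
  toFun φ := evenMap r φ
  map_add' := by
    rintro ⟨φ, _, c, hc, _⟩ ⟨ψ, _, d, hd, _⟩
    funext τ
    change evenMap r (φ + ψ) τ = evenMap r φ τ + evenMap r ψ τ
    simp only [evenMap_eq, hc.fourierCoeff_eq, hd.fourierCoeff_eq, (hc.add hd).fourierCoeff_eq,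
      ← coe_scale8, comp_add (hc.compSummable hr) (hd.compSummable hr), Finset.sum_add_distrib]
  map_smul' := by
    rintro a ⟨φ, _, c, hc, _⟩
    funext τ
    change evenMap r (a • φ) τ = a * evenMap r φ τ
    simp only [evenMap_eq, hc.fourierCoeff_eq, (hc.smul a).fourierCoeff_eq, comp_smul,
      Finset.mul_sum]

section

variable {k κ : ℕ}

/-- The vanishing of `g + W` at `τ` and at `T⁴τ` forces `W = 0` and `g = 0`, because `T⁴` negates
`W` only; then `u = 0` by applying `T` to `g`. -/
theorem eq_zero_of_evenMap_eq_zero (hκ : 2 * κ = 2 * k + 1 + r) (hev : Even κ) (hr : Odd r)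
    {φ : ℍ → (Fin r → ℂ) → ℂ} (hφ : φ ∈ jacobiForms (κ : ℤ) (latticeD r))
    (h0 : evenMap r φ = 0) : φ = 0 := by
  have hev' : Even (κ : ℤ) := by exact_mod_cast hev
  obtain ⟨h, c, hc, hc'⟩ := id hφ
  have hC := isCoeffFamily_of_mem hev' hφ hc
  have hs := hc.compSummable hr.pos
  rw [evenMap_eq, hc.fourierCoeff_eq, sum_comp_eq_liftForm] at h0
  have h1 : ∀ τ, compG c τ + compW c τ = 0 := fun τ => by
    obtain ⟨σ, rfl⟩ := exists_scale8_eq τ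
    exact congrFun h0 σ
  have hW : ∀ τ, compW c τ = 0 := fun τ => by
    have h2 := h1 (ModularGroup.T • ModularGroup.T • ModularGroup.T • ModularGroup.T • τ)
    rw [compG_T hr.pos, compU_T hr.pos, compG_T hr.pos, compU_T hr.pos, compW_T hκ hev,
      compW_T hκ hev, compW_T hκ hev, compW_T hκ hev] at h2
    have h3 := twist_pow_four (I_pow_sq hev) k
    linear_combination (h1 τ - h2 + compW c τ * h3) / 2
  have hG : ∀ τ, compG c τ = 0 := fun τ => by simpa [hW τ] using h1 τ
  have hU : ∀ τ, compU c τ = 0 := fun τ => by rw [← compG_T hr.pos]; exact hG _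
  funext τ z
  rw [theta_decomposition hr.pos hev' hφ hc, hC.sum_comp_mul hs hr, thetaCombination, hW, hG, hU]
  simp

/-- The laws under `T` hold for any coefficient family. The half-integral law of `f` supplies those
under `S`, so the theta combination built from `c` is a Jacobi form. -/
theorem exists_evenMap_eq (hκ : 2 * κ = 2 * k + 1 + r) (hev : Even κ) (hr : Odd r)
    {f : ℍ → ℂ} (hf : IsHalfIntegralForm k 8 f) {c : ℕ → ℂ}
    (hc : ∀ τ : ℍ, HasSum (fun n : ℕ => c n * e ((n : ℂ) * (τ : ℂ))) (f τ))
    (hc' : ∀ n : ℕ, c n ≠ 0 → (n : ℤ) ≡ 0 [ZMOD 8] ∨ (n : ℤ) ≡ 4 [ZMOD 8] ∨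
        (n : ℤ) ≡ -(r : ℤ) [ZMOD 8]) :
    ∃ φ, IsJacobiInvariant (κ : ℤ) (latticeD r) φ ∧
      IsFourierExpansion (latticeD r) φ (invCoeff c) ∧ evenMap r φ = f := by
  have hC := isCoeffFamily_invCoeff (r := r) c
  have hs := compSummable_invCoeff hr.pos (c := c) fun τ => (hc τ).summable
  have hE := hC.isFourierExpansion hr hs
  have hF : (fun τ : ℍ => ∑ j, comp (invCoeff (r := r) c) j (8 * (τ : ℂ))) = f := by
    funext τ
    refine (hC.hasSum_evenCoeff hs hr.pos τ).unique ?_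
    simpa only [evenCoeff_invCoeff hr hc'] using hc τ
  have ht : IsThetaTriple (2 * k + 1) (Complex.I ^ κ) (compG (invCoeff (r := r) c))
      (compU (invCoeff (r := r) c)) (compW (invCoeff (r := r) c)) := by
    refine isThetaTriple_of_isHalfIntegralForm (I_pow_sq hev) (compG_T hr.pos) (compU_T hr.pos)
      (compW_T hκ hev) ?_
    rw [← sum_comp_eq_liftForm, hF]
    exact hf
  refine ⟨_, thetaCombination_mem hκ hev hr hC hs ht, hE, ?_⟩
  rw [evenMap_eq, hE.fourierCoeff_eq, hF]

/-- The isomorphism between Jacobi forms and forms of half-integral weight. -/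
def evenEquiv (hκ : 2 * κ = 2 * k + 1 + r) (hev : Even κ) (hr : Odd r) :
    jacobiForms (κ : ℤ) (latticeD r) ≃ₗ[ℂ] plusForms k r :=
  LinearEquiv.ofBijective ((evenLinearMap hr.pos κ).codRestrict (plusForms k r)
    fun φ => evenMap_mem hκ hev hr φ.2) (by
    constructor
    · exact (injective_iff_map_eq_zero _).2 fun φ h => Subtype.ext
        (eq_zero_of_evenMap_eq_zero hκ hev hr φ.2 (congrArg Subtype.val h))
    · rintro ⟨f, hf, c, hc, hc'⟩
      obtain ⟨φ, h1, h2, h3⟩ := exists_evenMap_eq hκ hev hr hf hc hc'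
      exact ⟨⟨φ, h1, _, h2, (isCoeffFamily_invCoeff c).nonneg⟩, Subtype.ext h3⟩)

theorem coe_evenEquiv (hκ : 2 * κ = 2 * k + 1 + r) (hev : Even κ) (hr : Odd r)
    (φ : jacobiForms (κ : ℤ) (latticeD r)) :
    (evenEquiv hκ hev hr φ : ℍ → ℂ) = evenMap r φ := rfl

/-- Only the cusp at infinity is used: the constant term is the limit of `f` there. -/
theorem coeff_zero_eq_zero {k : ℤ} {f : ℍ → ℂ} (hf : f ∈ halfIntegralCuspForms k 8) {c : ℕ → ℂ}
    (hc : ∀ τ : ℍ, HasSum (fun n : ℕ => c n * e ((n : ℂ) * (τ : ℂ))) (f τ)) : c 0 = 0 := by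
  have h1 := hf.2 1
  rw [SlashAction.slash_one] at h1
  have h2 : IsZeroAtImInfty f := by
    have : Tendsto (fun τ => ‖f τ‖ ^ 2) atImInfty (𝓝 0) := by
      simpa using! Tendsto.norm h1
    have := this.sqrt
    simp only [Real.sqrt_zero, Real.sqrt_sq (norm_nonneg _)] at this
    exact tendsto_zero_iff_norm_tendsto_zero.2 this
  have h3 : IsZeroAtImInfty (fun τ => f τ - c 0) := by
    refine isZeroAtImInfty_of_hasSum (a := fun n : ℕ => if n = 0 then 0 else c n)
      (ν := fun n => n) (fun n hn => ?_) fun τ => ?_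
    · have : n ≠ 0 := fun h => hn (if_pos h)
      exact_mod_cast Nat.pos_of_ne_zero this
    · have := (hc τ).sub (hasSum_ite_eq 0 (c 0))
      refine this.congr_fun fun n => ?_
      by_cases hn : n = 0
      · simp [hn]
      · simp [hn]
  have h4 : Tendsto (fun τ => f τ - (f τ - c 0)) atImInfty (𝓝 (0 - 0)) := Tendsto.sub h2 h3
  simp only [sub_sub_cancel, sub_zero] at h4
  exact tendsto_nhds_unique tendsto_const_nhds h4

theorem jacobiCuspForms_le (κ : ℤ) :
    jacobiCuspForms κ (latticeD r) ≤ jacobiForms κ (latticeD r) :=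
  fun _ ⟨h, c, hc, hc'⟩ => ⟨h, c, hc, fun m x hmx => (hc' m x hmx).le⟩

/-- The isomorphism between cusp forms. -/
def evenCuspEquiv (hκ : 2 * κ = 2 * k + 1 + r) (hev : Even κ) (hr : Odd r) :
    jacobiCuspForms (κ : ℤ) (latticeD r) ≃ₗ[ℂ] plusCuspForms k r :=
  LinearEquiv.ofBijective (((evenLinearMap hr.pos κ).comp
      (Submodule.inclusion (jacobiCuspForms_le κ))).codRestrict (plusCuspForms k r)
    fun φ => evenMap_mem_cusp hκ hev hr φ.2) (by
    constructor
    · exact (injective_iff_map_eq_zero _).2 fun φ h => Subtype.ext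
        (eq_zero_of_evenMap_eq_zero hκ hev hr (jacobiCuspForms_le _ φ.2) (congrArg Subtype.val h))
    · rintro ⟨f, ⟨hf, c, hc, hc'⟩, hf'⟩
      obtain ⟨φ, h1, h2, h3⟩ := exists_evenMap_eq hκ hev hr hf hc hc'
      refine ⟨⟨φ, h1, _, h2, fun m x h => ?_⟩, Subtype.ext h3⟩
      -- Every coefficient with `m = β(x)` is a multiple of `c 0`, so the vanishing of that single
      -- number makes the Jacobi form cuspidal.
      refine lt_of_le_of_ne ((isCoeffFamily_invCoeff c).nonneg m x h) fun h0 => h ?_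
      rw [invCoeff, ← h0]
      simp [coeff_zero_eq_zero hf' hc])

theorem coe_evenCuspEquiv (hκ : 2 * κ = 2 * k + 1 + r) (hev : Even κ) (hr : Odd r)
    (φ : jacobiCuspForms (κ : ℤ) (latticeD r)) :
    (evenCuspEquiv hκ hev hr φ : ℍ → ℂ) = evenMap r φ := rfl

end

end

noncomputable section

/-! ### Representatives of the matrices of determinant `p²` -/

/-- The triples `(a, b, d)` of the upper triangular representatives of the primitive integral
matrices of determinant `p²` up to multiplication by `SL(2, ℤ)` on the left. -/
def heckeIndex (p : ℕ) : Finset (ℤ × ℤ × ℤ) :=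
  ((Finset.range (p ^ 2)).image fun b : ℕ => ((1 : ℤ), (b : ℤ), (p : ℤ) ^ 2)) ∪
    (((Finset.Ico 1 p).image fun b : ℕ => ((p : ℤ), (b : ℤ), (p : ℤ))) ∪
      {((p : ℤ) ^ 2, (0 : ℤ), (1 : ℤ))})

/-- The divisor `a` of `p²` is `1`, `p` or `p²`, and primitivity removes only `b = 0` in the middle
case. -/
theorem mem_heckeIndex_iff {p : ℕ} (hp : p.Prime) {a b d : ℤ} :
    (a, b, d) ∈ heckeIndex p ↔ 0 < a ∧ 0 ≤ b ∧ b < d ∧ a * d = (p : ℤ) ^ 2 ∧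
      ¬ ((p : ℤ) ∣ a ∧ (p : ℤ) ∣ b ∧ (p : ℤ) ∣ d) := by
  have hp0 : (0 : ℤ) < p := by exact_mod_cast hp.pos
  have hp1 : ¬ (p : ℤ) ∣ 1 := by
    intro h
    exact hp.one_lt.ne' (by exact_mod_cast Int.eq_one_of_dvd_one hp0.le h)
  simp only [heckeIndex, Finset.mem_union, Finset.mem_image, Finset.mem_range, Finset.mem_Ico,
    Finset.mem_singleton, Prod.mk.injEq]
  constructor
  · rintro (⟨x, hx, rfl, rfl, rfl⟩ | ⟨x, hx, rfl, rfl, rfl⟩ | ⟨rfl, rfl, rfl⟩)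
    · exact ⟨one_pos, by positivity, by exact_mod_cast hx, one_mul _, fun h => hp1 h.1⟩
    · refine ⟨hp0, by positivity, by exact_mod_cast hx.2, by ring, fun h => ?_⟩
      have h1 : p ∣ x := by exact_mod_cast h.2.1
      exact absurd (Nat.le_of_dvd hx.1 h1) (not_le.2 hx.2)
    · exact ⟨by positivity, le_rfl, one_pos, mul_one _, fun h => hp1 h.2.2⟩
  · rintro ⟨ha, hb, hbd, had, hprim⟩
    have h1 : a.natAbs ∣ p ^ 2 := by
      rw [← Int.natCast_dvd_natCast, Int.natAbs_dvd]
      exact ⟨d, by push_cast; exact had.symm⟩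
    have haa : (a.natAbs : ℤ) = a := Int.natAbs_of_nonneg ha.le
    obtain ⟨i, hi, hi'⟩ := (Nat.dvd_prime_pow hp).1 h1
    have ha' : a = (p : ℤ) ^ i := by rw [← haa, hi']; push_cast; rfl
    interval_cases i
    · left
      rw [pow_zero] at ha'
      subst ha'
      rw [one_mul] at had
      subst had
      refine ⟨b.toNat, ?_, rfl, Int.toNat_of_nonneg hb, rfl⟩
      zify
      rwa [Int.toNat_of_nonneg hb]
    · right; left
      rw [pow_one] at ha'
      subst ha'
      have hd : d = p := by
        have : (p : ℤ) * d = p * p := by rw [had, sq]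
        exact mul_left_cancel₀ hp0.ne' this
      subst hd
      refine ⟨b.toNat, ⟨?_, ?_⟩, rfl, Int.toNat_of_nonneg hb, rfl⟩
      · rcases hb.lt_or_eq with h | h
        · omega
        · exact absurd ⟨dvd_rfl, h ▸ dvd_zero _, dvd_rfl⟩ hprim
      · zify
        rwa [Int.toNat_of_nonneg hb]
    · right; right
      have hd : d = 1 := by
        rw [ha'] at had
        exact mul_left_cancel₀ (pow_ne_zero 2 hp0.ne') (by rw [had, mul_one])
      subst hd
      exact ⟨ha', by omega, rfl⟩

/-- Multiplication by `S` on the right permutes the classes of primitive integral matrices of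
determinant `p²`. -/
theorem exists_heckeIndex_S {p : ℕ} (hp : p.Prime) {a b d : ℤ} (h : (a, b, d) ∈ heckeIndex p) :
    ∃ γ : SL(2, ℤ), ∃ a' b' d' : ℤ, (a', b', d') ∈ heckeIndex p ∧
      !![b, -a; d, 0] = γ.1 * !![a', b'; 0, d'] := by
  obtain ⟨ha, hb, hbd, had, hprim⟩ := (mem_heckeIndex_iff hp).1 h
  have hp0 : (0 : ℤ) < p := by exact_mod_cast hp.pos
  obtain ⟨γ, a', b', d', ha', hb', hbd', had', hM⟩ := exists_eq_mul_upper (m := (p : ℤ) ^ 2)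
    (by positivity) !![b, -a; d, 0] (by rw [Matrix.det_fin_two_of]; linarith)
  refine ⟨γ, a', b', d', (mem_heckeIndex_iff hp).2 ⟨ha', hb', hbd', had', ?_⟩, hM⟩
  rintro ⟨⟨x, rfl⟩, ⟨y, rfl⟩, ⟨w, rfl⟩⟩
  have e00 := congrFun (congrFun hM 0) 0
  have e01 := congrFun (congrFun hM 0) 1
  have e10 := congrFun (congrFun hM 1) 0
  simp [Matrix.mul_apply, Fin.sum_univ_two] at e00 e01 e10
  refine hprim ⟨⟨-(γ 0 0 * y + γ 0 1 * w), ?_⟩, ⟨γ 0 0 * x, ?_⟩, ⟨γ 1 0 * x, ?_⟩⟩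
  · linear_combination -e01
  · linear_combination e00
  · linear_combination e10

/-- The matrix connecting the two is upper triangular with positive diagonal, hence unipotent; the
bounds on `b` and `b₁` then make it the identity. -/
theorem heckeIndex_S_unique {p : ℕ} (hp : p.Prime) {a b d a₁ b₁ d₁ : ℤ}
    (h : (a, b, d) ∈ heckeIndex p) (h₁ : (a₁, b₁, d₁) ∈ heckeIndex p) {γ γ₁ : SL(2, ℤ)}
    {N : Matrix (Fin 2) (Fin 2) ℤ}
    (hM : !![b, -a; d, 0] = γ.1 * N) (hM₁ : !![b₁, -a₁; d₁, 0] = γ₁.1 * N) :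
    (a, b, d) = (a₁, b₁, d₁) := by
  obtain ⟨ha, hb, hbd, had, -⟩ := (mem_heckeIndex_iff hp).1 h
  obtain ⟨ha₁, hb₁, hbd₁, had₁, -⟩ := (mem_heckeIndex_iff hp).1 h₁
  have h2 : !![b, -a; d, 0] = (γ * γ₁⁻¹).1 * !![b₁, -a₁; d₁, 0] := by
    rw [hM, hM₁, ← Matrix.mul_assoc, ← Matrix.SpecialLinearGroup.coe_mul]
    simp
  generalize γ * γ₁⁻¹ = δ at h2
  have e00 := congrFun (congrFun h2 0) 0
  have e01 := congrFun (congrFun h2 0) 1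
  have e10 := congrFun (congrFun h2 1) 0
  have e11 := congrFun (congrFun h2 1) 1
  simp [Matrix.mul_apply, Fin.sum_univ_two] at e00 e01 e10 e11
  have hdet := det_eq δ
  have h10 : δ 1 0 = 0 := e11.resolve_right ha₁.ne'
  have h00 : δ 0 0 * δ 1 1 = 1 := by rw [h10] at hdet; linarith
  have e01' : a = δ 0 0 * a₁ := e01
  have h00p : 0 < δ 0 0 := by
    by_contra hn
    nlinarith
  have h1 : δ 0 0 = 1 := by
    rcases Int.eq_one_or_neg_one_of_mul_eq_one h00 with h | h
    · exact h
    · omega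
  have h3 : δ 1 1 = 1 := by rw [h1, one_mul] at h00; exact h00
  have e10' : d = δ 1 0 * b₁ + δ 1 1 * d₁ := e10
  have e00' : b = δ 0 0 * b₁ + δ 0 1 * d₁ := e00
  rw [h1, one_mul] at e01' e00'
  rw [h10, h3, zero_mul, zero_add, one_mul] at e10'
  subst e01' e10'
  have : δ 0 1 = 0 := by
    rcases lt_trichotomy (δ 0 1) 0 with h | h | h
    · nlinarith
    · exact h
    · nlinarith
  rw [this, zero_mul, add_zero] at e00'
  rw [e00']

/-- A bijection of the classes of primitive integral matrices of determinant `p²` that is given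
by multiplication by `S` on the right. -/
theorem exists_heckeIndex_perm {p : ℕ} (hp : p.Prime) :
    ∃ σ : Equiv.Perm (heckeIndex p), ∀ i : heckeIndex p, ∃ γ : SL(2, ℤ),
      !![i.1.2.1, -i.1.1; i.1.2.2, 0] = γ.1 * !![(σ i).1.1, (σ i).1.2.1; 0, (σ i).1.2.2] := by
  have h : ∀ i : heckeIndex p, ∃ j : heckeIndex p, ∃ γ : SL(2, ℤ),
      !![i.1.2.1, -i.1.1; i.1.2.2, 0] = γ.1 * !![j.1.1, j.1.2.1; 0, j.1.2.2] := by
    rintro ⟨⟨a, b, d⟩, hi⟩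
    obtain ⟨γ, a', b', d', hi', hM⟩ := exists_heckeIndex_S hp hi
    exact ⟨⟨(a', b', d'), hi'⟩, γ, hM⟩
  choose σ γ hσ using h
  have hinj : Function.Injective σ := by
    intro i j hij
    have h1 := hσ i
    have h2 := hσ j
    rw [← hij] at h2
    exact Subtype.ext (heckeIndex_S_unique hp i.2 j.2 h1 h2)
  exact ⟨Equiv.ofBijective σ (Finite.injective_iff_bijective.1 hinj), fun i => ⟨γ i, hσ i⟩⟩

end

noncomputable section

variable {r : ℕ}

/-! ### The Hecke operator as a sum over matrices -/

theorem quadC_translate (l m : Fin r → ℚ) (z : Fin r → ℂ) (τ : ℂ) :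
    quadC (fun i => z i + (l i : ℂ) * τ + (m i : ℂ)) = quadC z + (quad l : ℂ) * τ ^ 2 + (quad m : ℂ)
      + bilC l z * τ + bilC m z + (bil l m : ℂ) * τ := by
  simp only [quadC, quad, bilC, bil]
  push_cast
  simp only [Finset.sum_mul, Finset.sum_div, ← Finset.sum_add_distrib]
  exact Finset.sum_congr rfl fun i _ => by ring

theorem quadC_mul (s : ℂ) (z : Fin r → ℂ) : quadC (fun i => s * z i) = s ^ 2 * quadC z := by
  simp only [quadC, Finset.sum_div, Finset.mul_sum]
  exact Finset.sum_congr rfl fun i _ => by ring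

/-- The summand of the Hecke operator `T(p)` on Jacobi forms that belongs to the matrix
`(a, b; 0, d)` and to the pair `(l, m)` of lattice vectors. -/
def heckeTerm (κ : ℤ) (p : ℕ) (φ : ℍ → (Fin r → ℂ) → ℂ) (M : ℤ × ℤ × ℤ) (l m : Fin r → ℚ)
    (τ : ℍ) (z : Fin r → ℂ) : ℂ :=
  (M.2.2 : ℂ) ^ (-κ)
    * φ (ofComplex ((M.1 * τ + M.2.1) / M.2.2))
      (fun i => p / M.2.2 * (z i + (l i : ℂ) * τ + (m i : ℂ)))
    * e ((τ : ℂ) * (quad l : ℂ) + bilC l z)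

/-- Elliptic translation by `(l', m')` shifts the pair `(l, m)`; the discrepancy `e(β(l, m'))` is
`1` because the lattice is integral. -/
theorem heckeTerm_translate {κ : ℤ} {p : ℕ} {φ : ℍ → (Fin r → ℂ) → ℂ} (M : ℤ × ℤ × ℤ)
    {l m l' m' : Fin r → ℚ} (hl : l ∈ latticeD r) (hm' : m' ∈ latticeD r)
    (τ : ℍ) (z : Fin r → ℂ) :
    heckeTerm κ p φ M l m τ (fun i => z i + (l' i : ℂ) * τ + (m' i : ℂ))
        * e ((τ : ℂ) * (quad l' : ℂ) + bilC l' z)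
      = heckeTerm κ p φ M (l + l') (m + m') τ z := by
  obtain ⟨a, ha⟩ := exists_bil_eq_int (mem_dual_of_mem hl) hm'
  rw [heckeTerm, heckeTerm, mul_assoc, ← e_add]
  congr 1
  · congr 2
    funext i
    simp only [Pi.add_apply]
    push_cast
    ring
  · refine e_congr_int a ?_
    rw [bilC_translate, ha, quad_add, bilC_add]
    push_cast
    ring

theorem coe_ofComplex_upper {a b d : ℤ} (ha : 0 < a) (hd : 0 < d) (τ : ℍ) :
    (ofComplex ((a * (τ : ℂ) + b) / d) : ℂ) = (a * (τ : ℂ) + b) / d := by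
  have h := coe_upper a b d ha hd τ
  rw [← h, ofComplex_apply]

/-- With `w = (aτ + b)/d` and `ad = p²`, the shift `(p/d)(p l τ + p m)` equals `(d l) w + (a m - b
l)`, a lattice translation to which the elliptic law of `φ` applies. -/
theorem heckeTerm_smul {κ : ℤ} {p : ℕ} {φ : ℍ → (Fin r → ℂ) → ℂ}
    (hφ : IsJacobiInvariant κ (latticeD r) φ) {a b d : ℤ} (ha : 0 < a) (hd : 0 < d)
    (had : a * d = (p : ℤ) ^ 2) {l m : Fin r → ℚ} (hl : l ∈ latticeD r) (hm : m ∈ latticeD r)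
    (τ : ℍ) (z : Fin r → ℂ) :
    heckeTerm κ p φ (a, b, d) ((p : ℚ) • l) ((p : ℚ) • m) τ z
      = heckeTerm κ p φ (a, b, d) 0 0 τ z := by
  have hd0 : (d : ℂ) ≠ 0 := by exact_mod_cast hd.ne'
  have hadC : (a : ℂ) * d = (p : ℂ) ^ 2 := by exact_mod_cast had
  set w := ofComplex ((a * (τ : ℂ) + b) / d) with hw
  have h1 := hφ.elliptic (d • l) (zsmul_mem hl d) (a • m - b • l)
    (sub_mem (zsmul_mem hm a) (zsmul_mem hl b)) w (fun i => p / d * z i)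
  obtain ⟨q, hq⟩ := exists_quad_eq_int hl
  have hz : (fun i => p / (d : ℂ) * (z i + (((p : ℚ) • l) i : ℂ) * τ + (((p : ℚ) • m) i : ℂ)))
      = fun i => p / (d : ℂ) * z i + ((d • l) i : ℂ) * w + ((a • m - b • l) i : ℂ) := by
    funext i
    simp only [Pi.smul_apply, Pi.sub_apply, smul_eq_mul]
    simp only [zsmul_eq_mul]
    rw [hw, coe_ofComplex_upper ha hd]
    push_cast
    field_simp
    linear_combination -((l i : ℂ) * τ + m i) * hadC
  simp only [heckeTerm]
  rw [hz, ← hw]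
  have hz0 : (fun i => p / (d : ℂ) * (z i + (((0 : Fin r → ℚ) i : ℚ) : ℂ) * τ
      + (((0 : Fin r → ℚ) i : ℚ) : ℂ))) = fun i => p / (d : ℂ) * z i := by simp
  rw [hz0, ← h1, mul_assoc, mul_assoc, mul_assoc, ← e_add]
  congr 2
  refine e_congr_int (-(d * b * q)) ?_
  have hdl : ((d • l : Fin r → ℚ)) = (d : ℚ) • l := by ext i; simp
  rw [hdl, quad_smul, quad_smul, bilC_smul, bilC_smul, hw, coe_ofComplex_upper ha hd, hq]
  have hb : bilC l (fun i => p / (d : ℂ) * z i) = p / d * bilC l z := by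
    simp only [bilC, Finset.mul_sum]
    exact Finset.sum_congr rfl fun i _ => by ring
  have h0 : (quad (0 : Fin r → ℚ)) = 0 := by simp [quad, bil]
  have h0' : bilC (0 : Fin r → ℚ) z = 0 := by simp [bilC]
  rw [hb, h0, h0']
  push_cast
  field_simp
  linear_combination (-(τ : ℂ) * q) * hadC

/-- The matrix `(a, b; 0, d) S` is `γ` times a new representative. The modular law of `φ` for `γ`
removes `γ`, and the pair `(l, m)` becomes `(m, -l)`; the exponents agree up to the integer `β(m,
l)`. -/
theorem heckeTerm_S {κ : ℤ} {p : ℕ} {φ : ℍ → (Fin r → ℂ) → ℂ}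
    (hφ : IsJacobiInvariant κ (latticeD r) φ) {a b d a' b' d' : ℤ} (ha : 0 < a) (hd : 0 < d)
    (ha' : 0 < a') (hd' : 0 < d') (had' : a' * d' = (p : ℤ) ^ 2)
    {γ : SL(2, ℤ)} (hM : !![b, -a; d, 0] = γ.1 * !![a', b'; 0, d'])
    {l m : Fin r → ℚ} (hl : l ∈ latticeD r) (hm : m ∈ latticeD r) (τ : ℍ) (z : Fin r → ℂ) :
    heckeTerm κ p φ (a, b, d) l m (ModularGroup.S • τ) (fun i => z i / (τ : ℂ))
        * e (-quadC z / τ) * (τ : ℂ) ^ (-κ)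
      = heckeTerm κ p φ (a', b', d') m (-l) τ z := by
  have hτ : (τ : ℂ) ≠ 0 := τ.ne_zero
  have hd0 : (d : ℂ) ≠ 0 := by exact_mod_cast hd.ne'
  have hd0' : (d' : ℂ) ≠ 0 := by exact_mod_cast hd'.ne'
  have ha0' : (a' : ℂ) ≠ 0 := by exact_mod_cast ha'.ne'
  have hadC : (a' : ℂ) * d' = (p : ℂ) ^ 2 := by exact_mod_cast had'
  obtain ⟨q, hq⟩ := exists_bil_eq_int (mem_dual_of_mem hm) hl
  have e00 := congrFun (congrFun hM 0) 0
  have e01 := congrFun (congrFun hM 0) 1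
  have e10 := congrFun (congrFun hM 1) 0
  have e11 := congrFun (congrFun hM 1) 1
  simp only [Matrix.mul_apply, Fin.sum_univ_two, Matrix.of_apply, Matrix.cons_val_zero,
    Matrix.cons_val_one, Matrix.cons_val', Matrix.cons_val_fin_one, mul_zero, add_zero]
    at e00 e01 e10 e11
  have c00 : (b : ℂ) = (γ 0 0 : ℂ) * a' := by exact_mod_cast e00
  have c01 : (-a : ℂ) = (γ 0 0 : ℂ) * b' + (γ 0 1 : ℂ) * d' := by exact_mod_cast e01
  have c10 : (d : ℂ) = (γ 1 0 : ℂ) * a' := by exact_mod_cast e10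
  have c11 : (0 : ℂ) = (γ 1 0 : ℂ) * b' + (γ 1 1 : ℂ) * d' := by exact_mod_cast e11
  set w := ofComplex ((a' * (τ : ℂ) + b') / d') with hw
  have hwC : (w : ℂ) = (a' * (τ : ℂ) + b') / d' := coe_ofComplex_upper ha' hd' τ
  have hj : (γ 1 0 : ℂ) * w + γ 1 1 = d * τ / d' := by
    rw [hwC]
    field_simp
    linear_combination -c11 - (τ : ℂ) * c10
  have hn : (γ 0 0 : ℂ) * w + γ 0 1 = (b * τ - a) / d' := by
    rw [hwC]
    field_simp
    linear_combination -c01 - (τ : ℂ) * c00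
  have hw' : γ • w = ofComplex ((a * ((ModularGroup.S • τ : ℍ) : ℂ) + b) / d) := by
    rw [← UpperHalfPlane.coe_inj, coe_ofComplex_upper ha hd, coe_SL_smul, hj, hn, coe_S_smul]
    field_simp
    ring
  set y : Fin r → ℂ := fun i => p / (d' : ℂ) * (z i + (m i : ℂ) * τ + ((-l) i : ℂ)) with hy
  have h1 := hφ.modular γ w y
  rw [hj, hw'] at h1
  have hy' : (fun i => y i / (d * τ / d' : ℂ)) = fun i => p / (d : ℂ) *
      (z i / τ + (l i : ℂ) * ((ModularGroup.S • τ : ℍ) : ℂ) + (m i : ℂ)) := by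
    funext i
    simp only [hy, coe_S_smul, Pi.neg_apply]
    push_cast
    field_simp
    ring
  rw [hy'] at h1
  simp only [heckeTerm]
  rw [← hw, ← hy, ← h1]
  have hz : (d' : ℂ) ^ (-κ) * (d * τ / d' : ℂ) ^ (-κ) = (d : ℂ) ^ (-κ) * (τ : ℂ) ^ (-κ) := by
    rw [← mul_zpow, ← mul_zpow]
    congr 1
    field_simp
  rw [show ∀ A B D E F : ℂ, A * B * D * E * F = (A * F) * B * (D * E) from fun A B D E F => by ring,
    show ∀ A B D E F : ℂ, A * (B * D * E) * F = (A * E) * B * (D * F) from fun A B D E F => by ring,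
    hz, ← e_add, ← e_add]
  congr 1
  refine e_congr_int (-q) ?_
  rw [hy, quadC_mul, quadC_translate, coe_S_smul, bil_neg_right, hq, quad_neg, bilC_neg]
  have hb : bilC l (fun i => z i / (τ : ℂ)) = bilC l z / τ := by
    simp only [bilC, Finset.sum_div]
    exact Finset.sum_congr rfl fun i _ => by ring
  rw [hb]
  have hγ : (γ 1 0 : ℂ) = d / a' := by field_simp; linear_combination -c10
  rw [hγ]
  push_cast
  have hpd : (p : ℂ) ^ 2 = a' * d' := hadC.symm
  rw [div_pow, hpd]
  field_simp
  ring

end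

noncomputable section

variable {r : ℕ}

/-! ### Sums over `D_r / p D_r` -/

/-- Representatives of `D_r / p D_r` for odd `p`. -/
def liftTwo (p : ℕ) (v : Fin r → ZMod p) : Fin r → ℚ := fun i => 2 * ((v i).val : ℚ)

/-- Doubling puts every integral vector into `D_r`, and since `2` is invertible modulo an odd `p` no
class is lost. -/
theorem liftTwo_mem (p : ℕ) (v : Fin r → ZMod p) : liftTwo p v ∈ latticeD r := by
  refine ⟨fun i => 2 * ((v i).val : ℤ), fun i => by simp [liftTwo], ?_⟩
  rw [← Finset.mul_sum]
  exact even_two_mul _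

/-- Periodicity with respect to `p D_r` of functions on `D_r`. -/
def IsPeriodicMod (p : ℕ) (f : (Fin r → ℚ) → ℂ) : Prop :=
  ∀ l ∈ latticeD r, ∀ m ∈ latticeD r, f (l + (p : ℚ) • m) = f l

section Periodic

variable {p : ℕ} {f : (Fin r → ℚ) → ℂ}

/-- If `p b` has even coordinate sum and `p` is odd, then so has `b`; hence the quotient by `p`
stays in `D_r`. -/
theorem exists_eq_liftTwo_add [NeZero p] (hp : Odd p) {l : Fin r → ℚ} (hl : l ∈ latticeD r)
    {v : Fin r → ZMod p} (hv : ∀ i, ∃ a : ℤ, l i = a ∧ (a : ZMod p) = 2 * v i) :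
    ∃ m ∈ latticeD r, l = liftTwo p v + (p : ℚ) • m := by
  choose a ha hav using hv
  have h1 : ∀ i, ∃ b : ℤ, a i = 2 * ((v i).val : ℤ) + p * b := fun i => by
    have : ((a i - 2 * ((v i).val : ℤ) : ℤ) : ZMod p) = 0 := by
      push_cast
      rw [hav i, ZMod.natCast_zmod_val, sub_self]
    obtain ⟨b, hb⟩ := (ZMod.intCast_zmod_eq_zero_iff_dvd _ _).1 this
    exact ⟨b, by linarith⟩
  choose b hb using h1
  refine ⟨fun i => b i, ⟨b, fun i => rfl, ?_⟩, funext fun i => ?_⟩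
  · obtain ⟨a', ha', heven⟩ := hl
    have haa : a' = a := funext fun i => by
      have : (a' i : ℚ) = a i := by rw [← ha', ha]
      exact_mod_cast this
    rw [haa] at heven
    simp only [hb, Finset.sum_add_distrib, ← Finset.mul_sum] at heven
    have h3 := (Int.even_add.1 heven).1 (even_two_mul _)
    have hp' : ¬ Even (p : ℤ) := by
      rw [Int.not_even_iff_odd]; exact_mod_cast hp
    exact (Int.even_mul.1 h3).resolve_left hp'
  · rw [ha, hb]
    simp [liftTwo]

theorem IsPeriodicMod.eq_liftTwo [NeZero p] (hf : IsPeriodicMod p f) (hp : Odd p) {l : Fin r → ℚ}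
    (hl : l ∈ latticeD r) {v : Fin r → ZMod p}
    (hv : ∀ i, ∃ a : ℤ, l i = a ∧ (a : ZMod p) = 2 * v i) : f l = f (liftTwo p v) := by
  obtain ⟨m, hm, rfl⟩ := exists_eq_liftTwo_add hp hl hv
  exact hf _ (liftTwo_mem p v) m hm

theorem two_mul_half_zmod [Fact p.Prime] (hp : p ≠ 2) (x : ZMod p) : 2 * (x / 2) = x := by
  have h2 : (2 : ZMod p) ≠ 0 := by
    have : ((2 : ℕ) : ZMod p) ≠ 0 := by
      rw [Ne, ZMod.natCast_eq_zero_iff]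
      exact fun h => hp ((Nat.prime_dvd_prime_iff_eq Fact.out Nat.prime_two).1 h)
    exact_mod_cast this
  exact mul_div_cancel₀ x h2

theorem odd_of_prime_ne_two [Fact p.Prime] (hp : p ≠ 2) : Odd p :=
  (Fact.out : p.Prime).odd_of_ne_two hp

theorem IsPeriodicMod.sum_add [Fact p.Prime] (hp : p ≠ 2) (hf : IsPeriodicMod p f)
    {l : Fin r → ℚ} (hl : l ∈ latticeD r) :
    ∑ v : Fin r → ZMod p, f (liftTwo p v + l) = ∑ v : Fin r → ZMod p, f (liftTwo p v) := by
  obtain ⟨a, ha, _⟩ := id hl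
  rw [← Equiv.sum_comp (Equiv.addRight fun i => (a i : ZMod p) / 2) fun v => f (liftTwo p v)]
  refine Finset.sum_congr rfl fun v _ => ?_
  refine hf.eq_liftTwo (odd_of_prime_ne_two hp) (add_mem (liftTwo_mem p v) hl) fun i => ?_
  refine ⟨2 * ((v i).val : ℤ) + a i, by simp [liftTwo, ha], ?_⟩
  push_cast
  rw [ZMod.natCast_zmod_val, Equiv.coe_addRight]
  beta_reduce
  rw [Pi.add_apply, mul_add, two_mul_half_zmod hp]

theorem IsPeriodicMod.sum_neg [Fact p.Prime] (hp : p ≠ 2) (hf : IsPeriodicMod p f) :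
    ∑ v : Fin r → ZMod p, f (-liftTwo p v) = ∑ v : Fin r → ZMod p, f (liftTwo p v) := by
  rw [← Equiv.sum_comp (Equiv.neg (Fin r → ZMod p))]
  refine Finset.sum_congr rfl fun v _ => ?_
  refine hf.eq_liftTwo (odd_of_prime_ne_two hp) (neg_mem (liftTwo_mem p _)) fun i => ?_
  refine ⟨-(2 * (((-v) i).val : ℤ)), by simp [liftTwo], ?_⟩
  push_cast
  rw [ZMod.natCast_zmod_val, Pi.neg_apply]
  ring

/-- The classes of the vectors `2v` represent `D_r / p D_r`. -/
theorem liftTwo_bijective [Fact p.Prime] (hp : p ≠ 2) :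
    Function.Bijective fun v : Fin r → ZMod p =>
      (QuotientAddGroup.mk ⟨liftTwo p v, liftTwo_mem p v⟩ :
        latticeD r ⧸ (nsmulAddMonoidHom (α := latticeD r) p).range) := by
  constructor
  · intro v w hvw
    obtain ⟨m, hm⟩ := QuotientAddGroup.eq.1 hvw
    obtain ⟨b, hb, -⟩ := m.2
    funext i
    have h1 := congrFun (congrArg Subtype.val hm) i
    simp only [nsmulAddMonoidHom_apply, AddSubgroup.coe_nsmul, AddSubgroup.coe_add,
      AddSubgroup.coe_neg, Pi.smul_apply, Pi.add_apply, Pi.neg_apply, liftTwo, hb] at h1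
    rw [nsmul_eq_mul] at h1
    have h2 : ((w i).val : ℤ) * 2 = 2 * (v i).val + p * b i := by
      have : ((w i).val : ℚ) * 2 = 2 * (v i).val + p * b i := by linarith
      exact_mod_cast this
    have h3 := congrArg (Int.cast : ℤ → ZMod p) h2
    push_cast at h3
    rw [ZMod.natCast_zmod_val, ZMod.natCast_zmod_val, CharP.cast_eq_zero, zero_mul, add_zero] at h3
    have h4 := congrArg (· / 2) h3
    simp only [mul_comm (w i) 2, mul_div_assoc, two_mul_half_zmod hp] at h4
    exact h4.symm
  · intro q
    induction q using QuotientAddGroup.induction_on with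
    | H l =>
      obtain ⟨a, ha, -⟩ := id l.2
      obtain ⟨m, hm, h⟩ := exists_eq_liftTwo_add (odd_of_prime_ne_two hp) l.2
        (v := fun i => (a i : ZMod p) / 2) fun i => ⟨a i, ha i, (two_mul_half_zmod hp _).symm⟩
      refine ⟨fun i => (a i : ZMod p) / 2, QuotientAddGroup.eq.2 ⟨⟨m, hm⟩, ?_⟩⟩
      ext i
      have := congrFun h i
      simp only [nsmulAddMonoidHom_apply, AddSubgroup.coe_nsmul, AddSubgroup.coe_add,
        AddSubgroup.coe_neg, Pi.smul_apply, Pi.add_apply, Pi.neg_apply, smul_eq_mul] at this ⊢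
      rw [this, nsmul_eq_mul]
      ring

/-- Periodicity makes the sum independent of the chosen coset representatives and replaces them by
the vectors `2v`. -/
theorem IsPeriodicMod.finsum_eq [Fact p.Prime] (hp : p ≠ 2) (hf : IsPeriodicMod p f) :
    ∑ᶠ l : latticeD r ⧸ (nsmulAddMonoidHom (α := latticeD r) p).range, f (l.out : latticeD r).1
      = ∑ v : Fin r → ZMod p, f (liftTwo p v) := by
  rw [← finsum_eq_sum_of_fintype]
  refine (finsum_eq_of_bijective _ (liftTwo_bijective hp) fun v => ?_).symm
  set q : latticeD r ⧸ (nsmulAddMonoidHom (α := latticeD r) p).range :=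
    QuotientAddGroup.mk ⟨liftTwo p v, liftTwo_mem p v⟩ with hq
  have h1 : (QuotientAddGroup.mk ⟨liftTwo p v, liftTwo_mem p v⟩ :
      latticeD r ⧸ (nsmulAddMonoidHom (α := latticeD r) p).range) = QuotientAddGroup.mk q.out := by
    rw [QuotientAddGroup.out_eq', hq]
  obtain ⟨m, hm⟩ := QuotientAddGroup.eq.1 h1
  have h2 : (q.out : latticeD r).1 = liftTwo p v + (p : ℚ) • m.1 := by
    have := congrArg Subtype.val hm
    simp only [nsmulAddMonoidHom_apply, AddSubgroup.coe_nsmul, AddSubgroup.coe_add,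
      AddSubgroup.coe_neg] at this
    rw [Nat.cast_smul_eq_nsmul, this]
    simp
  rw [h2, hf _ (liftTwo_mem p v) _ m.2]

end Periodic

/-! ### Transformation laws of the Hecke sum -/

/-- The sum of the terms `heckeTerm` over all matrices and all pairs of lattice vectors. -/
def heckeSum (κ : ℤ) (p : ℕ) [NeZero p] (φ : ℍ → (Fin r → ℂ) → ℂ) (τ : ℍ) (z : Fin r → ℂ) : ℂ :=
  ∑ M ∈ heckeIndex p, ∑ v : Fin r → ZMod p, ∑ w : Fin r → ZMod p,
    heckeTerm κ p φ M (liftTwo p v) (liftTwo p w) τ z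

variable {κ : ℤ} {p : ℕ} {φ : ℍ → (Fin r → ℂ) → ℂ}

theorem heckeTerm_add_smul (hφ : IsJacobiInvariant κ (latticeD r) φ) (hp : p.Prime)
    {M : ℤ × ℤ × ℤ} (hM : M ∈ heckeIndex p) {l m l' m' : Fin r → ℚ} (hm : m ∈ latticeD r)
    (hl' : l' ∈ latticeD r) (hm' : m' ∈ latticeD r) (τ : ℍ) (z : Fin r → ℂ) :
    heckeTerm κ p φ M (l + (p : ℚ) • l') (m + (p : ℚ) • m') τ z = heckeTerm κ p φ M l m τ z := by
  obtain ⟨a, b, d⟩ := M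
  obtain ⟨ha, hb, hbd, had, -⟩ := (mem_heckeIndex_iff hp).1 hM
  have hpl : (p : ℚ) • l' ∈ latticeD r := by
    rw [Nat.cast_smul_eq_nsmul]; exact nsmul_mem hl' p
  rw [add_comm l, add_comm m, ← heckeTerm_translate _ hpl hm,
    heckeTerm_smul hφ ha (hb.trans_lt hbd) had hl' hm',
    heckeTerm_translate _ (zero_mem _) hm, zero_add, zero_add]

theorem isPeriodicMod_right (hφ : IsJacobiInvariant κ (latticeD r) φ) (hp : p.Prime)
    {M : ℤ × ℤ × ℤ} (hM : M ∈ heckeIndex p) (l : Fin r → ℚ) (τ : ℍ)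
    (z : Fin r → ℂ) : IsPeriodicMod p fun m => heckeTerm κ p φ M l m τ z := fun m hm m' hm' => by
  simpa using heckeTerm_add_smul hφ hp hM (l := l) hm (zero_mem _) hm' τ z

variable [Fact p.Prime]

/-- Right multiplication by `S` permutes the matrices, and `(l, m) ↦ (m, -l)` permutes the pairs of
classes. -/
theorem heckeSum_S (hφ : IsJacobiInvariant κ (latticeD r) φ) (hp : p ≠ 2) (τ : ℍ)
    (z : Fin r → ℂ) :
    heckeSum κ p φ (ModularGroup.S • τ) (fun i => z i / (τ : ℂ))
      * e (-quadC z / τ) * (τ : ℂ) ^ (-κ) = heckeSum κ p φ τ z := by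
  have hp' : p.Prime := Fact.out
  obtain ⟨σ, hσ⟩ := exists_heckeIndex_perm hp'
  simp only [heckeSum, Finset.sum_mul]
  rw [← Finset.sum_coe_sort, ← Finset.sum_coe_sort (heckeIndex p), ← Equiv.sum_comp σ
    fun M : heckeIndex p => ∑ v : Fin r → ZMod p, ∑ w : Fin r → ZMod p,
      heckeTerm κ p φ M (liftTwo p v) (liftTwo p w) τ z]
  refine Finset.sum_congr rfl fun M _ => ?_
  obtain ⟨γ, hγ⟩ := hσ M
  have hterm : ∀ v w : Fin r → ZMod p,
      heckeTerm κ p φ M (liftTwo p v) (liftTwo p w) (ModularGroup.S • τ) (fun i => z i / (τ : ℂ))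
        * e (-quadC z / τ) * (τ : ℂ) ^ (-κ)
      = heckeTerm κ p φ (σ M) (liftTwo p w) (-liftTwo p v) τ z := by
    intro v w
    obtain ⟨h1, h2, h3, h4, -⟩ := (mem_heckeIndex_iff hp').1 M.2
    obtain ⟨h1', h2', h3', h4', -⟩ := (mem_heckeIndex_iff hp').1 (σ M).2
    exact heckeTerm_S hφ h1 (h2.trans_lt h3) h1' (h2'.trans_lt h3') h4' hγ (liftTwo_mem p v)
      (liftTwo_mem p w) τ z
  simp only [hterm]
  rw [Finset.sum_comm]
  exact Finset.sum_congr rfl fun w _ => (isPeriodicMod_right hφ hp' (σ M).2 _ τ z).sum_neg hp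

end

noncomputable section

variable {r : ℕ}

/-! ### Character sums -/

theorem sum_range_e {N : ℕ} (hN : 0 < N) (n : ℤ) :
    ∑ b ∈ Finset.range N, e (b * (n / N)) = if (N : ℤ) ∣ n then (N : ℂ) else 0 := by
  have hN0 : (N : ℂ) ≠ 0 := by exact_mod_cast hN.ne'
  simp only [e_nat_mul]
  split_ifs with h
  · obtain ⟨k, rfl⟩ := h
    have : e (((N * k : ℤ) : ℂ) / N) = 1 := by
      rw [← e_int k]; congr 1; push_cast; field_simp
    simp only [this, one_pow, Finset.sum_const, Finset.card_range, nsmul_eq_mul, mul_one]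
  · have h1 : e (n / N : ℂ) ≠ 1 := by
      intro h1
      obtain ⟨k, hk⟩ := (e_eq_one_iff _).1 h1
      rw [div_eq_iff hN0] at hk
      exact h ⟨k, by rw [mul_comm]; exact_mod_cast hk⟩
    rw [geom_sum_eq h1, ← e_nat_mul, mul_div_cancel₀ _ hN0, e_int, sub_self, zero_div]

variable {p : ℕ} [Fact p.Prime]

theorem e_int_div (j : ℤ) : e (j / p) = ZMod.stdAddChar (j : ZMod p) := by
  rw [ZMod.stdAddChar_coe, e]
  congr 1
  ring

/-- The quadratic character modulo `p` with values in `ℂ`. -/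
def quadChar (p : ℕ) [Fact p.Prime] : MulChar (ZMod p) ℂ :=
  (quadraticChar (ZMod p)).ringHomComp (Int.castRingHom ℂ)

theorem quadChar_int (a : ℤ) : quadChar p (a : ZMod p) = (jacobiSym a p : ℂ) := by
  rw [← jacobiSym.legendreSym.to_jacobiSym]
  rfl

theorem quadChar_zero : quadChar p 0 = 0 := MulChar.map_zero _

theorem isQuadratic_quadChar : (quadChar p).IsQuadratic :=
  (quadraticChar_isQuadratic _).comp _

theorem quadChar_ne_one (hp : p ≠ 2) : quadChar p ≠ 1 := by
  intro h
  refine quadraticChar_ne_one (F := ZMod p) (by rwa [ZMod.ringChar_zmod_n]) ?_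
  refine MulChar.ext fun a => ?_
  have h1 : quadChar p a = 1 := by rw [h, MulChar.one_apply_coe]
  have h2 : ((quadraticChar (ZMod p) a : ℤ) : ℂ) = ((1 : ℤ) : ℂ) := by
    rw [Int.cast_one]; exact h1
  rw [MulChar.one_apply_coe]
  exact_mod_cast h2

/-- The quadratic Gauss sum modulo `p`. -/
def gauss (p : ℕ) [Fact p.Prime] : ℂ := gaussSum (quadChar p) ZMod.stdAddChar

theorem gauss_sq (hp : p ≠ 2) : gauss p ^ 2 = ((jacobiSym (-1) p * (p : ℤ) : ℤ) : ℂ) := by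
  rw [gauss, gaussSum_sq (χ := quadChar p) (quadChar_ne_one hp) isQuadratic_quadChar
    (ZMod.isPrimitive_stdAddChar p), ZMod.card]
  push_cast
  rw [← quadChar_int]
  simp

theorem sum_quadChar_mul_stdAddChar (hp : p ≠ 2) (a : ZMod p) :
    ∑ t, quadChar p t * ZMod.stdAddChar (t * a) = quadChar p a * gauss p := by
  by_cases ha : a = 0
  · subst ha
    simp [MulChar.sum_eq_zero_of_ne_one (quadChar_ne_one hp), quadChar_zero]
  · have h := gaussSum_mulShift (quadChar p) ZMod.stdAddChar (Units.mk0 a ha)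
    rw [Units.val_mk0] at h
    have h1 : quadChar p a * quadChar p a = 1 := by
      rcases isQuadratic_quadChar (p := p) a with h0 | h0 | h0
      · exact absurd h0 ((Ne.isUnit ha).map (quadChar p)).ne_zero
      · rw [h0, one_mul]
      · rw [h0]; norm_num
    rw [gauss, ← h, ← mul_assoc, h1, one_mul, gaussSum]
    exact Finset.sum_congr rfl fun t _ => by rw [AddChar.mulShift_apply, mul_comm a]

/-- The number of square roots of `t` is `1 + χ(t)`; the constant part sums to zero and the rest is
a Gauss sum. -/
theorem sum_stdAddChar_sq (hp : p ≠ 2) {c : ZMod p} (hc : c ≠ 0) :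
    ∑ v : ZMod p, ZMod.stdAddChar (c * v ^ 2) = quadChar p c * gauss p := by
  classical
  rw [← Finset.sum_fiberwise Finset.univ (fun v : ZMod p => v ^ 2)]
  have h1 : ∀ t : ZMod p, ∑ v with v ^ 2 = t, (ZMod.stdAddChar (c * v ^ 2) : ℂ)
      = (quadChar p t + 1) * ZMod.stdAddChar (t * c) := by
    intro t
    have h2 := quadraticChar_card_sqrts (F := ZMod p) (by rwa [ZMod.ringChar_zmod_n]) t
    have h3 : ({v | v ^ 2 = t} : Set (ZMod p)).toFinset = Finset.univ.filter fun v => v ^ 2 = t := by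
      ext; simp
    rw [h3] at h2
    have h4 : ((Finset.univ.filter fun v : ZMod p => v ^ 2 = t).card : ℂ) = quadChar p t + 1 := by
      have := congrArg (Int.cast : ℤ → ℂ) h2
      push_cast at this
      exact this
    rw [← h4, ← nsmul_eq_mul, ← Finset.sum_const]
    refine Finset.sum_congr rfl fun v hv => ?_
    rw [(Finset.mem_filter.1 hv).2, mul_comm]
  simp only [h1, add_mul, one_mul, Finset.sum_add_distrib]
  rw [sum_quadChar_mul_stdAddChar hp, AddChar.sum_mulShift c (ZMod.isPrimitive_stdAddChar p),
    if_neg hc]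
  simp

theorem stdAddChar_sum {ι : Type*} (s : Finset ι) (f : ι → ZMod p) :
    (ZMod.stdAddChar (∑ i ∈ s, f i) : ℂ) = ∏ i ∈ s, ZMod.stdAddChar (f i) := by
  classical
  induction s using Finset.induction_on with
  | empty => simp
  | insert i s hi ih => rw [Finset.sum_insert hi, Finset.prod_insert hi, AddChar.map_add_eq_mul, ih]

theorem two_ne_zero_zmod (hp : p ≠ 2) : (2 : ZMod p) ≠ 0 := fun h => by
  have h1 := two_mul_half_zmod hp (1 : ZMod p)
  rw [h, zero_mul] at h1
  exact zero_ne_one h1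

/-- The substitution `v ↦ v + y/4` completes the square. -/
theorem sum_stdAddChar_quadratic (hp : p ≠ 2) {b : ZMod p} (hb : b ≠ 0) (y : ZMod p) :
    ∑ v : ZMod p, ZMod.stdAddChar (b * (2 * v ^ 2 - y * v))
      = quadChar p (2 * b) * gauss p * ZMod.stdAddChar (-(b * y ^ 2 / 8)) := by
  have h2 := two_ne_zero_zmod hp
  rw [← sum_stdAddChar_sq hp (mul_ne_zero h2 hb), Finset.sum_mul,
    ← Equiv.sum_comp (Equiv.addRight (y / 4))]
  refine Finset.sum_congr rfl fun v _ => ?_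
  rw [← AddChar.map_add_eq_mul, Equiv.coe_addRight]
  congr 1
  have h4 : (4 : ZMod p) ≠ 0 := by
    rw [show (4 : ZMod p) = 2 * 2 by norm_num]; exact mul_ne_zero h2 h2
  have h8 : (8 : ZMod p) ≠ 0 := by
    rw [show (8 : ZMod p) = 2 * 4 by norm_num]; exact mul_ne_zero h2 h4
  field_simp
  ring

theorem sum_Ico_eq_sum_zmod (g : ZMod p → ℂ) (hg : g 0 = 0) :
    ∑ b ∈ Finset.Ico 1 p, g (b : ZMod p) = ∑ b, g b := by
  have hp := (Fact.out : p.Prime).pos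
  have h1 : ∑ b ∈ Finset.range p, g (b : ZMod p) = ∑ b, g b := by
    refine Finset.sum_bij' (fun b _ => (b : ZMod p)) (fun b _ => b.val) (by simp)
      (fun b _ => Finset.mem_range.2 (ZMod.val_lt b)) (fun b hb => ?_) (fun b _ => ?_) (by simp)
    · exact ZMod.val_cast_of_lt (Finset.mem_range.1 hb)
    · exact ZMod.natCast_zmod_val b
  rw [← h1, Finset.range_eq_Ico, Finset.sum_eq_sum_Ico_succ_bot hp]
  simp [hg]

/-- The Gauss sum that appears in the Hecke operator. -/
theorem sum_sum_stdAddChar (hp : p ≠ 2) (hr : Odd r) (N : ZMod p) (y : Fin r → ZMod p) :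
    ∑ b ∈ Finset.Ico 1 p, ∑ v : Fin r → ZMod p,
      ZMod.stdAddChar ((b : ZMod p) * (N - ∑ i, y i * v i + 2 * ∑ i, v i ^ 2))
      = (gauss p ^ 2) ^ ((r + 1) / 2) * quadChar p 2 * quadChar p (N - (∑ i, y i ^ 2) / 8) := by
  -- The sum over `v` factors into `r` one-dimensional Gauss sums. As `r` is odd, one factor `χ(2b)`
  -- survives, so the sum over `b` is one more Gauss sum and the total power `r + 1` is even.
  have h1 : ∀ b ∈ Finset.Ico 1 p, ∑ v : Fin r → ZMod p,
      ZMod.stdAddChar ((b : ZMod p) * (N - ∑ i, y i * v i + 2 * ∑ i, v i ^ 2))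
      = quadChar p 2 * gauss p ^ r * (quadChar p (b : ZMod p)
        * ZMod.stdAddChar ((b : ZMod p) * (N - (∑ i, y i ^ 2) / 8))) := by
    intro b hb
    have hb0 : (b : ZMod p) ≠ 0 := by
      rw [Ne, ZMod.natCast_eq_zero_iff]
      intro h
      have := Finset.mem_Ico.1 hb
      exact absurd (Nat.le_of_dvd this.1 h) (not_le.2 this.2)
    have h2 : ∀ v : Fin r → ZMod p,
        (ZMod.stdAddChar ((b : ZMod p) * (N - ∑ i, y i * v i + 2 * ∑ i, v i ^ 2)) : ℂ)
        = ZMod.stdAddChar ((b : ZMod p) * N)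
          * ∏ i, ZMod.stdAddChar ((b : ZMod p) * (2 * v i ^ 2 - y i * v i)) := by
      intro v
      rw [← stdAddChar_sum, ← AddChar.map_add_eq_mul]
      congr 1
      rw [← Finset.mul_sum, Finset.sum_sub_distrib, ← Finset.mul_sum]
      ring
    have hq : quadChar p (2 * b) ^ r = quadChar p 2 * quadChar p b := by
      rw [← map_mul]
      obtain ⟨s, rfl⟩ := hr
      rw [pow_succ, pow_mul]
      rcases isQuadratic_quadChar (p := p) (2 * b) with h0 | h0 | h0 <;> rw [h0] <;> simp
    simp only [h2, ← Finset.mul_sum]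
    rw [← Fintype.prod_sum fun i (t : ZMod p) =>
      (ZMod.stdAddChar ((b : ZMod p) * (2 * t ^ 2 - y i * t)) : ℂ)]
    simp only [sum_stdAddChar_quadratic hp hb0]
    rw [Finset.prod_mul_distrib, Finset.prod_const, Finset.card_univ, Fintype.card_fin, mul_pow, hq,
      ← stdAddChar_sum, mul_sub, sub_eq_add_neg ((b : ZMod p) * N), AddChar.map_add_eq_mul]
    have : ∑ i, -((b : ZMod p) * y i ^ 2 / 8) = -((b : ZMod p) * ((∑ i, y i ^ 2) / 8)) := by
      rw [Finset.sum_neg_distrib, ← mul_div_assoc, Finset.mul_sum, Finset.sum_div]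
    rw [this]
    ring
  rw [Finset.sum_congr rfl h1, ← Finset.mul_sum, sum_Ico_eq_sum_zmod
    (fun b => quadChar p b * ZMod.stdAddChar (b * (N - (∑ i, y i ^ 2) / 8))) (by simp [quadChar_zero]),
    sum_quadChar_mul_stdAddChar hp]
  obtain ⟨s, rfl⟩ := hr
  have : (2 * s + 1 + 1) / 2 = s + 1 := by omega
  rw [this, ← pow_mul]
  ring

theorem jacobiSym_sq_mul {a b : ℤ} (ha : ¬ (p : ℤ) ∣ a) : jacobiSym (a ^ 2 * b) p = jacobiSym b p := by
  have hp : p.Prime := Fact.out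
  rw [jacobiSym.mul_left, jacobiSym.sq_one', one_mul]
  rw [Int.gcd_comm]
  exact (Nat.Prime.coprime_iff_not_dvd hp).2 fun h => ha (Int.natCast_dvd.2 h)

/-- Passing from `D` to `2 · 8D` multiplies by the square `16`, and the denominator of `D` is prime
to `p` because it divides `8`. -/
theorem legendreRat_eq (hp : p ≠ 2) {D : ℚ} {M : ℤ} (h : 8 * D = M) :
    legendreRat D p = jacobiSym (2 * M) p := by
  have hp' : p.Prime := Fact.out
  have h2 : ¬ (p : ℤ) ∣ 2 := fun h =>
    hp ((Nat.prime_dvd_prime_iff_eq hp' Nat.prime_two).1 (by exact_mod_cast h))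
  have h8 : ¬ (p : ℤ) ∣ 8 := fun h => by
    rw [show (8 : ℤ) = 2 ^ 3 by norm_num] at h
    exact h2 ((Nat.prime_iff_prime_int.1 hp').dvd_of_dvd_pow h)
  have h1 : 8 * D.num = M * D.den := by
    have h3 := Rat.num_div_den D
    have hd : (D.den : ℚ) ≠ 0 := by exact_mod_cast D.den_nz
    rw [← h3, ← mul_div_assoc, div_eq_iff hd] at h
    exact_mod_cast h
  have hden : ¬ (p : ℤ) ∣ D.den := fun hd => by
    have h3 : (p : ℤ) ∣ 8 * D.num := h1 ▸ hd.mul_left M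
    rcases (Nat.prime_iff_prime_int.1 hp').dvd_or_dvd h3 with h4 | h4
    · exact h8 h4
    · have h5 : p ∣ D.num.natAbs := Int.natCast_dvd.1 h4
      have h6 : p ∣ D.den := by exact_mod_cast hd
      have := Nat.dvd_gcd h5 h6
      rw [D.reduced] at this
      exact hp'.one_lt.ne' (Nat.dvd_one.1 this)
  rw [legendreRat, ← jacobiSym_sq_mul h8, ← jacobiSym_sq_mul (b := 2 * M) h2,
    ← jacobiSym_sq_mul (b := (2 : ℤ) ^ 2 * (2 * M)) hden]
  congr 1
  linear_combination (8 * (D.den : ℤ)) * h1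

end

noncomputable section

variable {r : ℕ} {κ : ℤ} {p : ℕ} {φ : ℍ → (Fin r → ℂ) → ℂ}
  {c : ℚ → (Fin r → ℚ) → ℂ}

/-! ### The Fourier expansion of the Hecke sum -/

theorem natCast_smul_mem (n : ℕ) {l : Fin r → ℚ} (hl : l ∈ latticeD r) : (n : ℚ) • l ∈ latticeD r := by
  rw [Nat.cast_smul_eq_nsmul]; exact nsmul_mem hl n

theorem smul_mem_dual (n : ℕ) {x : Fin r → ℚ} (hx : x ∈ dual (latticeD r)) :
    (n : ℚ) • x ∈ dual (latticeD r) := by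
  rw [Nat.cast_smul_eq_nsmul]; exact nsmul_mem hx n

theorem exists_two_mul_eq_int {x : Fin r → ℚ} (hx : x ∈ dual (latticeD r)) :
    ∃ y : Fin r → ℤ, ∀ i, 2 * x i = y i := by
  have : ∀ i, ∃ y : ℤ, 2 * x i = y := fun i => by
    obtain ⟨a, ha⟩ := hx _ (two_smul_single_mem i)
    exact ⟨a, by rw [← ha, bil_single]⟩
  exact ⟨fun i => (this i).choose, fun i => (this i).choose_spec⟩

theorem bil_liftTwo {x : Fin r → ℚ} {y : Fin r → ℤ} (hy : ∀ i, 2 * x i = y i)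
    (v : Fin r → ZMod p) : bil x (liftTwo p v) = ((∑ i, y i * ((v i).val : ℤ) : ℤ) : ℚ) := by
  push_cast
  exact Finset.sum_congr rfl fun i _ => by rw [liftTwo, ← hy i]; ring

theorem quad_liftTwo (v : Fin r → ZMod p) :
    quad (liftTwo p v) = ((2 * ∑ i, ((v i).val : ℤ) ^ 2 : ℤ) : ℚ) := by
  rw [quad, bil]
  push_cast
  rw [Finset.mul_sum, Finset.sum_div]
  exact Finset.sum_congr rfl fun i _ => by rw [liftTwo]; ring

theorem hasSum_heckeTerm (hc : IsFourierExpansion (latticeD r) φ c) {a b d : ℤ} (ha : 0 < a)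
    (hd : 0 < d) (l m : Fin r → ℚ) (τ : ℍ) (z : Fin r → ℂ) :
    HasSum (fun q : ℚ × (Fin r → ℚ) => (d : ℂ) ^ (-κ) * c q.1 q.2
        * e (q.1 * (b / d) + p / d * (bil q.2 m : ℂ))
        * e ((q.1 * (a / d) + p / d * (bil q.2 l : ℂ) + (quad l : ℂ)) * τ
          + (p / d * bilC q.2 z + bilC l z)))
      (heckeTerm κ p φ (a, b, d) l m τ z) := by
  have h := (((isFourierExpansion_iff hc.1).1 hc (ofComplex ((a * τ + b) / d))
    (fun i => p / d * (z i + (l i : ℂ) * τ + (m i : ℂ)))).mul_left ((d : ℂ) ^ (-κ))).mul_right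
    (e ((τ : ℂ) * (quad l : ℂ) + bilC l z))
  refine h.congr_fun fun q => ?_
  have h1 : bilC q.2 (fun i => p / d * (z i + (l i : ℂ) * τ + (m i : ℂ)))
      = p / d * (bilC q.2 z + (bil q.2 l : ℂ) * τ + (bil q.2 m : ℂ)) := by
    rw [← bilC_translate]
    simp only [bilC, Finset.mul_sum]
    exact Finset.sum_congr rfl fun i _ => by ring
  rw [h1, coe_ofComplex_upper ha hd, mul_assoc ((d : ℂ) ^ (-κ) * c q.1 q.2), ← e_add,
    ← mul_assoc ((d : ℂ) ^ (-κ)), mul_assoc ((d : ℂ) ^ (-κ) * c q.1 q.2), ← e_add]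
  congr 2
  ring

variable [Fact p.Prime]

theorem inv_smul_mem_dual_iff (hp : p ≠ 2) {x : Fin r → ℚ} (hx : x ∈ dual (latticeD r))
    {y : Fin r → ℤ} (hy : ∀ i, 2 * x i = y i) :
    (1 / (p : ℚ)) • x ∈ dual (latticeD r) ↔ ∀ i, (y i : ZMod p) = 0 := by
  have hp' : p.Prime := Fact.out
  have hp0 : (p : ℚ) ≠ 0 := by exact_mod_cast hp'.ne_zero
  simp only [ZMod.intCast_zmod_eq_zero_iff_dvd]
  constructor
  · intro h i
    obtain ⟨a, ha⟩ := h _ (two_smul_single_mem i)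
    rw [bil_single, Pi.smul_apply, smul_eq_mul] at ha
    refine ⟨a, ?_⟩
    have : (y i : ℚ) = p * a := by rw [← ha, ← hy i]; field_simp
    exact_mod_cast this
  · intro h l hl
    obtain ⟨k, hk⟩ := hx l hl
    obtain ⟨b, hb, -⟩ := id hl
    have h1 : 2 * k = ∑ i, b i * y i := by
      have : (2 * k : ℚ) = ∑ i, (b i : ℚ) * y i := by
        rw [← hk, bil, Finset.mul_sum]
        exact Finset.sum_congr rfl fun i _ => by rw [hb, ← hy]; ring
      exact_mod_cast this
    have h2 : (p : ℤ) ∣ 2 * k := by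
      rw [h1]
      exact Finset.dvd_sum fun i _ => (h i).mul_left _
    have h3 : (p : ℤ) ∣ k := by
      rcases (Nat.prime_iff_prime_int.1 hp').dvd_or_dvd h2 with h4 | h4
      · exact absurd ((Nat.prime_dvd_prime_iff_eq hp' Nat.prime_two).1 (by exact_mod_cast h4)) hp
      · exact h4
    obtain ⟨q, rfl⟩ := h3
    refine ⟨q, ?_⟩
    rw [bil_smul_right, hk]
    push_cast
    field_simp

open Classical in
-- Orthogonality of characters, coordinate by coordinate, detects divisibility of `x` by `p` in the
-- dual lattice.
theorem sum_e_bil_liftTwo (hp : p ≠ 2) {x : Fin r → ℚ} (hx : x ∈ dual (latticeD r)) :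
    ∑ w : Fin r → ZMod p, e ((bil x (liftTwo p w) : ℂ) / p)
      = if (1 / (p : ℚ)) • x ∈ dual (latticeD r) then (p : ℂ) ^ r else 0 := by
  obtain ⟨y, hy⟩ := exists_two_mul_eq_int hx
  have h1 : ∀ w : Fin r → ZMod p, e ((bil x (liftTwo p w) : ℂ) / p)
      = ∏ i, ZMod.stdAddChar (w i * (y i : ZMod p)) := fun w => by
    rw [bil_liftTwo hy, Rat.cast_intCast, e_int_div, ← stdAddChar_sum]
    congr 1
    push_cast
    exact Finset.sum_congr rfl fun i _ => by rw [ZMod.natCast_zmod_val, mul_comm]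
  simp only [h1]
  rw [← Fintype.prod_sum fun i (t : ZMod p) => (ZMod.stdAddChar (t * (y i : ZMod p)) : ℂ)]
  simp only [AddChar.sum_mulShift _ (ZMod.isPrimitive_stdAddChar p), ZMod.card]
  by_cases h : (1 / (p : ℚ)) • x ∈ dual (latticeD r)
  · rw [if_pos h]
    have h2 := (inv_smul_mem_dual_iff hp hx hy).1 h
    simp [h2]
  · rw [if_neg h]
    rw [inv_smul_mem_dual_iff hp hx hy] at h
    push Not at h
    obtain ⟨i, hi⟩ := h
    exact Finset.prod_eq_zero (Finset.mem_univ i) (by simp [hi])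

/-- `(m, x) ↦ (s²m, sx)`. -/
def scaleEquiv (s : ℚ) (hs : s ≠ 0) : ℚ × (Fin r → ℚ) ≃ ℚ × (Fin r → ℚ) where
  toFun q := (s ^ 2 * q.1, s • q.2)
  invFun q := (q.1 / s ^ 2, (1 / s) • q.2)
  left_inv q := by
    ext1
    · simp only; field_simp
    · simp only; rw [smul_smul, one_div, inv_mul_cancel₀ hs, one_smul]
  right_inv q := by
    ext1
    · simp only; field_simp
    · simp only; rw [smul_smul, one_div, mul_inv_cancel₀ hs, one_smul]

theorem bil_sub_self (x l : Fin r → ℚ) : bil (x - l) l = bil x l - 2 * quad l := by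
  rw [sub_eq_add_neg, bil_add_left, bil_neg_left, quad]; ring

theorem bilC_sub (x l : Fin r → ℚ) (z : Fin r → ℂ) : bilC (x - l) z = bilC x z - bilC l z := by
  rw [sub_eq_add_neg, bilC_add, bilC_neg, ← sub_eq_add_neg]

open Classical in
/-- The indicator function of `ℤ × D_r♯`. -/
def intDual (m : ℚ) (x : Fin r → ℚ) : ℂ := if (∃ a : ℤ, m = a) ∧ x ∈ dual (latticeD r) then 1 else 0

theorem natCast_ne_zero_of_prime : (p : ℚ) ≠ 0 ∧ (p : ℂ) ≠ 0 :=
  ⟨by exact_mod_cast (Fact.out : p.Prime).ne_zero, by exact_mod_cast (Fact.out : p.Prime).ne_zero⟩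

open Classical in
-- The sum over `b` selects integral `m` and the sum over `w` selects `x` in the dual lattice; the
-- sums are worth `p²` and `pʳ`. The translation by `l` disappears by invariance of the
-- coefficients.
theorem coeff_mul_sums (hp : p ≠ 2) (hC : IsCoeffFamily c) {l : Fin r → ℚ} (hl : l ∈ latticeD r)
    (m : ℚ) (x : Fin r → ℚ) :
    c (p ^ 2 * (m - bil x l + quad l)) ((p : ℚ) • (x - l))
      * ((∑ b ∈ Finset.range (p ^ 2), e (b * (((p ^ 2 * (m - bil x l + quad l) : ℚ) : ℂ) / p ^ 2)))
        * ∑ w : Fin r → ZMod p, e ((bil ((p : ℚ) • (x - l)) (liftTwo p w) : ℂ) / p))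
      = (p : ℂ) ^ (r + 2) * (intDual m x * c (p ^ 2 * m) ((p : ℚ) • x)) := by
  obtain ⟨hp0, hpC⟩ := natCast_ne_zero_of_prime (p := p)
  have hc : c (p ^ 2 * (m - bil x l + quad l)) ((p : ℚ) • (x - l))
      = c (p ^ 2 * m) ((p : ℚ) • x) := by
    rw [← hC.trans _ (natCast_smul_mem p hl) (p ^ 2 * m) ((p : ℚ) • x), bil_smul_left, bil_smul_right,
      quad_smul, smul_sub]
    congr 1
    ring
  by_cases h0 : c (p ^ 2 * m) ((p : ℚ) • x) = 0
  · rw [hc, h0]; ring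
  obtain ⟨⟨n, hn⟩, hx⟩ := hC.supp _ _ (hc ▸ h0)
  have h1 := sum_e_bil_liftTwo hp hx
  have h2 := sum_range_e (N := p ^ 2) (pow_pos (Fact.out : p.Prime).pos 2) n
  rw [hc, hn, h1]
  push_cast at h2 ⊢
  rw [h2, smul_smul, one_div, inv_mul_cancel₀ hp0, one_smul, intDual]
  have h3 : x - l ∈ dual (latticeD r) ↔ x ∈ dual (latticeD r) :=
    ⟨fun h => by simpa using add_mem h (mem_dual_of_mem hl),
      fun h => sub_mem h (mem_dual_of_mem hl)⟩
  by_cases h4 : x ∈ dual (latticeD r)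
  · rw [if_pos (h3.2 h4)]
    have h5 : (p : ℤ) ^ 2 ∣ n ↔ ∃ a : ℤ, m = a := by
      obtain ⟨s, hs⟩ := exists_bil_eq_int h4 hl
      obtain ⟨t, ht⟩ := exists_quad_eq_int hl
      rw [hs, ht] at hn
      constructor
      · rintro ⟨k, rfl⟩
        refine ⟨k + s - t, ?_⟩
        push_cast at hn ⊢
        have := mul_left_cancel₀ (pow_ne_zero 2 hp0) hn
        linarith
      · rintro ⟨a, rfl⟩
        refine ⟨a - s + t, ?_⟩
        exact_mod_cast hn.symm
    by_cases h6 : (p : ℤ) ^ 2 ∣ n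
    · rw [if_pos h6, if_pos ⟨h5.1 h6, h4⟩]; ring
    · rw [if_neg h6, if_neg fun h => h6 (h5.2 h.1)]; ring
  · rw [if_neg fun h => h4 (h3.1 h), if_neg (c := (∃ a : ℤ, m = a) ∧ _) fun h => h4 h.2]; ring

/-- The contribution of the matrices `(1, b; 0, p²)`. -/
theorem hasSum_hecke_first (hp : p ≠ 2) (hC : IsCoeffFamily c)
    (hc : IsFourierExpansion (latticeD r) φ c) (τ : ℍ) (z : Fin r → ℂ) :
    HasSum (fun q : ℚ × (Fin r → ℚ) => ((p : ℂ) ^ 2) ^ (-κ) * (p : ℂ) ^ (2 * r + 2)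
        * (intDual q.1 q.2 * c (p ^ 2 * q.1) ((p : ℚ) • q.2)) * e (q.1 * τ + bilC q.2 z))
      (∑ b ∈ Finset.range (p ^ 2), ∑ v : Fin r → ZMod p, ∑ w : Fin r → ZMod p,
        heckeTerm κ p φ (1, (b : ℤ), (p : ℤ) ^ 2) (liftTwo p v) (liftTwo p w) τ z) := by
  obtain ⟨hp0, hpC⟩ := natCast_ne_zero_of_prime (p := p)
  have hpos : (0 : ℤ) < (p : ℤ) ^ 2 := by
    have := (Fact.out : p.Prime).pos
    positivity
  rw [Finset.sum_comm]
  have key : ∀ v : Fin r → ZMod p, HasSum (fun q : ℚ × (Fin r → ℚ) =>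
      ((p : ℂ) ^ 2) ^ (-κ) * (p : ℂ) ^ (r + 2)
        * (intDual q.1 q.2 * c (p ^ 2 * q.1) ((p : ℚ) • q.2)) * e (q.1 * τ + bilC q.2 z))
      (∑ b ∈ Finset.range (p ^ 2), ∑ w : Fin r → ZMod p,
        heckeTerm κ p φ (1, (b : ℤ), (p : ℤ) ^ 2) (liftTwo p v) (liftTwo p w) τ z) := by
    intro v
    have h := hasSum_sum (s := Finset.range (p ^ 2)) fun b _ =>
      hasSum_sum (s := Finset.univ) fun (w : Fin r → ZMod p) _ =>
        hasSum_heckeTerm (κ := κ) (p := p) (b := (b : ℤ)) hc one_pos hpos (liftTwo p v)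
          (liftTwo p w) τ z
    rw [← ((heisenberg (liftTwo p v)).trans (scaleEquiv (p : ℚ) hp0)).hasSum_iff] at h
    refine h.congr_fun fun q => ?_
    simp only [Function.comp_apply, Equiv.trans_apply, heisenberg, scaleEquiv, Equiv.coe_fn_mk]
    have h2 := coeff_mul_sums hp hC (liftTwo_mem p v) q.1 q.2
    rw [mul_assoc (((p : ℂ) ^ 2) ^ (-κ)), ← h2, Finset.sum_mul_sum, Finset.mul_sum, Finset.mul_sum,
      Finset.sum_mul]
    refine Finset.sum_congr rfl fun b _ => ?_
    rw [Finset.mul_sum, Finset.mul_sum, Finset.sum_mul]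
    refine Finset.sum_congr rfl fun w _ => ?_
    rw [← mul_assoc, ← e_add]
    push_cast
    congr 1
    · congr 2
      field_simp
    · congr 1
      rw [bil_smul_left, bilC_smul, bil_sub_self, bilC_sub]
      push_cast
      field_simp
      ring
  -- The expansion no longer depends on `v`, so the sum over `v` contributes a further factor `pʳ`.
  have h := hasSum_sum (s := Finset.univ) fun (v : Fin r → ZMod p) _ => key v
  refine h.congr_fun fun q => ?_
  simp only [Finset.sum_const, Finset.card_univ, Fintype.card_pi, ZMod.card, Finset.prod_const,
    Fintype.card_fin, nsmul_eq_mul]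
  push_cast
  ring

/-- The contribution of the matrices `(p, b; 0, p)`. -/
theorem hasSum_hecke_second (hC : IsCoeffFamily c)
    (hc : IsFourierExpansion (latticeD r) φ c) (τ : ℍ) (z : Fin r → ℂ) :
    HasSum (fun q : ℚ × (Fin r → ℚ) => (p : ℂ) ^ (-κ) * (p : ℂ) ^ r
        * ((∑ b ∈ Finset.Ico 1 p, ∑ v : Fin r → ZMod p,
          e (b * ((q.1 - bil q.2 (liftTwo p v) + quad (liftTwo p v) : ℚ) : ℂ) / p)) * c q.1 q.2)
        * e (q.1 * τ + bilC q.2 z))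
      (∑ b ∈ Finset.Ico 1 p, ∑ v : Fin r → ZMod p, ∑ w : Fin r → ZMod p,
        heckeTerm κ p φ ((p : ℤ), (b : ℤ), (p : ℤ)) (liftTwo p v) (liftTwo p w) τ z) := by
  obtain ⟨hp0, hpC⟩ := natCast_ne_zero_of_prime (p := p)
  have hpos : (0 : ℤ) < (p : ℤ) := by exact_mod_cast (Fact.out : p.Prime).pos
  have key : ∀ (b : ℕ) (v w : Fin r → ZMod p), HasSum (fun q : ℚ × (Fin r → ℚ) =>
      (p : ℂ) ^ (-κ) * (e (b * ((q.1 - bil q.2 (liftTwo p v) + quad (liftTwo p v) : ℚ) : ℂ) / p)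
        * c q.1 q.2) * e (q.1 * τ + bilC q.2 z))
      (heckeTerm κ p φ ((p : ℤ), (b : ℤ), (p : ℤ)) (liftTwo p v) (liftTwo p w) τ z) := by
    intro b v w
    have h := hasSum_heckeTerm (κ := κ) (p := p) (b := (b : ℤ)) hc hpos hpos (liftTwo p v)
          (liftTwo p w) τ z
    rw [← (heisenberg (liftTwo p v)).hasSum_iff] at h
    refine h.congr_fun fun q => ?_
    simp only [Function.comp_apply, heisenberg, Equiv.coe_fn_mk]
    rw [hC.trans _ (liftTwo_mem p v)]
    by_cases h0 : c q.1 q.2 = 0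
    · simp [h0]
    -- For `d = p` the factor `p/d` is `1`, and `w` enters only through an integer in the exponent.
    obtain ⟨s, hs⟩ := exists_bil_eq_int (sub_mem (hC.supp _ _ h0).2
      (mem_dual_of_mem (liftTwo_mem p v))) (liftTwo_mem p w)
    rw [mul_comm (e _) (c q.1 q.2), ← mul_assoc, hs, bil_sub_self, bilC_sub]
    congr 1
    · congr 1
      refine (e_congr_int s ?_).symm
      push_cast
      field_simp
    · congr 1
      push_cast
      field_simp
      ring
  have h := hasSum_sum (s := Finset.Ico 1 p) fun b _ => hasSum_sum (s := Finset.univ) fun v _ =>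
    hasSum_sum (s := Finset.univ) fun (w : Fin r → ZMod p) _ => key b v w
  refine h.congr_fun fun q => ?_
  simp only [Finset.sum_const, Finset.card_univ, Fintype.card_pi, ZMod.card, Finset.prod_const,
    Fintype.card_fin, nsmul_eq_mul, Finset.sum_mul, Finset.mul_sum]
  push_cast
  refine Finset.sum_congr rfl fun b _ => Finset.sum_congr rfl fun v _ => ?_
  ring

/-- The contribution of the matrix `(p², 0; 0, 1)`. -/
theorem hasSum_hecke_third (hC : IsCoeffFamily c)
    (hc : IsFourierExpansion (latticeD r) φ c) (τ : ℍ) (z : Fin r → ℂ) :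
    HasSum (fun q : ℚ × (Fin r → ℚ) => (p : ℂ) ^ r
        * (∑ v : Fin r → ZMod p, c ((q.1 - bil q.2 (liftTwo p v) + quad (liftTwo p v)) / p ^ 2)
          ((1 / (p : ℚ)) • (q.2 - liftTwo p v)))
        * e (q.1 * τ + bilC q.2 z))
      (∑ v : Fin r → ZMod p, ∑ w : Fin r → ZMod p,
        heckeTerm κ p φ ((p : ℤ) ^ 2, 0, 1) (liftTwo p v) (liftTwo p w) τ z) := by
  obtain ⟨hp0, hpC⟩ := natCast_ne_zero_of_prime (p := p)
  have hpos : (0 : ℤ) < (p : ℤ) ^ 2 := by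
    have := (Fact.out : p.Prime).pos
    positivity
  have key : ∀ (v w : Fin r → ZMod p), HasSum (fun q : ℚ × (Fin r → ℚ) =>
      c ((q.1 - bil q.2 (liftTwo p v) + quad (liftTwo p v)) / p ^ 2)
          ((1 / (p : ℚ)) • (q.2 - liftTwo p v)) * e (q.1 * τ + bilC q.2 z))
      (heckeTerm κ p φ ((p : ℤ) ^ 2, 0, 1) (liftTwo p v) (liftTwo p w) τ z) := by
    intro v w
    have h := hasSum_heckeTerm (κ := κ) (p := p) (b := 0) hc hpos one_pos (liftTwo p v)
          (liftTwo p w) τ z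
    rw [← ((heisenberg (liftTwo p v)).trans (scaleEquiv (p : ℚ) hp0).symm).hasSum_iff] at h
    refine h.congr_fun fun q => ?_
    simp only [Function.comp_apply, Equiv.trans_apply, heisenberg, scaleEquiv, Equiv.coe_fn_mk,
      Equiv.coe_fn_symm_mk]
    by_cases h0 : c ((q.1 - bil q.2 (liftTwo p v) + quad (liftTwo p v)) / p ^ 2)
        ((1 / (p : ℚ)) • (q.2 - liftTwo p v)) = 0
    · rw [h0]; simp
    obtain ⟨s, hs⟩ := exists_bil_eq_int (hC.supp _ _ h0).2 (liftTwo_mem p w)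
    have h1 : e (((q.1 - bil q.2 (liftTwo p v) + quad (liftTwo p v)) / p ^ 2 : ℚ)
        * (((0 : ℤ) : ℂ) / ((1 : ℤ) : ℂ)) + p / ((1 : ℤ) : ℂ)
          * (bil ((1 / (p : ℚ)) • (q.2 - liftTwo p v)) (liftTwo p w) : ℂ)) = 1 := by
      rw [hs, ← e_int (p * s)]
      congr 1
      push_cast
      ring
    rw [h1, Int.cast_one, one_zpow, one_mul, mul_one, bil_smul_left, bil_sub_self, bilC_smul,
      bilC_sub]
    congr 2
    push_cast
    field_simp
    ring
  have h := hasSum_sum (s := Finset.univ) fun v _ =>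
    hasSum_sum (s := Finset.univ) fun (w : Fin r → ZMod p) _ => key v w
  refine h.congr_fun fun q => ?_
  simp only [Finset.sum_const, Finset.card_univ, Fintype.card_pi, ZMod.card, Finset.prod_const,
    Fintype.card_fin, nsmul_eq_mul, Finset.sum_mul, Finset.mul_sum]
  push_cast
  exact Finset.sum_congr rfl fun v _ => by ring

end

/-! ### The coefficients of the Hecke sum -/

noncomputable section

variable {r : ℕ} {κ : ℤ} {p : ℕ} [Fact p.Prime] {φ : ℍ → (Fin r → ℂ) → ℂ}
  {c : ℚ → (Fin r → ℚ) → ℂ}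

theorem two_not_dvd (hp : p ≠ 2) : ¬ (p : ℤ) ∣ 2 := fun h =>
  hp ((Nat.prime_dvd_prime_iff_eq Fact.out Nat.prime_two).1 (by exact_mod_cast h))

theorem exists_eight_mul_quad {x : Fin r → ℚ} {y : Fin r → ℤ} (hy : ∀ i, 2 * x i = y i) :
    8 * quad x = ((∑ i, y i ^ 2 : ℤ) : ℚ) := by
  rw [quad, bil]
  push_cast
  rw [Finset.sum_div, Finset.mul_sum]
  exact Finset.sum_congr rfl fun i _ => by rw [← hy]; ring

/-- With `y = 2x` the sum over `b` and `v` is the Gauss sum `sum_sum_stdAddChar`. The symbols agree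
because `2 · 8(m - β(x))` and `m - β(x)` differ by the square `16`. -/
theorem sum_sum_e_mul_coeff (hp : p ≠ 2) (hr : Odd r) (hC : IsCoeffFamily c) (m : ℚ)
    (x : Fin r → ℚ) :
    (∑ b ∈ Finset.Ico 1 p, ∑ v : Fin r → ZMod p,
        e (b * ((m - bil x (liftTwo p v) + quad (liftTwo p v) : ℚ) : ℂ) / p)) * c m x
      = ((jacobiSym (-1) p * (p : ℤ) : ℤ) : ℂ) ^ ((r + 1) / 2)
        * (jacobiSym (2 * 4) p : ℂ) * (legendreRat (m - quad x) p : ℂ) * c m x := by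
  by_cases h0 : c m x = 0
  · rw [h0, mul_zero, mul_zero]
  obtain ⟨⟨N, rfl⟩, hx⟩ := hC.supp _ _ h0
  obtain ⟨y, hy⟩ := exists_two_mul_eq_int hx
  congr 1
  have h1 : ∀ (b : ℕ) (v : Fin r → ZMod p),
      e (b * (((N : ℚ) - bil x (liftTwo p v) + quad (liftTwo p v) : ℚ) : ℂ) / p)
      = ZMod.stdAddChar ((b : ZMod p) * ((N : ZMod p) - ∑ i, (y i : ZMod p) * v i
        + 2 * ∑ i, v i ^ 2)) := fun b v => by
    rw [bil_liftTwo hy, quad_liftTwo]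
    have := e_int_div (p := p) (b * (N - ∑ i, y i * ((v i).val : ℤ) + 2 * ∑ i, ((v i).val : ℤ) ^ 2))
    push_cast at this ⊢
    rw [this]
    simp only [ZMod.natCast_zmod_val]
  simp only [h1]
  rw [sum_sum_stdAddChar hp hr, gauss_sq hp]
  have h8 : 8 * ((N : ℚ) - quad x) = ((8 * N - ∑ i, y i ^ 2 : ℤ) : ℚ) := by
    rw [mul_sub, exists_eight_mul_quad hy]
    push_cast
    ring
  have h2 := two_ne_zero_zmod hp
  rw [legendreRat_eq hp h8]
  have h4 : (2 : ZMod p) ^ 3 = 8 := by norm_num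
  have h3 : ((2 * (8 * N - ∑ i, y i ^ 2) : ℤ) : ZMod p)
      = ((4 ^ 2 * 1 : ℤ) : ZMod p) * ((N : ZMod p) - (∑ i, (y i : ZMod p) ^ 2) / 8) := by
    have h8' : (8 : ZMod p) ≠ 0 := h4 ▸ pow_ne_zero 3 h2
    push_cast
    field_simp
    ring
  have h5 : ¬ (p : ℤ) ∣ 4 := fun h => by
    rw [show (4 : ℤ) = 2 ^ 2 by norm_num] at h
    exact two_not_dvd hp ((Nat.prime_iff_prime_int.1 Fact.out).dvd_of_dvd_pow h)
  have h6 : (jacobiSym (2 * (8 * N - ∑ i, y i ^ 2)) p : ℂ)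
      = quadChar p ((N : ZMod p) - (∑ i, (y i : ZMod p) ^ 2) / 8) := by
    rw [← quadChar_int, h3, map_mul, quadChar_int (p := p) (4 ^ 2 * 1), jacobiSym_sq_mul h5,
      jacobiSym.one_left]
    push_cast
    ring
  have h7 : (jacobiSym (2 * 4) p : ℂ) = quadChar p 2 := by
    rw [show (2 * 4 : ℤ) = 2 ^ 2 * 2 by norm_num, jacobiSym_sq_mul (two_not_dvd hp),
      ← quadChar_int (p := p) 2]
    push_cast
    rfl
  rw [h6, h7]

/-- The sum over `D_r / p D_r` in the Hecke operator. -/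
def cosetSum (p : ℕ) [NeZero p] (c : ℚ → (Fin r → ℚ) → ℂ) (m : ℚ) (x : Fin r → ℚ) : ℂ :=
  ∑ v : Fin r → ZMod p, c ((m - bil x (liftTwo p v) + quad (liftTwo p v)) / p ^ 2)
    ((1 / (p : ℚ)) • (x - liftTwo p v))

/-- The Fourier coefficients of `φ | T^J(p)`. -/
def heckeCoeff (κ : ℤ) (p : ℕ) [NeZero p] (c : ℚ → (Fin r → ℚ) → ℂ) (m : ℚ) (x : Fin r → ℚ) : ℂ :=
  -- The indicator is needed off `ℤ × D_r♯`, where `c(p²m, px)` may be nonzero although the new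
  -- coefficient has to vanish.
  intDual m x * c (p ^ 2 * m) ((p : ℚ) • x)
    + (p : ℂ) ^ (κ - r - 2) * (((jacobiSym (-1) p * (p : ℤ) : ℤ) : ℂ) ^ ((r + 1) / 2)
        * (jacobiSym (2 * 4) p : ℂ) * (legendreRat (m - quad x) p : ℂ) * c m x)
    + (p : ℂ) ^ (2 * κ - r - 2) * cosetSum p c m x

theorem isPeriodicMod_coeff (hC : IsCoeffFamily c) (m : ℚ) (x : Fin r → ℚ) :
    IsPeriodicMod p fun l => c ((m - bil x l + quad l) / p ^ 2) ((1 / (p : ℚ)) • (x - l)) := by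
  intro l hl n hn
  obtain ⟨hp0, -⟩ := natCast_ne_zero_of_prime (p := p)
  simp only
  rw [← hC.trans n hn _ ((1 / (p : ℚ)) • (x - l))]
  congr 1
  · rw [bil_add_right, bil_smul_right, bil_smul_left, quad_add, bil_smul_right, quad_smul,
      sub_eq_add_neg x l, bil_add_left, bil_neg_left]
    field_simp
    ring
  · rw [← sub_sub, smul_sub (1 / (p : ℚ)) (x - l), smul_smul, one_div, inv_mul_cancel₀ hp0, one_smul]

theorem jacobiHeckeCoeff_eq (hp : p ≠ 2) (hr : 0 < r) (hC : IsCoeffFamily c) {m : ℤ}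
    {x : Fin r → ℚ} (hx : x ∈ dual (latticeD r)) :
    jacobiHeckeCoeff κ (latticeD r) p c m x = heckeCoeff κ p c m x := by
  rw [jacobiHeckeCoeff, (isPeriodicMod_coeff hC m x).finsum_eq hp, relIndex_latticeD hr, heckeCoeff,
    cosetSum, intDual, if_pos ⟨⟨m, rfl⟩, hx⟩]
  push_cast
  ring

/-- The normalising power of `p` is the one that cancels `p^(-2κ) p^(2r+2)` in the contribution of
the matrices `(1, b; 0, p²)`; the powers in the other two contributions follow. -/
theorem hasSum_heckeSum (hp : p ≠ 2) (hr : Odd r) (hC : IsCoeffFamily c)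
    (hc : IsFourierExpansion (latticeD r) φ c) (τ : ℍ) (z : Fin r → ℂ) :
    HasSum (fun q : ℚ × (Fin r → ℚ) => heckeCoeff κ p c q.1 q.2 * e (q.1 * τ + bilC q.2 z))
      ((p : ℂ) ^ (2 * κ - 2 - 2 * r) * heckeSum κ p φ τ z) := by
  obtain ⟨hp0, hpC⟩ := natCast_ne_zero_of_prime (p := p)
  have hp' : p.Prime := Fact.out
  have h1 : heckeSum κ p φ τ z
      = (∑ b ∈ Finset.range (p ^ 2), ∑ v : Fin r → ZMod p, ∑ w : Fin r → ZMod p,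
        heckeTerm κ p φ (1, (b : ℤ), (p : ℤ) ^ 2) (liftTwo p v) (liftTwo p w) τ z)
      + ((∑ b ∈ Finset.Ico 1 p, ∑ v : Fin r → ZMod p, ∑ w : Fin r → ZMod p,
        heckeTerm κ p φ ((p : ℤ), (b : ℤ), (p : ℤ)) (liftTwo p v) (liftTwo p w) τ z)
      + ∑ v : Fin r → ZMod p, ∑ w : Fin r → ZMod p,
        heckeTerm κ p φ ((p : ℤ) ^ 2, 0, 1) (liftTwo p v) (liftTwo p w) τ z) := by
    have hp1 : (p : ℤ) ≠ 1 := fun h => hp'.one_lt.ne' (by exact_mod_cast h)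
    have hp2 : (1 : ℤ) ≠ (p : ℤ) ^ 2 := fun h => by
      have := hp'.one_lt
      have : (1 : ℤ) < p := by exact_mod_cast this
      nlinarith
    rw [heckeSum, heckeIndex, Finset.sum_union, Finset.sum_union, Finset.sum_image,
      Finset.sum_image, Finset.sum_singleton]
    · intro a _ b _ h; simpa using h
    · intro a _ b _ h; simpa using h
    · rw [Finset.disjoint_left]
      intro q h
      obtain ⟨b, -, rfl⟩ := Finset.mem_image.1 h
      simp [hp1]
    · rw [Finset.disjoint_left]
      intro q h
      obtain ⟨b, -, rfl⟩ := Finset.mem_image.1 h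
      simp [hp1, hp2]
  rw [h1]
  refine ((((hasSum_hecke_first hp hC hc τ z).add
    ((hasSum_hecke_second hC hc τ z).add (hasSum_hecke_third hC hc τ z))).mul_left
      ((p : ℂ) ^ (2 * κ - 2 - 2 * r)))).congr_fun fun q => ?_
  rw [sum_sum_e_mul_coeff hp hr hC, heckeCoeff, cosetSum]
  have e1 : (p : ℂ) ^ (2 * κ - 2 - 2 * r) * (((p : ℂ) ^ 2) ^ (-κ) * (p : ℂ) ^ (2 * r + 2)) = 1 := by
    rw [← zpow_natCast (p : ℂ) 2, ← zpow_mul, ← zpow_natCast, ← zpow_add₀ hpC, ← zpow_add₀ hpC,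
      ← zpow_zero (p : ℂ)]
    congr 1
    push_cast
    ring
  have e2 : (p : ℂ) ^ (2 * κ - 2 - 2 * r) * ((p : ℂ) ^ (-κ) * (p : ℂ) ^ r)
      = (p : ℂ) ^ (κ - r - 2) := by
    rw [← zpow_natCast, ← zpow_add₀ hpC, ← zpow_add₀ hpC]
    congr 1
    ring
  have e3 : (p : ℂ) ^ (2 * κ - 2 - 2 * r) * (p : ℂ) ^ r = (p : ℂ) ^ (2 * κ - r - 2) := by
    rw [← zpow_natCast, ← zpow_add₀ hpC]
    congr 1
    ring
  rw [← e2, ← e3]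
  linear_combination (-(intDual q.1 q.2 * c (p ^ 2 * q.1) ((p : ℚ) • q.2))
    * e (q.1 * τ + bilC q.2 z)) * e1

end

/-! ### The Hecke image is a Jacobi form -/

noncomputable section

variable {r : ℕ} {κ : ℤ} {p : ℕ} [Fact p.Prime] {φ : ℍ → (Fin r → ℂ) → ℂ}
  {c : ℚ → (Fin r → ℚ) → ℂ}

theorem intDual_of_not {m : ℚ} {x : Fin r → ℚ} (h : ¬ ((∃ a : ℤ, m = a) ∧ x ∈ dual (latticeD r))) :
    intDual m x = 0 := if_neg h

theorem intDual_trans {l : Fin r → ℚ} (hl : l ∈ latticeD r) (m : ℚ) (x : Fin r → ℚ) :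
    intDual (m - bil x l + quad l) (x - l) = intDual m x := by
  have h3 : x - l ∈ dual (latticeD r) ↔ x ∈ dual (latticeD r) :=
    ⟨fun h => by simpa using add_mem h (mem_dual_of_mem hl),
      fun h => sub_mem h (mem_dual_of_mem hl)⟩
  unfold intDual
  rw [h3]
  by_cases hx : x ∈ dual (latticeD r)
  · obtain ⟨s, hs⟩ := exists_bil_eq_int hx hl
    obtain ⟨t, ht⟩ := exists_quad_eq_int hl
    have : (∃ a : ℤ, m - bil x l + quad l = a) ↔ ∃ a : ℤ, m = a := by
      rw [hs, ht]
      constructor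
      · rintro ⟨a, ha⟩
        exact ⟨a + s - t, by push_cast; linarith⟩
      · rintro ⟨a, rfl⟩
        exact ⟨a - s + t, by push_cast; ring⟩
    rw [this]
  · rw [if_neg fun h => hx h.2, if_neg fun h => hx h.2]

theorem intDual_neg (m : ℚ) (x : Fin r → ℚ) : intDual m (-x) = intDual m x := by
  unfold intDual
  rw [neg_mem_iff]

theorem coeff_smul_trans (hC : IsCoeffFamily c) (n : ℕ) {l : Fin r → ℚ} (hl : l ∈ latticeD r)
    (m : ℚ) (x : Fin r → ℚ) :
    c (n ^ 2 * (m - bil x l + quad l)) ((n : ℚ) • (x - l)) = c (n ^ 2 * m) ((n : ℚ) • x) := by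
  rw [← hC.trans _ (natCast_smul_mem n hl) (n ^ 2 * m) ((n : ℚ) • x), bil_smul_left, bil_smul_right,
    quad_smul, smul_sub]
  congr 1
  ring

theorem smul_inv_smul (x : Fin r → ℚ) : (p : ℚ) • (1 / (p : ℚ)) • x = x := by
  rw [smul_smul, mul_one_div_cancel natCast_ne_zero_of_prime.1, one_smul]

theorem cosetSum_trans (hp : p ≠ 2) (hC : IsCoeffFamily c) {l : Fin r → ℚ} (hl : l ∈ latticeD r)
    (m : ℚ) (x : Fin r → ℚ) : cosetSum p c (m - bil x l + quad l) (x - l) = cosetSum p c m x := by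
  rw [cosetSum, cosetSum, ← (isPeriodicMod_coeff hC m x).sum_add hp hl]
  refine Finset.sum_congr rfl fun v _ => ?_
  have h1 : bil (x - l) (liftTwo p v) = bil x (liftTwo p v) - bil (liftTwo p v) l := by
    rw [sub_eq_add_neg, bil_add_left, bil_neg_left, bil_comm l]; ring
  rw [h1, bil_add_right, quad_add, sub_sub, add_comm l]
  congr 1
  ring

theorem cosetSum_neg (hp : p ≠ 2) (hC : IsCoeffFamily c) (m : ℚ) (x : Fin r → ℚ) :
    cosetSum p c m (-x) = cosetSum p c m x := by
  rw [cosetSum, cosetSum, ← (isPeriodicMod_coeff hC m x).sum_neg hp]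
  refine Finset.sum_congr rfl fun v _ => ?_
  rw [← hC.even, bil_neg_left, bil_neg_right, quad_neg]
  congr 1
  module

theorem cosetSum_ne_zero (hC : IsCoeffFamily c) {m : ℚ} {x : Fin r → ℚ} (h : cosetSum p c m x ≠ 0) :
    ((∃ a : ℤ, m = a) ∧ x ∈ dual (latticeD r)) ∧ 0 ≤ m - quad x := by
  obtain ⟨v, -, hv⟩ := Finset.exists_ne_zero_of_sum_ne_zero h
  obtain ⟨hp0, -⟩ := natCast_ne_zero_of_prime (p := p)
  obtain ⟨⟨a, ha⟩, h2⟩ := hC.supp _ _ hv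
  have h3 := hC.nonneg _ _ hv
  have h4 : x - liftTwo p v ∈ dual (latticeD r) := by
    simpa only [smul_inv_smul] using smul_mem_dual p h2
  have h5 : x ∈ dual (latticeD r) := by
    simpa using add_mem h4 (mem_dual_of_mem (liftTwo_mem p v))
  obtain ⟨s, hs⟩ := exists_bil_eq_int h5 (liftTwo_mem p v)
  obtain ⟨t, ht⟩ := exists_quad_eq_int (liftTwo_mem p v)
  refine ⟨⟨⟨p ^ 2 * a + s - t, ?_⟩, h5⟩, ?_⟩
  · rw [hs, ht, div_eq_iff (pow_ne_zero 2 hp0)] at ha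
    push_cast
    linarith
  · rw [quad_smul, quad_sub] at h3
    have h6 : (m - quad x) / (p : ℚ) ^ 2 = (m - bil x (liftTwo p v) + quad (liftTwo p v)) / p ^ 2
        - (1 / (p : ℚ)) ^ 2 * (quad x - bil x (liftTwo p v) + quad (liftTwo p v)) := by
      field_simp
      ring
    rw [← h6] at h3
    have h7 : (0 : ℚ) < (p : ℚ) ^ 2 := by positivity
    have h8 := mul_nonneg h3 h7.le
    rwa [div_mul_cancel₀ _ h7.ne'] at h8

/-- Elliptic invariance, the support condition and, through the theta components, holomorphy of the
image all follow from these properties of its coefficients. -/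
theorem IsCoeffFamily.heckeCoeff (hp : p ≠ 2) (hC : IsCoeffFamily c) :
    IsCoeffFamily (heckeCoeff κ p c) where
  supp m x h := by
    by_contra hn
    refine h ?_
    rw [JacobiD.heckeCoeff, intDual_of_not hn, not_imp_comm.1 (hC.supp m x) hn,
      not_imp_comm.1 (fun h => (cosetSum_ne_zero (p := p) hC (m := m) (x := x) h).1) hn]
    ring
  trans l hl m x := by
    have : m - bil x l + quad l - quad (x - l) = m - quad x := by rw [quad_sub]; ring
    rw [JacobiD.heckeCoeff, JacobiD.heckeCoeff, cosetSum_trans hp hC hl, hC.trans l hl,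
      intDual_trans hl, coeff_smul_trans hC p hl, this]
  even m x := by
    rw [JacobiD.heckeCoeff, JacobiD.heckeCoeff, cosetSum_neg hp hC, hC.even,
      intDual_neg, smul_neg, hC.even, quad_neg]
  nonneg m x h := by
    by_contra hn
    refine h ?_
    have h1 : c (p ^ 2 * m) ((p : ℚ) • x) = 0 := by
      refine not_imp_comm.1 (hC.nonneg _ _) ?_
      rw [quad_smul, ← mul_sub]
      have h7 : (0 : ℚ) < (p : ℚ) ^ 2 := by
        have := natCast_ne_zero_of_prime (p := p)
        have := this.1
        positivity
      rwa [mul_nonneg_iff_of_pos_left h7]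
    rw [JacobiD.heckeCoeff, h1, not_imp_comm.1 (hC.nonneg m x) hn,
      not_imp_comm.1 (fun h => (cosetSum_ne_zero (p := p) hC (m := m) (x := x) h).2) hn]
    ring

theorem jacobiHecke_eq (hp : p ≠ 2) (hr : Odd r) (hC : IsCoeffFamily c)
    (hc : IsFourierExpansion (latticeD r) φ c) :
    jacobiHecke κ (latticeD r) p φ
      = fun τ z => (p : ℂ) ^ (2 * κ - 2 - 2 * r) * heckeSum κ p φ τ z := by
  funext τ z
  rw [jacobiHecke, hc.fourierCoeff_eq]
  have h := hasSum_heckeSum (κ := κ) hp hr hC hc τ z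
  rw [← hasSum_int_dual_iff (L := latticeD r)] at h
  · rw [← h.tsum_eq]
    refine tsum_congr fun q => ?_
    rw [jacobiHeckeCoeff_eq hp hr.pos hC q.2.2]
    norm_cast
  · exact fun q hq => (hC.heckeCoeff hp).supp _ _ (left_ne_zero_of_mul hq)

theorem isFourierExpansion_jacobiHecke (hp : p ≠ 2) (hr : Odd r) (hC : IsCoeffFamily c)
    (hc : IsFourierExpansion (latticeD r) φ c) :
    IsFourierExpansion (latticeD r) (jacobiHecke κ (latticeD r) p φ) (heckeCoeff κ p c) := by
  rw [jacobiHecke_eq hp hr hC hc, isFourierExpansion_iff (hC.heckeCoeff hp).supp]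
  exact hasSum_heckeSum hp hr hC hc

theorem IsFourierExpansion.T_smul (hc : IsFourierExpansion (latticeD r) φ c) (τ : ℍ)
    (z : Fin r → ℂ) : φ (ModularGroup.T • τ) z = φ τ z := by
  refine (hc.2 (ModularGroup.T • τ) z).unique ((hc.2 τ z).congr_fun fun q => ?_)
  congr 1
  refine e_congr_int q.1 ?_
  rw [coe_T_smul]
  ring

/-- Only the law under `S` needs the description by matrices; the law under `T` and the elliptic law
come from the Fourier expansion. -/
theorem jacobiHecke_mem (hp : p ≠ 2) (hr : Odd r) (hκ : Even κ)
    (hφ : φ ∈ jacobiForms κ (latticeD r)) :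
    jacobiHecke κ (latticeD r) p φ ∈ jacobiForms κ (latticeD r) := by
  obtain ⟨h, c, hc, -⟩ := id hφ
  have hC := isCoeffFamily_of_mem hκ hφ hc
  have hH := isFourierExpansion_jacobiHecke (κ := κ) hp hr hC hc
  have hCH := hC.heckeCoeff (κ := κ) hp
  have hs := hH.compSummable hr.pos
  have hd := hCH.mdifferentiable_comp hs
  refine ⟨⟨?_, modular_of_S_T (fun τ z => ?_) hH.T_smul,
    fun l hl m hm τ z => hH.elliptic hCH.trans hl hm τ z⟩, _, hH, hCH.nonneg⟩
  · have h1 : jacobiHecke κ (latticeD r) p φ = thetaCombination (compG (heckeCoeff κ p c))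
        (compU (heckeCoeff κ p c)) (compW (heckeCoeff κ p c)) := by
      funext τ z
      exact (hH.2 τ z).unique ((hCH.isFourierExpansion hr hs).2 τ z)
    rw [h1]
    exact differentiableOn_thetaCombination ((hd 0).add (hd 2)) ((hd 0).sub (hd 2))
      ((hd 1).add (hd 3))
  · rw [jacobiHecke_eq hp hr hC hc]
    beta_reduce
    rw [← heckeSum_S h hp τ z]
    ring

end

noncomputable section

variable {r : ℕ} {κ : ℤ} {p : ℕ} [Fact p.Prime] {φ : ℍ → (Fin r → ℂ) → ℂ}
  {c : ℚ → (Fin r → ℚ) → ℂ}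

/-! ### Comparison of the Hecke operators -/

theorem four_smul_mem {x : Fin r → ℚ} (hx : x ∈ dual (latticeD r)) :
    (4 : ℚ) • x ∈ latticeD r := by
  obtain ⟨y, hy⟩ := exists_two_mul_eq_int hx
  refine ⟨fun i => 2 * y i, fun i => ?_, ?_⟩
  · rw [Pi.smul_apply, smul_eq_mul]
    push_cast
    rw [← hy]
    ring
  · rw [← Finset.mul_sum]
    exact even_two_mul _

/-- An odd `n` is `±1` modulo `4`, and `4 D_r♯` lies in `D_r`. -/
theorem odd_smul_sub_mem_or {n : ℕ} (hn : Odd n) {x : Fin r → ℚ} (hx : x ∈ dual (latticeD r)) :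
    (n : ℚ) • x - x ∈ latticeD r ∨ (n : ℚ) • x + x ∈ latticeD r := by
  obtain ⟨m, rfl⟩ := hn
  rcases Nat.even_or_odd' m with ⟨s, rfl | rfl⟩
  · left
    have := natCast_smul_mem s (four_smul_mem hx)
    rw [smul_smul] at this
    convert this using 1
    push_cast
    module
  · right
    have := natCast_smul_mem (s + 1) (four_smul_mem hx)
    rw [smul_smul] at this
    convert this using 1
    push_cast
    module

theorem IsCoeffFamily.eq_of_sub_mem_or (hC : IsCoeffFamily c) {j : Fin 4} {x : Fin r → ℚ}
    (hx : x - rep r j ∈ latticeD r ∨ x + rep r j ∈ latticeD r) (N : ℚ) :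
    c (N + quad x) x = c (N + quad (rep r j)) (rep r j) := by
  rcases hx with hx | hx
  · exact hC.eq_rep hx N
  · rw [← hC.even, ← quad_neg x]
    refine hC.eq_rep ?_ N
    rw [← neg_add']
    exact neg_mem hx

theorem exists_eight_mul_of_prime (hp : p ≠ 2) : ∃ s : ℕ, p ^ 2 = 8 * s + 1 := by
  obtain ⟨m, hm⟩ := odd_of_prime_ne_two hp
  obtain ⟨s, hs⟩ := Nat.even_mul_succ_self m
  refine ⟨s, ?_⟩
  rw [hm]
  have : m * (m + 1) = s + s := hs
  nlinarith

/-- The vector `p v_j` is congruent to `±v_j`, and `p² ≡ 1` modulo `8` makes `n/8 + β(v_j)` integral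
whenever `p²n/8 + β(v_j)` is. -/
theorem intDual_mul_coeff_smul (hp : p ≠ 2) (hr : 0 < r) (hC : IsCoeffFamily c) (n : ℕ)
    (j : Fin 4) :
    intDual (n / 8 + quad (rep r j)) (rep r j)
        * c (p ^ 2 * (n / 8 + quad (rep r j))) ((p : ℚ) • rep r j)
      = c (((p ^ 2 * n : ℕ) : ℚ) / 8 + quad (rep r j)) (rep r j) := by
  have h1 : (p : ℚ) ^ 2 * (n / 8 + quad (rep r j))
      = ((p ^ 2 * n : ℕ) : ℚ) / 8 + quad ((p : ℚ) • rep r j) := by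
    rw [quad_smul]; push_cast; ring
  rw [h1, hC.eq_of_sub_mem_or (odd_smul_sub_mem_or (odd_of_prime_ne_two hp) (rep_mem_dual hr j))]
  by_cases h0 : c (((p ^ 2 * n : ℕ) : ℚ) / 8 + quad (rep r j)) (rep r j) = 0
  · rw [h0, mul_zero]
  obtain ⟨⟨a, ha⟩, -⟩ := hC.supp _ _ h0
  obtain ⟨s, hs⟩ := exists_eight_mul_of_prime hp
  have h2 : (n : ℚ) / 8 + quad (rep r j) = ((a - s * n : ℤ) : ℚ) := by
    rw [hs] at ha
    push_cast at ha ⊢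
    linarith
  rw [intDual, if_pos ⟨⟨_, h2⟩, rep_mem_dual hr j⟩, one_mul]

/-- Exactly one class `v` modulo `p` makes `(v_j - 2v)/p` a dual vector, namely `v ≡ v_j / 2`. That
dual vector is again congruent to `±v_j`. -/
theorem cosetSum_rep (hp : p ≠ 2) (hr : 0 < r) (hC : IsCoeffFamily c) (N : ℚ) (j : Fin 4) :
    cosetSum p c (N + quad (rep r j)) (rep r j)
      = c (N / p ^ 2 + quad (rep r j)) (rep r j) := by
  obtain ⟨hp0, -⟩ := natCast_ne_zero_of_prime (p := p)
  obtain ⟨y, hy⟩ := exists_two_mul_eq_int (rep_mem_dual hr j)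
  have h4 : (4 : ZMod p) ≠ 0 := by
    have := pow_ne_zero 2 (two_ne_zero_zmod hp)
    norm_num at this
    exact this
  have hmem : ∀ v : Fin r → ZMod p, (1 / (p : ℚ)) • (rep r j - liftTwo p v) ∈ dual (latticeD r) ↔
      v = fun i => (y i : ZMod p) / 4 := fun v => by
    rw [inv_smul_mem_dual_iff hp (sub_mem (rep_mem_dual hr j) (mem_dual_of_mem (liftTwo_mem p v)))
      (y := fun i => y i - 4 * ((v i).val : ℤ)), funext_iff]
    · refine forall_congr' fun i => ?_
      push_cast
      rw [ZMod.natCast_zmod_val, sub_eq_zero, eq_div_iff h4, mul_comm, eq_comm]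
    · intro i
      rw [Pi.sub_apply, mul_sub, hy, liftTwo]
      push_cast
      ring
  set v₀ : Fin r → ZMod p := fun i => (y i : ZMod p) / 4 with hv₀
  rw [cosetSum, Finset.sum_eq_single v₀ (fun v _ hv => ?_) (fun h => absurd (Finset.mem_univ _) h)]
  · set w := (1 / (p : ℚ)) • (rep r j - liftTwo p v₀) with hw
    have hwd : w ∈ dual (latticeD r) := (hmem v₀).2 rfl
    have hpw : (p : ℚ) • w = rep r j - liftTwo p v₀ := smul_inv_smul _
    have h1 : (N + quad (rep r j) - bil (rep r j) (liftTwo p v₀) + quad (liftTwo p v₀)) / (p : ℚ) ^ 2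
        = N / p ^ 2 + quad w := by
      rw [hw, quad_smul, quad_sub]
      field_simp
      ring
    rw [h1]
    refine hC.eq_of_sub_mem_or ?_ _
    rcases odd_smul_sub_mem_or (odd_of_prime_ne_two hp) hwd with h | h <;> rw [hpw] at h
    · left
      have := neg_mem (add_mem h (liftTwo_mem p v₀))
      convert this using 1
      abel
    · right
      have := add_mem h (liftTwo_mem p v₀)
      convert this using 1
      abel
  · exact not_imp_comm.1 (fun h => (hC.supp _ _ h).2) (mt (hmem v).1 hv)

theorem coeff_div_sq (hr : 0 < r) (hC : IsCoeffFamily c) (n : ℕ) (j : Fin 4) :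
    c ((n / 8 : ℚ) / p ^ 2 + quad (rep r j)) (rep r j)
      = if p ^ 2 ∣ n then c (((n / p ^ 2 : ℕ) : ℚ) / 8 + quad (rep r j)) (rep r j) else 0 := by
  obtain ⟨hp0, -⟩ := natCast_ne_zero_of_prime (p := p)
  split_ifs with h
  · obtain ⟨m, rfl⟩ := h
    rw [Nat.mul_div_cancel_left _ (pow_pos (Fact.out : p.Prime).pos 2)]
    congr 2
    push_cast
    field_simp
  · by_contra h0
    obtain ⟨⟨a, ha⟩, -⟩ := hC.supp _ _ h0
    obtain ⟨b, hb⟩ := exists_eight_mul_quad_rep hr j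
    refine h ?_
    have h1 : (n : ℚ) = p ^ 2 * (8 * a - b) := by
      rw [← hb, ← ha]
      field_simp
      ring
    have h2 : (n : ℤ) = p ^ 2 * (8 * a - b) := by exact_mod_cast h1
    have h3 : ((p ^ 2 : ℕ) : ℤ) ∣ (n : ℤ) := ⟨8 * a - b, by rw [h2]; push_cast; rfl⟩
    exact_mod_cast h3

/-- With `s = (r + 1)/2` one has `κ = k + s`. Evenness of `κ` turns `(-1)^s` into `(-1)^k`, and the
exponent of `p` is `κ - r - 2 + s = k - 1`. -/
theorem legendre_factor {k κ : ℕ} (hp : p ≠ 2) (hκ : 2 * κ = 2 * k + 1 + r) (hev : Even κ) (hr : Odd r)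
    (n : ℕ) :
    (p : ℂ) ^ ((κ : ℤ) - r - 2) * (((jacobiSym (-1) p * (p : ℤ) : ℤ) : ℂ) ^ ((r + 1) / 2)
        * (jacobiSym (2 * 4) p : ℂ) * (legendreRat ((n : ℚ) / 8) p : ℂ))
      = (jacobiSym (((k : ℤ).negOnePow : ℤ) * (n : ℤ)) p : ℂ) * (p : ℂ) ^ ((k : ℤ) - 1) := by
  obtain ⟨-, hpC⟩ := natCast_ne_zero_of_prime (p := p)
  obtain ⟨s, hs⟩ : ∃ s, r + 1 = 2 * s := by
    obtain ⟨t, rfl⟩ := hr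
    exact ⟨t + 1, by ring⟩
  have hs' : (r + 1) / 2 = s := by omega
  have hκ' : κ = k + s := by omega
  have h8 : 8 * ((n : ℚ) / 8) = ((n : ℤ) : ℚ) := by push_cast; ring
  have h4 : ¬ (p : ℤ) ∣ 4 := fun h => by
    rw [show (4 : ℤ) = 2 ^ 2 by norm_num] at h
    exact two_not_dvd hp ((Nat.prime_iff_prime_int.1 Fact.out).dvd_of_dvd_pow h)
  have h1 : jacobiSym (2 * 4) p * jacobiSym (2 * n) p = jacobiSym n p := by
    rw [← jacobiSym.mul_left, ← jacobiSym_sq_mul (b := (n : ℤ)) h4]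
    congr 1
    ring
  have h2 : jacobiSym (-1) p ^ s = jacobiSym ((k : ℤ).negOnePow : ℤ) p := by
    rw [← jacobiSym.pow_left]
    congr 1
    have : (-1 : ℤ) ^ (k + s) = 1 := (hκ' ▸ hev).neg_one_pow
    rw [pow_add] at this
    rw [Int.negOnePow_def, zpow_natCast, Units.val_pow_eq_pow_val, Units.val_neg, Units.val_one]
    have h3 : ((-1 : ℤ) ^ k) ^ 2 = 1 := by rw [← pow_mul, mul_comm, pow_mul]; simp
    linear_combination (-1 : ℤ) ^ k * this - (-1 : ℤ) ^ s * h3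
  have h3 : (p : ℂ) ^ ((κ : ℤ) - r - 2) * (p : ℂ) ^ s = (p : ℂ) ^ ((k : ℤ) - 1) := by
    rw [← zpow_natCast, ← zpow_add₀ hpC]
    congr 1
    omega
  rw [legendreRat_eq hp h8, hs', jacobiSym.mul_left ((k : ℤ).negOnePow : ℤ), ← h1, ← h2, ← h3]
  push_cast
  ring

theorem evenCoeff_heckeCoeff {k κ : ℕ} (hp : p ≠ 2) (hκ : 2 * κ = 2 * k + 1 + r) (hev : Even κ)
    (hr : Odd r) (hC : IsCoeffFamily c) (n : ℕ) :
    evenCoeff (heckeCoeff κ p c) n = evenCoeff c (p ^ 2 * n)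
      + (jacobiSym (((k : ℤ).negOnePow : ℤ) * (n : ℤ)) p : ℂ) * (p : ℂ) ^ ((k : ℤ) - 1)
          * evenCoeff c n
      + (p : ℂ) ^ (2 * (k : ℤ) - 1) * (if p ^ 2 ∣ n then evenCoeff c (n / p ^ 2) else 0) := by
  have h2 : 2 * (κ : ℤ) - r - 2 = 2 * (k : ℤ) - 1 := by omega
  have h3 : (if p ^ 2 ∣ n then evenCoeff c (n / p ^ 2) else 0) = ∑ j, if p ^ 2 ∣ n then
      c (((n / p ^ 2 : ℕ) : ℚ) / 8 + quad (rep r j)) (rep r j) else 0 := by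
    split_ifs
    · rfl
    · simp
  rw [h3, ← legendre_factor hp hκ hev hr]
  simp only [evenCoeff, Finset.mul_sum, ← Finset.sum_add_distrib]
  refine Finset.sum_congr rfl fun j _ => ?_
  rw [heckeCoeff, intDual_mul_coeff_smul hp hr.pos hC, cosetSum_rep hp hr.pos hC,
    coeff_div_sq hr.pos hC, add_sub_cancel_right, h2]
  ring

theorem qExpansion_coeff_eq {f : ℍ → ℂ} {a : ℕ → ℂ}
    (hf : ∀ τ : ℍ, HasSum (fun n : ℕ => a n * e (n * τ)) (f τ)) (n : ℕ) :
    (qExpansion 1 f).coeff n = a n := by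
  have hν : ∀ n : ℕ, a n ≠ 0 → (0 : ℝ) ≤ n := fun n _ => n.cast_nonneg
  have hf' : ∀ τ : ℍ, HasSum (fun n : ℕ => a n * e (((n : ℝ) : ℂ) * τ)) (f τ) := by
    simpa using hf
  have hper : Function.Periodic (f ∘ ofComplex) (1 : ℝ) := by
    intro w
    by_cases hw : 0 < w.im
    · have hw' : 0 < (w + (1 : ℝ)).im := by simpa using hw
      simp only [Function.comp_apply, ofComplex_apply_of_im_pos hw', ofComplex_apply_of_im_pos hw]
      refine (hf _).unique ((hf _).congr_fun fun n => ?_)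
      congr 1
      refine e_congr_int n ?_
      push_cast
      ring
    · have hw' : (w + (1 : ℝ)).im ≤ 0 := by simpa using hw
      simp only [Function.comp_apply, ofComplex_apply_of_im_nonpos hw',
        ofComplex_apply_of_im_nonpos (not_lt.1 hw)]
  have han := analyticAt_cuspFunction_zero one_pos hper
    (mdifferentiable_of_hasSum hν hf') (isBoundedAtImInfty_of_hasSum hν hf')
  -- The uniqueness of `q`-expansions is stated for types of functions with a coercion, which is
  -- here the identity.
  let _ : FunLike (ℍ → ℂ) ℍ ℂ := ⟨id, Function.injective_id⟩
  refine (qExpansion_coeff_unique (F := ℍ → ℂ) f one_pos han (fun τ => ?_) n).symm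
  refine (hf τ).congr_fun fun n => ?_
  rw [smul_eq_mul, e_nat_mul, Function.Periodic.qParam, e]
  simp

theorem evenMap_jacobiHecke {k κ : ℕ} (hp : p ≠ 2) (hκ : 2 * κ = 2 * k + 1 + r) (hev : Even κ)
    (hr : Odd r) (hφ : φ ∈ jacobiForms (κ : ℤ) (latticeD r)) :
    evenMap r (jacobiHecke κ (latticeD r) p φ) = halfIntegralHecke k p (evenMap r φ) := by
  obtain ⟨h, c, hc, -⟩ := id hφ
  have hC := isCoeffFamily_of_mem (by exact_mod_cast hev) hφ hc
  have hH := isFourierExpansion_jacobiHecke (κ := κ) hp hr hC hc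
  have h1 : ∀ τ : ℍ, HasSum (fun n : ℕ => evenCoeff c n * e (n * τ)) (evenMap r φ τ) := fun τ => by
    rw [evenMap_eq, hc.fourierCoeff_eq]
    exact hC.hasSum_evenCoeff (hc.compSummable hr.pos) hr.pos τ
  have h2 : ∀ τ : ℍ, HasSum (fun n : ℕ => evenCoeff (heckeCoeff κ p c) n * e (n * τ))
      (evenMap r (jacobiHecke κ (latticeD r) p φ) τ) := fun τ => by
    rw [evenMap_eq, hH.fourierCoeff_eq]
    exact (hC.heckeCoeff hp).hasSum_evenCoeff (hH.compSummable hr.pos) hr.pos τ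
  funext τ
  rw [halfIntegralHecke, ← (h2 τ).tsum_eq]
  refine tsum_congr fun n => ?_
  rw [evenCoeff_heckeCoeff hp hκ hev hr hC]
  simp only [qExpansion_coeff_eq h1]

end
end JacobiD

/-! ### The proposition -/

open JacobiD

theorem proposition6p2 (r : ℕ) (hr : r = 1 ∨ r = 3 ∨ r = 5 ∨ r = 7) (k : ℤ) (hk : 0 ≤ k)
    (heven : Even (k + ((r : ℤ) + 1) / 2)) :
    (∀ φ ∈ jacobiForms (k + ((r : ℤ) + 1) / 2) (latticeD r), ∀ (τ : ℍ) (z : Fin r → ℂ),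
      φ τ z = ∑ j : Fin 4, thetaComponent (latticeD r) φ (rep r j) (τ : ℂ)
        * latticeTheta (latticeD r) (rep r j) τ z) ∧
    (∃ E : jacobiForms (k + ((r : ℤ) + 1) / 2) (latticeD r) ≃ₗ[ℂ] plusForms k r,
      (∀ φ, (E φ : ℍ → ℂ) = evenMap r φ) ∧
      ∀ p : ℕ, p.Prime → p ≠ 2 → ∀ φ : jacobiForms (k + ((r : ℤ) + 1) / 2) (latticeD r),
        ∃ h : jacobiHecke (k + ((r : ℤ) + 1) / 2) (latticeD r) p φ
            ∈ jacobiForms (k + ((r : ℤ) + 1) / 2) (latticeD r),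
          (E ⟨_, h⟩ : ℍ → ℂ) = halfIntegralHecke k p (E φ)) ∧
    (∃ E₀ : jacobiCuspForms (k + ((r : ℤ) + 1) / 2) (latticeD r) ≃ₗ[ℂ] plusCuspForms k r,
      ∀ φ, (E₀ φ : ℍ → ℂ) = evenMap r φ) := by
  have hodd : Odd r := by rcases hr with rfl | rfl | rfl | rfl <;> decide
  lift k to ℕ using hk
  obtain ⟨κ, hκ⟩ : ∃ κ : ℕ, (k : ℤ) + ((r : ℤ) + 1) / 2 = κ := ⟨k + (r + 1) / 2, by push_cast; rfl⟩
  rw [hκ] at heven ⊢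
  have hev : Even κ := by exact_mod_cast heven
  have hκ' : 2 * κ = 2 * k + 1 + r := by
    obtain ⟨s, rfl⟩ := hodd
    omega
  refine ⟨fun φ hφ τ z => ?_, ⟨evenEquiv hκ' hev hodd, coe_evenEquiv hκ' hev hodd,
    fun p hp hp2 φ => ?_⟩, evenCuspEquiv hκ' hev hodd, coe_evenCuspEquiv hκ' hev hodd⟩
  · obtain ⟨-, c, hc, -⟩ := id hφ
    have h := theta_decomposition hodd.pos heven hφ hc τ z
    rw [← hc.fourierCoeff_eq] at h
    exact h
  · have : Fact p.Prime := ⟨hp⟩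
    exact ⟨jacobiHecke_mem hp2 hodd heven φ.2, evenMap_jacobiHecke hp2 hκ' hev hodd φ.2⟩
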